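/- **Setting.** Let $(\mathbf S,\mathbf M)$ be an oriented marked surface (compact, with finitely many marked points $\mathbf M$, all on $\partial\mathbf S$, at least one on each boundary component) with a triangulation $T$, and let $\mathcal L_T=\{L_\tau : \tau\in T\}$ be an arbitrary principal lamination: for each arc $\tau$ of $T$, $L_\tau$ is a curve that runs along $\tau$ and at both ends of $\tau$ turns in the same direction (both clockwise or both counterclockwise, chosen for each $\tau$ separately) around the end point until it ends on $\partial\mathbf S$. Let $b_\tau=b_T(L_\tau,\tau)\in\{1,-1\}$ be the shear coordinate ($1$ for an $S$-intersection, $-1$ for a $Z$-intersection). Let $x_\tau$ ($\tau$ an arc of $T$ or a boundary segment) and $y_\tau$ ($\tau$ an arc of $T$) be independent variables. **M-paths.** Draw a small horocycle around each marked point. An elementary step of type 1 goes along a horocycle inside a triangle with sides $\tau,\tau',\sigma$ from $\tau$ to $\tau'$ and has the matrix $\begin{pmatrix}1&0\\ \pm x_\sigma/(x_\tau x_{\tau'})&1\end{pmatrix}$ ($+$ if clockwise, $-$ otherwise). A step of type 2 crosses $\tau$ along a horocycle and has the matrix $\mathrm{diag}(y_\tau^{\delta_{-1,b_\tau}},y_\tau^{\delta_{1,b_\tau}})$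 if clockwise and $\mathrm{diag}(y_\tau^{\delta_{1,b_\tau}},y_\tau^{\delta_{-1,b_\tau}})$ otherwise. A step of type 3 goes parallel to $\tau$ from one end of $\tau$ to the other and has the matrix $\begin{pmatrix}0&\pm x_\tau\\ \mp 1/x_\tau&0\end{pmatrix}$ (upper signs if $\tau$ is on the right, lower signs otherwise). An M-path of a generalized arc (closed loop) $\gamma$ is a concatenation (closed concatenation) $\rho=\rho_t\circ\dots\circ\rho_1$ of elementary steps that is homotopic to $\gamma$ (for an arc: to the part of $\gamma$ between the horocycles at its ends) and whose crossings with $T$ are in bijection with those of $\gamma$, where $\gamma$ crosses $T$ minimally. Put $M(\rho)=M(\rho_t)\cdots M(\rho_1)$. **Snake and band graphs.** If $\gamma$ crosses the arcs $\tau_{i_1},\dots,\tau_{i_d}$ of $T$ in this order, its snake graph $\mathcal G_{T,\gamma}$ consists of square tiles $G_1,\dots,G_d$. The tile $G_k$ is a copy of the quadrilateral with diagonal $\tau_{i_k}$, drawn from the NW to the SE corner, so that the triangle which $\gamma$ leaves at this crossing is the SW half; the copy preserves the orientation for odd $k$ and reverses it for even $k$. The edges are labelled by the sides of the quadrilateral,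 and $G_{k+1}$ is glued to the N or E edge of $G_k$ along the third side of the triangle that $\gamma$ passes between the two crossings; diagonals are not edges of the graph. If $\gamma$ is a closed loop, cut at a point off $T$, the band graph $\widetilde{\mathcal G}_{T,\gamma}$ arises by identifying also the edges of $G_1$ and $G_d$ that correspond to the third side of the triangle containing this point. A good matching of the band graph is a perfect matching in which the two ends of the identified edge are matched to each other, or by edges on one and the same side of the cut along it; adding one copy of the identified edge lifts it to a perfect matching of the cut-open snake graph. If $\gamma$ has no crossings (an arc of $T$ or a boundary segment), $\mathcal G_{T,\gamma}$ is a single edge with label $\gamma$. For a perfect (good) matching $P$, $x(P)$ is the product of the $x_\tau$ over the labels $\tau$ of the edges in $P$. The path from the SW vertex of $G_1$ to the NE vertex of $G_d$ that takes alternatingly edges of $P$ (of its lift, for band graphs) and diagonals orients each diagonal down (NW to SE) or up. The diagonal of $G_k$ is $\mathcal L_T$-oriented if it is oriented down and $(-1)^{k+1}b_{\tau_{i_k}}=1$, or up and $(-1)^{k+1}b_{\tau_{i_k}}=-1$. Put $y_{\mathcal L_T}(P)=\prod y_{\tau_{i_k}}$ over the $k$ whose diagonals are $\mathcal L_T$-oriented,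 and $\mathrm{cross}_T(\gamma)=x_{\tau_{i_1}}\cdots x_{\tau_{i_d}}$. **Theorem.** 1. Let $\gamma$ be a generalized arc without contractible kinks. Then $\gamma$ has an M-path, and for every M-path $\rho$ of $\gamma$ the absolute value of the upper right entry (the sign being chosen such that it is a Laurent polynomial with non-negative coefficients) is $$\chi_{\gamma,\mathcal L_T}=|\mathrm{ur}(M(\rho))|=\frac1{\mathrm{cross}_T(\gamma)}\sum_P x(P)\,y_{\mathcal L_T}(P),$$ where $P$ runs over all perfect matchings of $\mathcal G_{T,\gamma}$. If $\gamma$ is an arc, $\chi_{\gamma,\mathcal L_T}$ is the Laurent expansion of the cluster variable $x_\gamma$ in the cluster algebra $\mathcal A_{\mathcal L_T}(\mathbf S,\mathbf M)$ whose initial exchange matrix is the signed adjacency matrix of $T$, extended by rows for the boundary segments and by the rows of shear coordinates $b_T(L_\rho,\cdot)$, $\rho\in T$; that is, whenever a sequence of flips takes $T$ to a triangulation that contains $\gamma$, the corresponding sequence of mutations produces $\chi_{\gamma,\mathcal L_T}$ as the variable at $\gamma$. 2. Let $\gamma$ be a closed loop which is not contractible and has no contractible kinks. Then $\gamma$ has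 an M-path, and for every M-path $\rho$ of $\gamma$ $$\chi_{\gamma,\mathcal L_T}=|\mathrm{tr}(M(\rho))|=\frac1{\mathrm{cross}_T(\gamma)}\sum_P x(P)\,y_{\mathcal L_T}(P),$$ where $P$ runs over all good matchings of $\widetilde{\mathcal G}_{T,\gamma}$ (for every choice of the cutting point). It is a Laurent polynomial with non-negative coefficients. -/

import Mathlib

/-!
# Triangulated orientable marked surfaces, M-paths, snake and band graphs

A triangulated orientable marked surface is presented by its triangles: a finite set of oriented
triangles, whose sides are numbered counterclockwise by `Fin 3`, glued along sides by an
orientation-reversing pairing.  Curves are kept transverse to the triangulation, are recorded by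
the sides through which they cross, and are considered up to the homotopy of such curves.
-/

noncomputable section

/-- A side of a triangle.  It is traversed counterclockwise, i.e. with the triangle on its left.
A side also stands for the corner of the triangle at its tail. -/
abbrev TSide (Tri : Type*) := Tri × Fin 3

namespace TSide

variable {Tri : Type*}

/-- The next side of the same triangle in counterclockwise order (it starts at the head of `s`). -/
def next (s : TSide Tri) : TSide Tri := (s.1, s.2 + 1)

/-- The previous side of the same triangle in counterclockwise order. -/
def prev (s : TSide Tri) : TSide Tri := (s.1, s.2 + 2)

end TSide

open TSide

/-- A triangulated oriented marked surface `(S, M)`: triangles with index set `Tri`, where the side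
`s` is glued to the side `glue s` with tail and head exchanged, and is a boundary segment if
`glue s = s`.  The marked points are the vertices. -/
structure TriangulatedSurface (Tri : Type*) where
  glue : TSide Tri → TSide Tri
  glue_glue : ∀ s, glue (glue s) = s

namespace TriangulatedSurface

variable {Tri : Type*} (T : TriangulatedSurface Tri)

/-! ### Arcs of the triangulation and variables -/

/-- Two sides are the same edge if they are equal or glued. -/
def edgeSetoid : Setoid (TSide Tri) where
  r s t := t = s ∨ t = T.glue s
  iseqv := by
    refine ⟨fun s => Or.inl rfl, ?_, ?_⟩
    · rintro s t (h | h)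
      · exact Or.inl h.symm
      · exact Or.inr (by rw [h, T.glue_glue])
    · rintro s t u (h | h) (h' | h')
      · exact Or.inl (h'.trans h)
      · exact Or.inr (by rw [h', h])
      · exact Or.inr (by rw [h', h])
      · exact Or.inl (by rw [h', h, T.glue_glue])

/-- The edges of the triangulation: its arcs and the boundary segments. -/
def Edge : Type _ := Quotient T.edgeSetoid

/-- The edge on which a side lies. -/
def edge (s : TSide Tri) : T.Edge := Quotient.mk T.edgeSetoid s

instance [Finite Tri] : Finite T.Edge := inferInstanceAs (Finite (Quotient T.edgeSetoid))

/-- A side is interior if it is not a boundary segment, i.e. if it lies on an arc. -/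
def Interior (s : TSide Tri) : Prop := T.glue s ≠ s

/-- The edges that are arcs. -/
def IsArcEdge (τ : T.Edge) : Prop := ∃ s, T.Interior s ∧ T.edge s = τ

/-- Indices of the variables: `Sum.inl τ` for `x_τ` and `Sum.inr τ` for `y_τ` (the latter is used
only if `τ` is an arc). -/
abbrev Var : Type _ := T.Edge ⊕ T.Edge

/-- The field of rational functions in all `x_τ` and `y_τ`. -/
abbrev Fld : Type _ := FractionRing (MvPolynomial T.Var ℚ)

/-- The variable with a given index. -/
def var (i : T.Var) : T.Fld := algebraMap (MvPolynomial T.Var ℚ) T.Fld (MvPolynomial.X i)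

/-- The variable `x_τ`. -/
def x (τ : T.Edge) : T.Fld := T.var (Sum.inl τ)

/-- The variable `y_τ`. -/
def y (τ : T.Edge) : T.Fld := T.var (Sum.inr τ)

/-- `f` is a Laurent polynomial in the variables with coefficients in the natural numbers. -/
def IsPositiveLaurent (f : T.Fld) : Prop :=
  ∃ (p : MvPolynomial T.Var ℕ) (m : T.Var →₀ ℕ),
    f * algebraMap (MvPolynomial T.Var ℚ) T.Fld (MvPolynomial.monomial m 1) =
      algebraMap (MvPolynomial T.Var ℚ) T.Fld (MvPolynomial.map (Nat.castRingHom ℚ) p)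

open Classical in
/-- The absolute value `|f|` of an expression that is positive up to sign. -/
def absL (f : T.Fld) : T.Fld := if T.IsPositiveLaurent f then f else -f

/-! ### Curves -/

/-- `T.IsWalk Δ w Δ'`: a curve that starts in the triangle `Δ` can leave successive triangles
through the sides of the list `w`, and then it ends in the triangle `Δ'`. -/
def IsWalk : Tri → List (TSide Tri) → Tri → Prop
  | Δ, [], Δ' => Δ = Δ'
  | Δ, s :: w, Δ' => s.1 = Δ ∧ T.Interior s ∧ IsWalk (T.glue s).1 w Δ'

/-- A curve between marked points, transverse to the triangulation: it starts at the corner `init`,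
crosses the triangulation through the sides in `word`, and ends at the corner `fin`. -/
@[ext] structure ArcCurve where
  init : TSide Tri
  word : List (TSide Tri)
  fin : TSide Tri
  walk : T.IsWalk init.1 word fin.1

/-- The elementary homotopies between curves with fixed end points: removing two successive
crossings through the same edge, and removing a first or a last crossing of an edge which is
incident to the end point there. -/
inductive ArcMove : T.ArcCurve → T.ArcCurve → Prop
  | backtrack (γ γ' : T.ArcCurve) (u v : List (TSide Tri)) (s : TSide Tri) :
      γ.word = u ++ s :: T.glue s :: v → γ'.word = u ++ v →
      γ'.init = γ.init → γ'.fin = γ.fin → ArcMove γ γ'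
  | initTail (γ γ' : T.ArcCurve) (s : TSide Tri) :
      γ.word = s :: γ'.word → γ.init = s → γ'.init = next (T.glue s) →
      γ'.fin = γ.fin → ArcMove γ γ'
  | initHead (γ γ' : T.ArcCurve) (s : TSide Tri) :
      γ.word = s :: γ'.word → γ.init = next s → γ'.init = T.glue s →
      γ'.fin = γ.fin → ArcMove γ γ'
  | finTail (γ γ' : T.ArcCurve) (s : TSide Tri) :
      γ.word = γ'.word ++ [s] → γ.fin = next (T.glue s) → γ'.fin = s →
      γ'.init = γ.init → ArcMove γ γ'
  | finHead (γ γ' : T.ArcCurve) (s : TSide Tri) :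
      γ.word = γ'.word ++ [s] → γ.fin = T.glue s → γ'.fin = next s →
      γ'.init = γ.init → ArcMove γ γ'

/-- Homotopy of curves between marked points. -/
def ArcHomotopic : T.ArcCurve → T.ArcCurve → Prop := Relation.EqvGen T.ArcMove

/-- The constant curve at a corner. -/
def trivialArc (c : TSide Tri) : T.ArcCurve := ⟨c, [], c, rfl⟩

/-- A generalized arc without contractible kinks, in minimal position with respect to the
triangulation: a non-contractible curve between marked points which has the least number of
crossings among all homotopic curves. -/
def IsGeneralizedArc (γ : T.ArcCurve) : Prop :=
  (∀ γ', T.ArcHomotopic γ γ' → γ.word.length ≤ γ'.word.length) ∧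
    ∀ c, ¬ T.ArcHomotopic γ (T.trivialArc c)

/-- A closed curve transverse to the triangulation, which starts and ends in the triangle `base`
and crosses the triangulation through the sides in `word`. -/
@[ext] structure LoopCurve where
  base : Tri
  word : List (TSide Tri)
  walk : T.IsWalk base word base

/-- The elementary free homotopies of closed curves: removing two successive crossings through
the same edge, and moving the base point across the first crossing. -/
inductive LoopMove : T.LoopCurve → T.LoopCurve → Prop
  | backtrack (γ γ' : T.LoopCurve) (u v : List (TSide Tri)) (s : TSide Tri) :
      γ.word = u ++ s :: T.glue s :: v → γ'.word = u ++ v → γ'.base = γ.base → LoopMove γ γ'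
  | rotate (γ γ' : T.LoopCurve) (s : TSide Tri) (w : List (TSide Tri)) :
      γ.word = s :: w → γ'.word = w ++ [s] → LoopMove γ γ'

/-- Free homotopy of closed curves. -/
def LoopHomotopic : T.LoopCurve → T.LoopCurve → Prop := Relation.EqvGen T.LoopMove

/-- The constant loop in a triangle. -/
def trivialLoop (Δ : Tri) : T.LoopCurve := ⟨Δ, [], rfl⟩

/-- A non-contractible closed loop without contractible kinks, in minimal position. -/
def IsClosedLoop (γ : T.LoopCurve) : Prop :=
  (∀ γ', T.LoopHomotopic γ γ' → γ.word.length ≤ γ'.word.length) ∧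
    ∀ Δ, ¬ T.LoopHomotopic γ (T.trivialLoop Δ)

/-! ### Laminations and shear coordinates -/

/-- A lamination curve joining two points of the boundary away from the marked points: it enters
through the boundary segment `entry`, crosses arcs through `body`, and leaves through the boundary
segment `last`. -/
structure LamCurve where
  entry : TSide Tri
  body : List (TSide Tri)
  last : TSide Tri
  entry_boundary : ¬ T.Interior entry
  last_boundary : ¬ T.Interior last
  walk : T.IsWalk entry.1 body last.1

/-- The list of sides through which a lamination curve leaves triangles. -/
def LamCurve.exits {T : TriangulatedSurface Tri} (ℓ : T.LamCurve) : List (TSide Tri) :=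
  ℓ.body ++ [ℓ.last]

/-- A curve that enters triangles first through `e`, and leaves them through the given sides,
always leaves through the side `turn e`, where `e` is the side of entry.  With `turn = next` it
always turns right, around the head of `e`; with `turn = prev` it always turns left, around the
tail of `e`. -/
def AllTurn (turn : TSide Tri → TSide Tri) : TSide Tri → List (TSide Tri) → Prop
  | _, [] => True
  | e, s :: w => s = turn e ∧ AllTurn turn (T.glue s) w

/-- `ℓ` is a lamination associated to the arc `τ`: it crosses `τ`, runs along `τ` towards both end
points of `τ` and, at both of them, turns in the same direction around the end point (both
clockwise or both counterclockwise) until it ends on the boundary. -/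
def IsElementary (ℓ : T.LamCurve) (τ : T.Edge) : Prop :=
  ∃ (u v : List (TSide Tri)) (s : TSide Tri),
    ℓ.exits = (u ++ [s]) ++ v ∧ T.Interior s ∧ T.edge s = τ ∧
    ((T.AllTurn next ℓ.entry (u ++ [s]) ∧ T.AllTurn prev (T.glue s) v) ∨
      (T.AllTurn prev ℓ.entry (u ++ [s]) ∧ T.AllTurn next (T.glue s) v))

open Classical in
/-- The number of `S`-intersections minus the number of `Z`-intersections with the quadrilateral of
`τ`, for a curve that enters through `e` and leaves successive triangles through the listed sides.
An `S`-intersection is a passage through `τ` which turns right before and left after `τ`, a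
`Z`-intersection one which turns left before and right after `τ`. -/
def shearAux (τ : T.Edge) : TSide Tri → List (TSide Tri) → ℤ
  | e, s :: t :: w =>
      (if T.edge s = τ ∧ s = next e ∧ t = prev (T.glue s) then 1
        else if T.edge s = τ ∧ s = prev e ∧ t = next (T.glue s) then -1 else 0) +
      shearAux τ (T.glue s) (t :: w)
  | _, _ => 0

/-- The shear coordinate `b_T(ℓ, τ)`. -/
def shear (ℓ : T.LamCurve) (τ : T.Edge) : ℤ := T.shearAux τ ℓ.entry ℓ.exits

/-- A principal lamination `L_T = {L_τ : τ ∈ T}`. -/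
structure PrincipalLamination where
  curve : (τ : T.Edge) → T.IsArcEdge τ → T.LamCurve
  elementary : ∀ τ h, T.IsElementary (curve τ h) τ

namespace PrincipalLamination

variable {T} (L : T.PrincipalLamination)

open Classical in
/-- The shear coordinate `b_T(L_ρ, τ)` (zero if `ρ` is a boundary segment). -/
def b (ρ τ : T.Edge) : ℤ := if h : T.IsArcEdge ρ then T.shear (L.curve ρ h) τ else 0

end PrincipalLamination

/-! ### M-paths -/

/-- The points `v^±_{m,τ}`: `(s, false)` and `(s, true)` lie in the triangle of the side `s`, next
to `s`, on the horocycle at the tail and at the head of `s`, respectively. -/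
abbrev MPoint (Tri : Type*) := TSide Tri × Bool

/-- The corner in which a point lies. -/
def MPoint.corner : MPoint Tri → TSide Tri
  | (s, false) => s
  | (s, true) => next s

/-- The three types of elementary steps.  From each point there is exactly one of each type:
`turn` goes along the horocycle through the triangle to its other side at the marked point,
`cross` goes along the horocycle across the side, and `along` goes parallel to the side. -/
inductive StepType
  | turn
  | cross
  | along

/-- The end point of an elementary step. -/
def stepEnd : StepType → MPoint Tri → MPoint Tri
  | .turn, (s, true) => (next s, false)
  | .turn, (s, false) => (prev s, true)
  | .cross, (s, e) => (T.glue s, !e)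
  | .along, (s, e) => (s, !e)

/-- The matrix of an elementary step.  The step `turn` is clockwise if it starts at the head of
`s`, the step `cross` is clockwise if it is at the tail of `s`, and the step `along` sees `s` on
its right if it starts at the tail of `s`. -/
def stepMatrix (L : T.PrincipalLamination) : StepType → MPoint Tri → Matrix (Fin 2) (Fin 2) T.Fld
  | .turn, (s, true) =>
      !![1, 0; T.x (T.edge (prev s)) / (T.x (T.edge s) * T.x (T.edge (next s))), 1]
  | .turn, (s, false) =>
      !![1, 0; -(T.x (T.edge (next s)) / (T.x (T.edge s) * T.x (T.edge (prev s)))), 1]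
  | .cross, (s, false) =>
      !![(if L.b (T.edge s) (T.edge s) = -1 then T.y (T.edge s) else 1), 0;
        0, (if L.b (T.edge s) (T.edge s) = 1 then T.y (T.edge s) else 1)]
  | .cross, (s, true) =>
      !![(if L.b (T.edge s) (T.edge s) = 1 then T.y (T.edge s) else 1), 0;
        0, (if L.b (T.edge s) (T.edge s) = -1 then T.y (T.edge s) else 1)]
  | .along, (s, false) => !![0, T.x (T.edge s); -(1 / T.x (T.edge s)), 0]
  | .along, (s, true) => !![0, -T.x (T.edge s); 1 / T.x (T.edge s), 0]

/-- The end point of a concatenation of elementary steps (the head of the list is done first). -/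
def pathEnd : MPoint Tri → List StepType → MPoint Tri
  | p, [] => p
  | p, k :: ks => pathEnd (T.stepEnd k p) ks

/-- The sides crossed by a concatenation of elementary steps. -/
def pathWord : MPoint Tri → List StepType → List (TSide Tri)
  | _, [] => []
  | p, .cross :: ks => p.1 :: pathWord (T.stepEnd .cross p) ks
  | p, k :: ks => pathWord (T.stepEnd k p) ks

/-- The matrix `M(ρ) = M(ρ_t) ⋯ M(ρ_1)`. -/
def pathMatrix (L : T.PrincipalLamination) :
    MPoint Tri → List StepType → Matrix (Fin 2) (Fin 2) T.Fld
  | _, [] => 1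
  | p, k :: ks => pathMatrix L (T.stepEnd k p) ks * T.stepMatrix L k p

/-- A path of elementary steps. -/
structure MPath (Tri : Type*) where
  start : MPoint Tri
  steps : List StepType

/-- `ρ` is an M-path of the generalized arc `γ`: continued to the marked points at its two ends, it
is a curve that is homotopic to `γ`, and it has as many crossings with the triangulation as `γ`. -/
def IsMPathOfArc (ρ : MPath Tri) (γ : T.ArcCurve) : Prop :=
  ∃ δ : T.ArcCurve,
    δ.init = MPoint.corner ρ.start ∧ δ.word = T.pathWord ρ.start ρ.steps ∧
    δ.fin = MPoint.corner (T.pathEnd ρ.start ρ.steps) ∧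
    T.ArcHomotopic δ γ ∧ δ.word.length = γ.word.length

/-- `ρ` is an M-path of the closed loop `γ`: it is closed, freely homotopic to `γ`, and has as many
crossings with the triangulation as `γ`. -/
def IsMPathOfLoop (ρ : MPath Tri) (γ : T.LoopCurve) : Prop :=
  T.pathEnd ρ.start ρ.steps = ρ.start ∧
  ∃ δ : T.LoopCurve,
    δ.base = ρ.start.1.1 ∧ δ.word = T.pathWord ρ.start ρ.steps ∧
    T.LoopHomotopic δ γ ∧ δ.word.length = γ.word.length

/-- `|ur(M(ρ))|`. -/
def chiArc (L : T.PrincipalLamination) (ρ : MPath Tri) : T.Fld :=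
  T.absL (T.pathMatrix L ρ.start ρ.steps 0 1)

/-- `|tr(M(ρ))|`. -/
def chiLoop (L : T.PrincipalLamination) (ρ : MPath Tri) : T.Fld :=
  T.absL (T.pathMatrix L ρ.start ρ.steps).trace

/-! ### Snake graphs and band graphs -/

/-- A unit square tile of a snake graph with south-west corner `pos`.  It is a copy of the
quadrilateral around the edge of the side `s`: the triangle of `s` is its south-west half, that of
`glue s` is its north-east half, and its diagonal, from the north-west to the south-east corner, is
the edge of `s`.  The copy preserves the orientation if `odd` is true, and reverses it otherwise. -/
structure Tile (Tri : Type*) where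
  pos : ℤ × ℤ
  s : TSide Tri
  odd : Bool

namespace Tile

variable (t : Tile Tri)

def sw : ℤ × ℤ := t.pos
def se : ℤ × ℤ := t.pos + (1, 0)
def nw : ℤ × ℤ := t.pos + (0, 1)
def ne : ℤ × ℤ := t.pos + (1, 1)

end Tile

/-- Edges of snake graphs: the two ends and the label. -/
abbrev SnakeEdge : Type _ := (ℤ × ℤ) × (ℤ × ℤ) × T.Edge

def southEdge (t : Tile Tri) : T.SnakeEdge :=
  (t.sw, t.se, T.edge (if t.odd then prev t.s else next t.s))
def westEdge (t : Tile Tri) : T.SnakeEdge :=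
  (t.sw, t.nw, T.edge (if t.odd then next t.s else prev t.s))
def eastEdge (t : Tile Tri) : T.SnakeEdge :=
  (t.se, t.ne, T.edge (if t.odd then next (T.glue t.s) else prev (T.glue t.s)))
def northEdge (t : Tile Tri) : T.SnakeEdge :=
  (t.nw, t.ne, T.edge (if t.odd then prev (T.glue t.s) else next (T.glue t.s)))

open Classical in
/-- After crossing through `s`, a curve crosses the third triangle side through `s'`.  Whether the
third side of that triangle (not `glue s`, not `s'`) is the north edge (otherwise: the east edge)
of the tile of `s` with the given parity. -/
def gluesNorth (odd : Bool) (s s' : TSide Tri) : Bool :=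
  decide (s' = next (T.glue s)) == odd

/-- The tiles of the snake graph for a list of crossings, where the first tile has the given
position and parity.  Each tile is glued to the previous one along the third side of the triangle
that contains the segment of the curve between the two crossings. -/
def tilesFrom : ℤ × ℤ → Bool → List (TSide Tri) → List (Tile Tri)
  | _, _, [] => []
  | p, o, [s] => [⟨p, s, o⟩]
  | p, o, s :: s' :: w =>
      ⟨p, s, o⟩ ::
        tilesFrom (p + if T.gluesNorth o s s' then (0, 1) else (1, 0)) (!o) (s' :: w)

/-- The tiles `G_1, …, G_d`; tiles with an odd number preserve the orientation. -/
def tiles (w : List (TSide Tri)) : List (Tile Tri) := T.tilesFrom (0, 0) true w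

open Classical in
/-- The edges of the snake graph. -/
def snakeEdges (w : List (TSide Tri)) : Finset T.SnakeEdge :=
  (T.tiles w).toFinset.biUnion fun t =>
    {T.southEdge t, T.westEdge t, T.eastEdge t, T.northEdge t}

variable {T} in
/-- A vertex is covered by a set of edges. -/
def Covers (P : Finset T.SnakeEdge) (v : ℤ × ℤ) : Prop := ∃ e ∈ P, e.1 = v ∨ e.2.1 = v

/-- `P` is a perfect matching of the snake graph. -/
def IsPerfectMatching (w : List (TSide Tri)) (P : Finset T.SnakeEdge) : Prop :=
  P ⊆ T.snakeEdges w ∧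
    ∀ v, Covers (T.snakeEdges w) v → ∃! e, e ∈ P ∧ (e.1 = v ∨ e.2.1 = v)

/-- The weight monomial `x(P)`. -/
def xMon (P : Finset T.SnakeEdge) : T.Fld := ∏ e ∈ P, T.x e.2.2

variable {T} in
/-- Two vertices are joined by an edge of `P`. -/
def Joined (P : Finset T.SnakeEdge) (u v : ℤ × ℤ) : Prop :=
  ∃ e ∈ P, (e.1 = u ∧ e.2.1 = v) ∨ (e.1 = v ∧ e.2.1 = u)

variable {T} in
/-- There is a path from the vertex `u` to the vertex `goal` which takes alternatingly edges of `P`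
and the diagonals of the listed tiles, where each diagonal is traversed downwards or upwards as
prescribed (`true`: downwards). -/
def AltPath (P : Finset T.SnakeEdge) (goal : ℤ × ℤ) : ℤ × ℤ → List (Tile Tri × Bool) → Prop
  | u, [] => Joined P u goal
  | u, (t, down) :: l =>
      Joined P u (if down then t.nw else t.se) ∧ AltPath P goal (if down then t.se else t.nw) l

/-- With respect to the perfect matching `P` of the snake graph, the diagonal of the tile `G_{k+1}`
is oriented downwards (`down = true`) or upwards (`down = false`): so it is traversed by the
alternating path from the south-west vertex of `G_1` to the north-east vertex of `G_d`. -/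
def DiagOriented (w : List (TSide Tri)) (P : Finset T.SnakeEdge) (k : ℕ) (down : Bool) : Prop :=
  ∃ (o : List Bool) (t t' : Tile Tri), o.length = w.length ∧
    (T.tiles w).head? = some t ∧ (T.tiles w).getLast? = some t' ∧
    AltPath P t'.ne t.sw ((T.tiles w).zip o) ∧ o[k]? = some down

/-- The diagonal of the tile `G_{k+1}`, which is the edge `τ`, is `L_T`-oriented.  The tile is
indexed odd if `k` is even. -/
def LOriented (L : T.PrincipalLamination) (w : List (TSide Tri)) (P : Finset T.SnakeEdge)
    (k : ℕ) (τ : T.Edge) : Prop :=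
  (Even k ∧ ((L.b τ τ = 1 ∧ T.DiagOriented w P k true) ∨
    (L.b τ τ = -1 ∧ T.DiagOriented w P k false))) ∨
  (Odd k ∧ ((L.b τ τ = 1 ∧ T.DiagOriented w P k false) ∨
    (L.b τ τ = -1 ∧ T.DiagOriented w P k true)))

open Classical in
/-- The coefficient monomial `y_{L_T}(P)` of a perfect matching of the snake graph. -/
def yMon (L : T.PrincipalLamination) (w : List (TSide Tri)) (P : Finset T.SnakeEdge) : T.Fld :=
  ∏ k : Fin w.length,
    if T.LOriented L w P k (T.edge (w.get k)) then T.y (T.edge (w.get k)) else 1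

/-- The crossing monomial. -/
def crossMon (w : List (TSide Tri)) : T.Fld := (w.map fun s => T.x (T.edge s)).prod

open Classical in
/-- The snake graph expansion `cross(γ)⁻¹ ∑_P x(P) y(P)` of a generalized arc.  If the arc has no
crossings, then it joins two corners of one triangle along an edge of the triangulation, its snake
graph is a single edge with that label, and the crossing monomial is `1`. -/
def snakeExpansion (L : T.PrincipalLamination) (γ : T.ArcCurve) : T.Fld :=
  if γ.word = [] then
    (if γ.fin = next γ.init then T.x (T.edge γ.init) else T.x (T.edge γ.fin))
  else
    1 / T.crossMon γ.word *
      ∑ P ∈ (T.snakeEdges γ.word).powerset with T.IsPerfectMatching γ.word P,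
        T.xMon P * T.yMon L γ.word P

open Classical in
/-- The glued edge of the band graph as an edge `a` of the first tile `t`: the third side of the
triangle in which the loop, having crossed through `s_d` at last, crosses through `s_1` again. -/
def bandFirst (t t' : Tile Tri) : T.SnakeEdge :=
  if t.s = next (T.glue t'.s) then T.westEdge t else T.southEdge t

/-- The glued edge of the band graph as an edge `a'` of the last tile `t'`. -/
def bandLast (t t' : Tile Tri) : T.SnakeEdge :=
  if T.gluesNorth t'.odd t'.s t.s then T.northEdge t' else T.eastEdge t'

variable {T} in
/-- The identification of the vertices of `a'` with those of `a`. -/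
def bandVertex (a a' : T.SnakeEdge) (v : ℤ × ℤ) : ℤ × ℤ :=
  if v = a'.1 then a.1 else if v = a'.2.1 then a.2.1 else v

open Classical in
/-- `P` is a good matching of the band graph that arises from the snake graph of `w` by
identification of the edges `a` and `a'` (and of their vertices); the identified edge is represented
by `a`.  It is a perfect matching of the band graph, and the two ends of the identified edge are
matched on the same side of the cut along this edge. -/
def IsGoodMatching (w : List (TSide Tri)) (a a' : T.SnakeEdge) (P : Finset T.SnakeEdge) : Prop :=
  P ⊆ (T.snakeEdges w).erase a' ∧
  (∀ v, Covers (T.snakeEdges w) v →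
    ∃! e, e ∈ P ∧ (bandVertex a a' e.1 = bandVertex a a' v ∨
      bandVertex a a' e.2.1 = bandVertex a a' v)) ∧
  ((Covers P a.1 ∧ Covers P a.2.1) ∨ (Covers P a'.1 ∧ Covers P a'.2.1))

open Classical in
/-- The perfect matching of the snake graph, cut open along the identified edge, that is obtained
from a good matching of the band graph by adding the copy of the identified edge at the end of the
snake graph that is not matched yet. -/
def bandLift (a a' : T.SnakeEdge) (P : Finset T.SnakeEdge) : Finset T.SnakeEdge :=
  if Covers P a.1 ∧ Covers P a.2.1 then insert a' P else insert a P

open Classical in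
/-- The band graph expansion `cross(γ)⁻¹ ∑_P x(P) y(P)` of a closed loop with at least one crossing
(the value is `0` by convention if there is none). -/
def bandExpansion (L : T.PrincipalLamination) (γ : T.LoopCurve) : T.Fld :=
  match (T.tiles γ.word).head?, (T.tiles γ.word).getLast? with
  | some t, some t' =>
      1 / T.crossMon γ.word *
        ∑ P ∈ (T.snakeEdges γ.word).powerset with
            T.IsGoodMatching γ.word (T.bandFirst t t') (T.bandLast t t') P,
          T.xMon P * T.yMon L γ.word (T.bandLift (T.bandFirst t t') (T.bandLast t t') P)
  | _, _ => 0

/-! ### The cluster algebra -/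

/-- A seed: the cluster and frozen variables, indexed by all edges and by the laminations, and the
extended exchange matrix, with rows indexed in the same way.  Only the arcs are mutable. -/
structure Seed where
  cluster : T.Var → T.Fld
  B : T.Var → T.Edge → ℤ

variable {T} in
open Classical in
/-- Mutation of a seed in direction `k`. -/
def Seed.mutate [Finite Tri] (σ : T.Seed) (k : T.Edge) : T.Seed where
  cluster i :=
    letI := Fintype.ofFinite T.Var
    if i = Sum.inl k then
      ((∏ j, σ.cluster j ^ (σ.B j k).toNat) + ∏ j, σ.cluster j ^ (-σ.B j k).toNat) /
        σ.cluster (Sum.inl k)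
    else σ.cluster i
  B i j :=
    if i = Sum.inl k ∨ j = k then -σ.B i j
    else σ.B i j + (max (σ.B i k) 0 * max (σ.B (Sum.inl k) j) 0 -
      max (-σ.B i k) 0 * max (-σ.B (Sum.inl k) j) 0)

open Classical in
/-- The initial seed of the cluster algebra of the surface with coefficients from the principal
lamination: the rows of the arcs and boundary segments form the signed adjacency matrix (an entry
`b_{ij}` counts the triangles in which the side `j` follows the side `i` clockwise, minus those in
which it does so counterclockwise), and the other rows are formed by shear coordinates. -/
def initialSeed [Finite Tri] (L : T.PrincipalLamination) : T.Seed where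
  cluster := T.var
  B
    | .inl i, j =>
        (Nat.card {s : TSide Tri // T.edge (next s) = i ∧ T.edge s = j} : ℤ) -
          Nat.card {s : TSide Tri // T.edge (prev s) = i ∧ T.edge s = j}
    | .inr ρ, j => L.b ρ j

/-- A triangulation `T'` of the surface, with its seed: the gluing of its triangles, the label (the
index of the variable) of each side, the curve in the surface that runs along each side from tail
to head, and the seed. -/
structure Stage where
  surf : TriangulatedSurface Tri
  label : TSide Tri → T.Edge
  curve : TSide Tri → T.ArcCurve
  seed : T.Seed

/-- The initial triangulation `T`. -/
def initialStage [Finite Tri] (L : T.PrincipalLamination) : T.Stage where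
  surf := T
  label := T.edge
  curve s := ⟨s, [], next s, rfl⟩
  seed := T.initialSeed L

/-- `c` is homotopic to the concatenation of `a` and `b`. -/
def IsConcat (a b c : T.ArcCurve) : Prop :=
  ∃ a' b' c' : T.ArcCurve, T.ArcHomotopic a a' ∧ T.ArcHomotopic b b' ∧ T.ArcHomotopic c c' ∧
    a'.fin = b'.init ∧ c'.init = a'.init ∧ c'.word = a'.word ++ b'.word ∧ c'.fin = b'.fin

open Classical in
/-- In a flip of the arc of the side `s`, glued to `s'`, the two triangles get the sides
`s, prev s, next s'` and `s', prev s', next s` in counterclockwise order.  The function gives the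
old position of the side that is at the position `t` after the flip. -/
def flipPos (s s' t : TSide Tri) : TSide Tri :=
  if t = next s then prev s
  else if t = prev s then next s'
  else if t = next s' then prev s'
  else if t = prev s' then next s
  else t

variable {T} in
/-- `A'` arises from `A` by a flip of the arc of the side `s` (an arc that separates two distinct
triangles) and mutation of the seed at this arc.  The new diagonal is homotopic to the concatenation
of two successive sides of the quadrilateral, for each of its two orientations. -/
def IsFlip [Finite Tri] (A A' : T.Stage) (s : TSide Tri) : Prop :=
  let s' := A.surf.glue s
  s'.1 ≠ s.1 ∧
  (∀ t, flipPos s s' (A'.surf.glue t) = A.surf.glue (flipPos s s' t)) ∧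
  (∀ t, A'.label t = A.label (flipPos s s' t)) ∧
  (∀ t, t ≠ s → t ≠ s' → A'.curve t = A.curve (flipPos s s' t)) ∧
  T.IsConcat (A.curve (prev s')) (A.curve (next s)) (A'.curve s) ∧
  T.IsConcat (A.curve (prev s)) (A.curve (next s')) (A'.curve s') ∧
  A'.seed = A.seed.mutate (A.label s)

/-- The triangulations, with seeds, that are reached from `T` by sequences of flips. -/
def Reachable [Finite Tri] (L : T.PrincipalLamination) : T.Stage → Prop :=
  Relation.ReflTransGen (fun A A' => ∃ s, IsFlip A A' s) (T.initialStage L)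

/-- `z` is the cluster variable `x_γ` of the arc `γ`: the arc `γ` belongs to some triangulation that
is reached from `T` by flips, and `z` is the variable of `γ` in the seed of this triangulation. -/
def IsClusterVariable [Finite Tri] (L : T.PrincipalLamination) (γ : T.ArcCurve)
    (z : T.Fld) : Prop :=
  ∃ A, T.Reachable L A ∧
    ∃ s, T.ArcHomotopic (A.curve s) γ ∧ A.seed.cluster (Sum.inl (A.label s)) = z

end TriangulatedSurface

end

noncomputable section

open TSide

/-! ### Positive rational functions and their order in each coefficient variable -/

namespace TriangulatedSurface

variable {Tri : Type*} (T : TriangulatedSurface Tri)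

/-! ### Polynomials with natural coefficients and positive rational functions -/

/-! Transport. Give the three corners of each triangle plane vectors whose pairwise determinants
are, up to sign, the variables of the sides (`det_cornerVec`), and give each point near a corner a
frame of determinant one whose second column is the vector of the corner. Steps inside a triangle
are then mere changes of frame, up to sign, and a crossing is a transport depending only on the
side. Hence the matrix of an M-path is, up to sign, the inverse end frame times the transport along
the crossed sides times the start frame (`pathMatrix_eqNeg`). Its upper right entry depends only on
the crossings and the two end corners; for a closed path its trace depends only on the crossings.

Matchings. The vertices of a snake graph lie on levels `x + y`, every edge climbs one level, and
each inner level consists of the two ends of one diagonal. A perfect matching is therefore a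
sequence of binary states, one for each tile, the state being the end at which the alternating path
enters the diagonal. The weighted sum over matchings is a product of two by two transfer matrices
(`sum_perfectMatchings`). After a diagonal rescaling these are exactly the changes of frame in the
triangles passed (`frame_turn_eq`) and the crossing matrices. So for a curve in minimal position the
upper right entry is the snake graph sum divided by the crossing monomial (`frame_transport_arc`).
For a band graph the closing turn makes it a trace (`sum_goodMatchings`, `bandExpansion_eq`,
`trace_transport`).

Homotopy. An M-path may run through another word than the given curve, so invariance is needed.
Crossing an arc has determinant `y`; after `y ↦ y²` it can be scaled to determinant one. The
principal lamination forces every marked point to lie on the boundary, so rotation about a marked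
point has an end from which compatible frames can be propagated (`exists_framing`). This yields a
holonomy in `SL2` that is exactly homotopy invariant. An expansion equals an entry or trace of it up
to sign and a Laurent monomial in the `y`. But numerators have natural coefficients and are
divisible by no `y_ρ`: the matching with a suitable constant state avoids `y_ρ`. So every expansion
has order zero in each `y_ρ`, which fixes the monomial, while positivity fixes the sign
(`eq_of_eqNeg_ymon`).

Clusters. The upper right entries of the holonomies along the sides of a triangulation are signed
lambda lengths, and a flip acts on them by the Plücker relation (`SL2.pluecker`). The invariant
`StageData` says that a cluster variable is the lambda length rescaled by a monomial in the `y` to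
order zero, and that the coefficient rows `b` satisfy `2 b_j = -∑ B_ij t_i`, with `t` the rescaling
exponents. Mutation preserves this because the order of a sum of positive functions is the minimum
of the orders (`row_mutation`, `cluster_mutate`). A cluster variable and the expansion of the same
arc thus both have order zero and come from the same holonomy entry, so they agree. -/

/-- The embedding of polynomials with natural coefficients into the field of rational functions. -/
def natPoly : MvPolynomial T.Var ℕ →+* T.Fld :=
  (algebraMap (MvPolynomial T.Var ℚ) T.Fld).comp (MvPolynomial.map (Nat.castRingHom ℚ))

theorem natPoly_injective : Function.Injective T.natPoly := by
  refine (IsFractionRing.injective (MvPolynomial T.Var ℚ) T.Fld).comp ?_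
  exact MvPolynomial.map_injective _ Nat.cast_injective

theorem natPoly_X (i : T.Var) : T.natPoly (MvPolynomial.X i) = T.var i := by
  simp [natPoly, var]

theorem natPoly_ne_zero {p : MvPolynomial T.Var ℕ} (hp : p ≠ 0) : T.natPoly p ≠ 0 := fun h =>
  hp (T.natPoly_injective (by rw [h, map_zero]))

theorem var_ne_zero (i : T.Var) : T.var i ≠ 0 := by
  rw [← natPoly_X]
  exact T.natPoly_ne_zero (MvPolynomial.X_ne_zero i)

theorem x_ne_zero (τ : T.Edge) : T.x τ ≠ 0 := T.var_ne_zero _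

theorem y_ne_zero (τ : T.Edge) : T.y τ ≠ 0 := T.var_ne_zero _

variable {T} in
theorem exists_eq_monomial_add {p : MvPolynomial T.Var ℕ} (hp : p ≠ 0) :
    ∃ m q, p = MvPolynomial.monomial m 1 + q := by
  obtain ⟨m, hm⟩ := MvPolynomial.ne_zero_iff.1 hp
  obtain ⟨c, hc⟩ := Nat.exists_eq_succ_of_ne_zero hm
  classical
  have hmem : m ∈ p.support := MvPolynomial.mem_support_iff.2 hm
  refine ⟨m, MvPolynomial.monomial m c +
    ∑ v ∈ p.support.erase m, MvPolynomial.monomial v (p.coeff v), ?_⟩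
  conv_lhs => rw [p.as_sum, ← Finset.add_sum_erase _ _ hmem, hc]
  rw [← add_assoc, ← map_add, add_comm 1 c]

-- A positive natural coefficient maps to the unit of the idempotent semiring `Tropical ℕ∞`, so only
-- exponents are seen. This is why coefficients are taken in `ℕ`: the least exponent becomes a
-- semiring homomorphism.
variable {T} in
open Classical in
/-- Tropical evaluation: the least exponent of `y_ρ`. -/
def tropEval (ρ : T.Edge) : MvPolynomial T.Var ℕ →+* Tropical ℕ∞ :=
  MvPolynomial.eval₂Hom (Nat.castRingHom _)
    (fun i => if i = Sum.inr ρ then Tropical.trop 1 else 1)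

variable {T} in
/-- The least exponent of `y_ρ` in the monomials of a polynomial. -/
def yOrder (ρ : T.Edge) (p : MvPolynomial T.Var ℕ) : ℕ := (Tropical.untrop (tropEval ρ p)).toNat

variable {T} in
theorem tropEval_ne_top (ρ : T.Edge) {p : MvPolynomial T.Var ℕ} (hp : p ≠ 0) :
    Tropical.untrop (tropEval ρ p) ≠ ⊤ := by
  classical
  obtain ⟨m, q, rfl⟩ := exists_eq_monomial_add hp
  rw [map_add, Tropical.untrop_add]
  have h : Tropical.untrop (tropEval ρ (MvPolynomial.monomial m 1)) ≠ ⊤ := by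
    have key : ∀ i : T.Var,
        Tropical.untrop (if i = Sum.inr ρ then Tropical.trop (1 : ℕ∞) else 1) ≠ ⊤ := by
      intro i
      split_ifs
      · simp
      · rw [Tropical.untrop_one]; simp
    have hmul : ∀ a b : Tropical ℕ∞, a.untrop ≠ ⊤ → b.untrop ≠ ⊤ → (a * b).untrop ≠ ⊤ := by
      intro a b ha hb
      rw [Tropical.untrop_mul]
      exact WithTop.add_ne_top.2 ⟨ha, hb⟩
    have hone : (1 : Tropical ℕ∞).untrop ≠ ⊤ := by rw [Tropical.untrop_one]; simp
    simp only [tropEval, MvPolynomial.coe_eval₂Hom, MvPolynomial.eval₂_monomial, map_one, one_mul]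
    refine Finset.prod_induction _ (fun a => Tropical.untrop a ≠ ⊤) hmul hone ?_
    intro i _
    change Tropical.untrop (_ ^ (m i)) ≠ ⊤
    induction m i with
    | zero => simp
    | succ n ih => rw [pow_succ]; exact hmul _ _ ih (key i)
  exact fun h' => h (min_eq_top.1 h').1

variable {T} in
theorem yOrder_mul (ρ : T.Edge) {p q : MvPolynomial T.Var ℕ} (hp : p ≠ 0) (hq : q ≠ 0) :
    yOrder ρ (p * q) = yOrder ρ p + yOrder ρ q := by
  rw [yOrder, map_mul, Tropical.untrop_mul,
    ENat.toNat_add (tropEval_ne_top ρ hp) (tropEval_ne_top ρ hq)]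
  rfl

-- Natural coefficients do not cancel, so the order of a sum is exactly the minimum, not merely
-- bounded below by it. The hypotheses exclude the zero polynomial, whose order is the junk value
-- `0`.
variable {T} in
theorem yOrder_add (ρ : T.Edge) {p q : MvPolynomial T.Var ℕ} (hp : p ≠ 0) (hq : q ≠ 0) :
    yOrder ρ (p + q) = min (yOrder ρ p) (yOrder ρ q) := by
  obtain ⟨a, ha⟩ := WithTop.ne_top_iff_exists.1 (tropEval_ne_top ρ hp)
  obtain ⟨b, hb⟩ := WithTop.ne_top_iff_exists.1 (tropEval_ne_top ρ hq)
  rw [yOrder, yOrder, yOrder, map_add, Tropical.untrop_add, ← ha, ← hb]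
  change (min (a : ℕ∞) (b : ℕ∞)).toNat = min (a : ℕ∞).toNat (b : ℕ∞).toNat
  rcases le_total a b with h | h
  · have h' : (a : ℕ∞) ≤ b := by exact_mod_cast h
    simp [min_eq_left h', min_eq_left h]
  · have h' : (b : ℕ∞) ≤ a := by exact_mod_cast h
    simp [min_eq_right h', min_eq_right h]

variable {T} in
open Classical in
theorem yOrder_X (ρ : T.Edge) (i : T.Var) :
    yOrder ρ (MvPolynomial.X i) = if i = Sum.inr ρ then 1 else 0 := by
  simp only [yOrder, tropEval, MvPolynomial.coe_eval₂Hom, MvPolynomial.eval₂_X]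
  split_ifs
  · simp
  · rw [Tropical.untrop_one]; simp

variable {T} in
theorem yOrder_one (ρ : T.Edge) : yOrder ρ 1 = 0 := by
  rw [yOrder, map_one, Tropical.untrop_one]; simp

theorem natPoly_add_ne_zero {p q : MvPolynomial T.Var ℕ} (hp : p ≠ 0) : p + q ≠ 0 := by
  obtain ⟨m, hm⟩ := MvPolynomial.ne_zero_iff.1 hp
  refine MvPolynomial.ne_zero_iff.2 ⟨m, ?_⟩
  rw [MvPolynomial.coeff_add]
  omega

variable {T} in
/-- `f` is a nonzero quotient of polynomials with natural coefficients, with `y_ρ`-order `t ρ`. -/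
def HasOrder (f : T.Fld) (t : T.Edge → ℤ) : Prop :=
  ∃ p q : MvPolynomial T.Var ℕ, p ≠ 0 ∧ q ≠ 0 ∧ f * T.natPoly q = T.natPoly p ∧
    ∀ ρ, (yOrder ρ p : ℤ) = yOrder ρ q + t ρ

namespace HasOrder

variable {T} {f g : T.Fld} {t t' : T.Edge → ℤ}

theorem of_natPoly {p : MvPolynomial T.Var ℕ} (hp : p ≠ 0) :
    HasOrder (T.natPoly p) (fun ρ => (yOrder ρ p : ℤ)) :=
  ⟨p, 1, hp, one_ne_zero, by simp, fun ρ => by simp [yOrder_one]⟩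

theorem one : HasOrder (1 : T.Fld) 0 :=
  ⟨1, 1, one_ne_zero, one_ne_zero, by simp, fun ρ => by simp⟩

theorem x (τ : T.Edge) : HasOrder (T.x τ) 0 := by
  have h := of_natPoly (T := T) (MvPolynomial.X_ne_zero (Sum.inl τ))
  rw [natPoly_X] at h
  refine (congrArg (HasOrder _) ?_).mp h
  funext ρ
  simp [yOrder_X]

open Classical in
theorem y (τ : T.Edge) : HasOrder (T.y τ) (Pi.single τ 1) := by
  have h := of_natPoly (T := T) (MvPolynomial.X_ne_zero (Sum.inr τ))
  rw [natPoly_X] at h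
  refine (congrArg (HasOrder _) ?_).mp h
  funext ρ
  by_cases hρ : τ = ρ
  · subst hρ; simp [yOrder_X]
  · simp [yOrder_X, hρ, Ne.symm hρ]

theorem mul (hf : HasOrder f t) (hg : HasOrder g t') : HasOrder (f * g) (t + t') := by
  obtain ⟨p, q, hp, hq, h, ht⟩ := hf
  obtain ⟨p', q', hp', hq', h', ht'⟩ := hg
  refine ⟨p * p', q * q', mul_ne_zero hp hp', mul_ne_zero hq hq', ?_, fun ρ => ?_⟩
  · rw [map_mul, map_mul, ← h, ← h']; ring
  · rw [yOrder_mul _ hp hp', yOrder_mul _ hq hq']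
    push_cast
    rw [ht, ht']
    simp only [Pi.add_apply]
    ring

theorem ne_zero (hf : HasOrder f t) : f ≠ 0 := by
  rintro rfl
  obtain ⟨p, q, hp, hq, h, ht⟩ := hf
  exact T.natPoly_ne_zero hp (by rw [← h, zero_mul])

theorem inv (hf : HasOrder f t) : HasOrder f⁻¹ (-t) := by
  have h0 := hf.ne_zero
  obtain ⟨p, q, hp, hq, h, ht⟩ := hf
  refine ⟨q, p, hq, hp, ?_, fun ρ => ?_⟩
  · rw [← h]; field_simp
  · rw [ht]; simp

theorem div (hf : HasOrder f t) (hg : HasOrder g t') : HasOrder (f / g) (t - t') := by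
  rw [div_eq_mul_inv, sub_eq_add_neg]
  exact hf.mul hg.inv

theorem add (hf : HasOrder f t) (hg : HasOrder g t') :
    HasOrder (f + g) (fun ρ => min (t ρ) (t' ρ)) := by
  obtain ⟨p, q, hp, hq, h, ht⟩ := hf
  obtain ⟨p', q', hp', hq', h', ht'⟩ := hg
  refine ⟨p * q' + p' * q, q * q', T.natPoly_add_ne_zero (mul_ne_zero hp hq'),
    mul_ne_zero hq hq', ?_, fun ρ => ?_⟩
  · rw [map_add, map_mul, map_mul, map_mul, ← h, ← h']; ring
  · rw [yOrder_add _ (mul_ne_zero hp hq') (mul_ne_zero hp' hq), yOrder_mul _ hp hq',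
      yOrder_mul _ hp' hq, yOrder_mul _ hq hq']
    push_cast
    have h1 := ht ρ
    have h2 := ht' ρ
    omega

theorem unique (hf : HasOrder f t) (hf' : HasOrder f t') : t = t' := by
  obtain ⟨p, q, hp, hq, h, ht⟩ := hf
  obtain ⟨p', q', hp', hq', h', ht'⟩ := hf'
  have key : p * q' = p' * q := by
    apply T.natPoly_injective
    rw [map_mul, map_mul, ← h, ← h']; ring
  funext ρ
  have := congrArg (yOrder ρ) key
  rw [yOrder_mul _ hp hq', yOrder_mul _ hp' hq] at this
  have h1 := ht ρ
  have h2 := ht' ρ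
  omega

/-- A sum of two positive functions is nonzero, whereas `f + (-f) = 0`. This is what resolves all
sign ambiguities in the sequel. -/
theorem not_neg (hf : HasOrder f t) (hf' : HasOrder (-f) t') : False := by
  have := (hf.add hf').ne_zero
  simp at this

theorem eq_of_eq_or_neg (hf : HasOrder f t) (hg : HasOrder g t') (h : f = g ∨ f = -g) : f = g := by
  rcases h with h | h
  · exact h
  · subst h
    exact (hg.not_neg hf).elim

theorem pow (hf : HasOrder f t) (n : ℕ) : HasOrder (f ^ n) (n • t) := by
  induction n with
  | zero => simpa using one
  | succ n ih => rw [pow_succ, succ_nsmul]; exact ih.mul hf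

theorem zpow (hf : HasOrder f t) (n : ℤ) : HasOrder (f ^ n) (n • t) := by
  cases n with
  | ofNat n => simpa using hf.pow n
  | negSucc n =>
    rw [zpow_negSucc, negSucc_zsmul]
    exact (hf.pow (n + 1)).inv

theorem prod {ι : Type*} (s : Finset ι) (f : ι → T.Fld) (t : ι → T.Edge → ℤ)
    (h : ∀ i ∈ s, HasOrder (f i) (t i)) : HasOrder (∏ i ∈ s, f i) (∑ i ∈ s, t i) := by
  classical
  induction s using Finset.induction_on with
  | empty => simpa using one
  | insert a s ha ih =>
    rw [Finset.prod_insert ha, Finset.sum_insert ha]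
    exact (h a (Finset.mem_insert_self _ _)).mul
      (ih fun i hi => h i (Finset.mem_insert_of_mem hi))

end HasOrder

/-! ### Positive Laurent polynomials -/

theorem IsPositiveLaurent.exists_natPoly {T : TriangulatedSurface Tri} {f : T.Fld}
    (h : T.IsPositiveLaurent f) :
    ∃ p q : MvPolynomial T.Var ℕ, q ≠ 0 ∧ f * T.natPoly q = T.natPoly p := by
  obtain ⟨p, m, h⟩ := h
  refine ⟨p, MvPolynomial.monomial m 1, by simp [MvPolynomial.monomial_eq_zero], ?_⟩
  simpa [natPoly] using h

/-- The definition of `absL` tests positivity of `f` itself. If `f = -g` were positive too, clearing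
denominators would give a vanishing sum of polynomials with natural coefficients, so `g = 0` and the
sign is irrelevant. -/
theorem absL_eq {f g : T.Fld} (hg : T.IsPositiveLaurent g) (h : f = g ∨ f = -g) :
    T.absL f = g := by
  rcases h with rfl | rfl
  · simp [absL, hg]
  · unfold absL
    split_ifs with hf
    · obtain ⟨p, q, hq, h⟩ := hg.exists_natPoly
      obtain ⟨p', q', hq', h'⟩ := hf.exists_natPoly
      have key : p * q' + p' * q = 0 := by
        apply T.natPoly_injective
        rw [map_add, map_mul, map_mul, ← h, ← h', map_zero]; ring
      have hp : p = 0 := by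
        by_contra hp
        exact T.natPoly_add_ne_zero (mul_ne_zero hp hq') key
      rw [hp, map_zero] at h
      have : g = 0 := (mul_eq_zero.1 h).resolve_right (T.natPoly_ne_zero hq)
      simp [this]
    · simp

/-! ### Doubling the exponents of the coefficient variables -/

/-- The polynomial homomorphism which squares the `y`-variables. -/
def sqYPoly : MvPolynomial T.Var ℚ →ₐ[ℚ] MvPolynomial T.Var ℚ :=
  MvPolynomial.aeval (Sum.elim (fun τ => MvPolynomial.X (Sum.inl τ))
    (fun τ => MvPolynomial.X (Sum.inr τ) ^ 2))

/-- Squaring the `x`-variables afterwards gives the substitution of squares for all variables, which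
is known to be injective. -/
theorem sqYPoly_injective : Function.Injective T.sqYPoly := by
  let g : MvPolynomial T.Var ℚ →ₐ[ℚ] MvPolynomial T.Var ℚ :=
    MvPolynomial.aeval (Sum.elim (fun τ => MvPolynomial.X (Sum.inl τ) ^ 2)
      (fun τ => MvPolynomial.X (Sum.inr τ)))
  have h : g.comp T.sqYPoly = MvPolynomial.expand 2 := by
    apply MvPolynomial.algHom_ext
    rintro (i | i) <;> simp [sqYPoly, g]
  have h' : Function.Injective (g.comp T.sqYPoly) := by
    rw [h]; exact MvPolynomial.expand_injective two_pos
  exact Function.Injective.of_comp (f := g) h'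

/-- The endomorphism of the field of rational functions which squares the `y`-variables. -/
def sqY : T.Fld →+* T.Fld :=
  IsFractionRing.map (A := MvPolynomial T.Var ℚ) (B := MvPolynomial T.Var ℚ)
    (j := T.sqYPoly.toRingHom) T.sqYPoly_injective

theorem sqY_x (τ : T.Edge) : T.sqY (T.x τ) = T.x τ := by
  simp [sqY, x, var, IsFractionRing.map, sqYPoly]

theorem sqY_y (τ : T.Edge) : T.sqY (T.y τ) = T.y τ ^ 2 := by
  simp [sqY, y, var, IsFractionRing.map, sqYPoly]

end TriangulatedSurface

/-! ### M-paths as parallel transport -/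

namespace TriangulatedSurface

variable {Tri : Type*} (T : TriangulatedSurface Tri)

/-! ### Equality up to sign -/

/-- Equality up to sign. -/
def EqNeg {M : Type*} [Neg M] (a b : M) : Prop := a = b ∨ a = -b

namespace EqNeg

variable {M : Type*}

theorem refl [Neg M] (a : M) : EqNeg a a := Or.inl rfl

theorem symm [InvolutiveNeg M] {a b : M} (h : EqNeg a b) : EqNeg b a := by
  rcases h with h | h
  · exact Or.inl h.symm
  · exact Or.inr (by rw [h, neg_neg])

theorem trans [InvolutiveNeg M] {a b c : M} (h : EqNeg a b) (h' : EqNeg b c) : EqNeg a c := by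
  rcases h with rfl | rfl <;> rcases h' with rfl | rfl
  · exact Or.inl rfl
  · exact Or.inr rfl
  · exact Or.inr rfl
  · exact Or.inl (neg_neg _)

theorem mul [Mul M] [HasDistribNeg M] {a b c d : M} (h : EqNeg a b) (h' : EqNeg c d) :
    EqNeg (a * c) (b * d) := by
  rcases h with rfl | rfl <;> rcases h' with rfl | rfl <;> simp [EqNeg]

theorem map {N : Type*} [Neg M] [Neg N] {a b : M} (f : M → N) (hf : ∀ a, f (-a) = -f a)
    (h : EqNeg a b) : EqNeg (f a) (f b) := by
  rcases h with rfl | rfl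
  · exact Or.inl rfl
  · exact Or.inr (hf _)

end EqNeg

/-! ### Frames at the points of a triangle -/

/-- Vectors at the three corners of a triangle, such that the determinant of the vectors at the
ends of a side is, up to sign, the variable of this side. -/
def cornerVec (s : TSide Tri) : Fin 2 → T.Fld :=
  ![![1, 0], ![T.x (T.edge (s.1, 1)) / T.x (T.edge (s.1, 2)), T.x (T.edge (s.1, 0))],
    ![0, T.x (T.edge (s.1, 2))]] s.2

variable {T} in
/-- The sign of the determinant of the vectors at the ends of a side. -/
def sideSign (s : TSide Tri) : T.Fld := if s.2 = 2 then -1 else 1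

theorem sideSign_sq (s : TSide Tri) : (sideSign s : T.Fld) * sideSign s = 1 := by
  unfold sideSign; split_ifs <;> simp

theorem eqNeg_sideSign_smul (s : TSide Tri) (M : Matrix (Fin 2) (Fin 2) T.Fld) :
    EqNeg ((sideSign s : T.Fld) • M) M := by
  unfold sideSign; split_ifs <;> simp [EqNeg]

/-- Three plane vectors with prescribed pairwise determinants exist, and `cornerVec` is one explicit
choice; going once around the triangle forces the sign at the last side. -/
theorem det_cornerVec (s : TSide Tri) :
    T.cornerVec s 0 * T.cornerVec (next s) 1 - T.cornerVec s 1 * T.cornerVec (next s) 0 =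
      sideSign s * T.x (T.edge s) := by
  obtain ⟨Δ, i⟩ := s
  have h2 := T.x_ne_zero (T.edge (Δ, 2))
  fin_cases i <;> (simp [cornerVec, sideSign, next]; try field_simp)

/-- The frame at a point near a corner: its second vector is that of the corner. -/
def frame : MPoint Tri → Matrix (Fin 2) (Fin 2) T.Fld
  | (s, false) =>
      !![-(sideSign s * T.cornerVec (next s) 0 / T.x (T.edge s)), T.cornerVec s 0;
        -(sideSign s * T.cornerVec (next s) 1 / T.x (T.edge s)), T.cornerVec s 1]
  | (s, true) =>
      !![sideSign s * T.cornerVec s 0 / T.x (T.edge s), T.cornerVec (next s) 0;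
        sideSign s * T.cornerVec s 1 / T.x (T.edge s), T.cornerVec (next s) 1]

theorem frame_apply_one (p : MPoint Tri) (i : Fin 2) :
    T.frame p i 1 = T.cornerVec (MPoint.corner p) i := by
  obtain ⟨s, _ | _⟩ := p <;> fin_cases i <;> simp [frame, MPoint.corner]

theorem det_frame (p : MPoint Tri) : (T.frame p).det = 1 := by
  have hx := fun s => T.x_ne_zero (T.edge s)
  obtain ⟨s, _ | _⟩ := p
  · have h := T.det_cornerVec s
    have hs := T.sideSign_sq s
    have := hx s
    simp only [frame, Matrix.det_fin_two_of]
    field_simp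
    linear_combination sideSign s * h + T.x (T.edge s) * hs
  · have h := T.det_cornerVec s
    have hs := T.sideSign_sq s
    have := hx s
    simp only [frame, Matrix.det_fin_two_of]
    field_simp
    linear_combination sideSign s * h + T.x (T.edge s) * hs

/-- A turn keeps the corner, hence the second column of the frame; the two frames of determinant one
differ by a lower unipotent matrix, whose entry is the one prescribed for the step. -/
theorem frame_turn (L : T.PrincipalLamination) (p : MPoint Tri) :
    T.frame (T.stepEnd .turn p) * T.stepMatrix L .turn p = T.frame p := by
  obtain ⟨⟨Δ, i⟩, b⟩ := p
  have h0 := T.x_ne_zero (T.edge (Δ, 0))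
  have h1 := T.x_ne_zero (T.edge (Δ, 1))
  have h2 := T.x_ne_zero (T.edge (Δ, 2))
  cases b <;> fin_cases i <;> ext j k <;> fin_cases j <;> fin_cases k <;>
    simp [frame, stepEnd, stepMatrix, cornerVec, next, prev, sideSign, Matrix.mul_apply,
      Fin.sum_univ_two] <;> field_simp <;> ring

theorem frame_along (L : T.PrincipalLamination) (p : MPoint Tri) :
    T.frame (T.stepEnd .along p) * T.stepMatrix L .along p =
      (sideSign p.1 : T.Fld) • T.frame p := by
  obtain ⟨⟨Δ, i⟩, b⟩ := p
  have h0 := T.x_ne_zero (T.edge (Δ, 0))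
  have h1 := T.x_ne_zero (T.edge (Δ, 1))
  have h2 := T.x_ne_zero (T.edge (Δ, 2))
  cases b <;> fin_cases i <;> ext j k <;> fin_cases j <;> fin_cases k <;>
    simp [frame, stepEnd, stepMatrix, cornerVec, next, sideSign, Matrix.mul_apply,
      Fin.sum_univ_two] <;> field_simp

/-- The transport across a side, in the standard frames of the two triangles. -/
def crossing (L : T.PrincipalLamination) (s : TSide Tri) : Matrix (Fin 2) (Fin 2) T.Fld :=
  T.frame (T.glue s, true) * T.stepMatrix L .cross (s, false) * (T.frame (s, false))⁻¹

theorem edge_glue (s : TSide Tri) : T.edge (T.glue s) = T.edge s :=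
  Quotient.sound (s := T.edgeSetoid) (Or.inr (T.glue_glue s).symm)

theorem isUnit_det_frame (p : MPoint Tri) : IsUnit (T.frame p).det := by
  rw [det_frame]; exact isUnit_one

theorem frame_cross_false (L : T.PrincipalLamination) (s : TSide Tri) :
    T.frame (T.stepEnd .cross (s, false)) * T.stepMatrix L .cross (s, false) =
      T.crossing L s * T.frame (s, false) := by
  rw [crossing, Matrix.mul_assoc, Matrix.nonsing_inv_mul _ (T.isUnit_det_frame _), Matrix.mul_one]
  rfl

/-- The matrix of a step along a side, from its tail to its head. -/
def alongMatrix (τ : T.Edge) : Matrix (Fin 2) (Fin 2) T.Fld := !![0, T.x τ; -(1 / T.x τ), 0]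

/-- `crossing` is defined by the step at the tail of the side. The step at the head yields the same
transport up to sign: going along the side interchanges the two coordinates, which turns one
diagonal crossing matrix into the other. -/
theorem frame_cross_true (L : T.PrincipalLamination) (s : TSide Tri) :
    EqNeg (T.frame (T.stepEnd .cross (s, true)) * T.stepMatrix L .cross (s, true))
      (T.crossing L s * T.frame (s, true)) := by
  have hx := T.x_ne_zero (T.edge s)
  have h1 : EqNeg (T.frame (s, true) * T.alongMatrix (T.edge s)) (T.frame (s, false)) :=
    EqNeg.trans (Or.inl (T.frame_along L (s, false))) (T.eqNeg_sideSign_smul _ _)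
  have h2 : EqNeg (T.frame (T.glue s, true) * T.alongMatrix (T.edge s))
      (T.frame (T.glue s, false)) := by
    have := EqNeg.trans (Or.inl (T.frame_along L (T.glue s, false)))
      (T.eqNeg_sideSign_smul _ _)
    simp only [stepEnd, Bool.not_false, stepMatrix, edge_glue] at this
    exact this
  have hcomm : T.alongMatrix (T.edge s) * T.stepMatrix L .cross (s, true) =
      T.stepMatrix L .cross (s, false) * T.alongMatrix (T.edge s) := by
    ext i j
    fin_cases i <;> fin_cases j <;>
      simp [alongMatrix, stepMatrix, Matrix.mul_apply, Fin.sum_univ_two, mul_comm]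
  have hsq : T.alongMatrix (T.edge s) * T.alongMatrix (T.edge s) = -1 := by
    ext i j
    fin_cases i <;> fin_cases j <;>
      simp [alongMatrix, Matrix.mul_apply, Fin.sum_univ_two, hx]
  have h3 : EqNeg (T.frame (s, true)) (T.frame (s, false) * T.alongMatrix (T.edge s)) := by
    have := h1.mul (EqNeg.refl (T.alongMatrix (T.edge s)))
    rw [Matrix.mul_assoc, hsq, Matrix.mul_neg, Matrix.mul_one] at this
    exact EqNeg.trans (Or.inr (neg_neg _).symm) this
  have h4 : EqNeg (T.frame (T.glue s, false) * T.stepMatrix L .cross (s, true))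
      (T.frame (T.glue s, true) * T.alongMatrix (T.edge s) * T.stepMatrix L .cross (s, true)) :=
    h2.symm.mul (EqNeg.refl _)
  have h5 : T.frame (T.glue s, true) * T.alongMatrix (T.edge s) * T.stepMatrix L .cross (s, true) =
      T.crossing L s * (T.frame (s, false) * T.alongMatrix (T.edge s)) := by
    rw [Matrix.mul_assoc, hcomm, ← Matrix.mul_assoc, ← Matrix.mul_assoc,
      ← T.frame_cross_false L s]
    rfl
  rw [h5] at h4
  exact h4.trans ((EqNeg.refl _).mul h3.symm)

/-- The transport along a sequence of crossings. -/
def transport (L : T.PrincipalLamination) : List (TSide Tri) → Matrix (Fin 2) (Fin 2) T.Fld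
  | [] => 1
  | s :: w => transport L w * T.crossing L s

theorem frame_pathMatrix (L : T.PrincipalLamination) (p : MPoint Tri) (ks : List StepType) :
    EqNeg (T.frame (T.pathEnd p ks) * T.pathMatrix L p ks)
      (T.transport L (T.pathWord p ks) * T.frame p) := by
  induction ks generalizing p with
  | nil => simp [pathEnd, pathMatrix, pathWord, transport, EqNeg.refl]
  | cons k ks ih =>
    have h := (ih (T.stepEnd k p)).mul (EqNeg.refl (T.stepMatrix L k p))
    rw [pathEnd, pathMatrix, ← Matrix.mul_assoc]
    refine h.trans ?_
    rw [Matrix.mul_assoc]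
    cases k with
    | turn =>
      rw [T.frame_turn, pathWord]
      · exact EqNeg.refl _
      · simp
    | along =>
      rw [T.frame_along, pathWord]
      · exact (EqNeg.refl _).mul (T.eqNeg_sideSign_smul _ _)
      · simp
    | cross =>
      rw [pathWord, transport, Matrix.mul_assoc]
      refine (EqNeg.refl _).mul ?_
      obtain ⟨s, _ | _⟩ := p
      · exact Or.inl (T.frame_cross_false L s)
      · exact T.frame_cross_true L s

/-- The central description of M-paths: apart from the sign, everything but the crossed sides and
the two end frames drops out. -/
theorem pathMatrix_eqNeg (L : T.PrincipalLamination) (p : MPoint Tri) (ks : List StepType) :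
    EqNeg (T.pathMatrix L p ks)
      ((T.frame (T.pathEnd p ks))⁻¹ * T.transport L (T.pathWord p ks) * T.frame p) := by
  have h := (EqNeg.refl ((T.frame (T.pathEnd p ks))⁻¹)).mul (T.frame_pathMatrix L p ks)
  rwa [← Matrix.mul_assoc, Matrix.nonsing_inv_mul _ (T.isUnit_det_frame _), Matrix.one_mul,
    ← Matrix.mul_assoc] at h

/-! ### Existence of M-paths -/

theorem pathEnd_append (p : MPoint Tri) (ks ks' : List StepType) :
    T.pathEnd p (ks ++ ks') = T.pathEnd (T.pathEnd p ks) ks' := by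
  induction ks generalizing p with
  | nil => rfl
  | cons k ks ih => exact ih _

theorem pathWord_append (p : MPoint Tri) (ks ks' : List StepType) :
    T.pathWord p (ks ++ ks') = T.pathWord p ks ++ T.pathWord (T.pathEnd p ks) ks' := by
  induction ks generalizing p with
  | nil => rfl
  | cons k ks ih => cases k <;> simp [pathWord, pathEnd, ih]

theorem exists_path_triangle (Δ : Tri) (i j : Fin 3) (b c : Bool) :
    ∃ ks, T.pathEnd ((Δ, i), b) ks = ((Δ, j), c) ∧ T.pathWord ((Δ, i), b) ks = [] := by
  have h : ∀ i b, ∃ ks, T.pathEnd ((Δ, i), b) ks = ((Δ, i + 1), b) ∧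
      T.pathWord ((Δ, i), b) ks = [] := by
    rintro i (_ | _)
    · exact ⟨[.along, .turn], by simp [pathEnd, stepEnd, next], by simp [pathWord]⟩
    · exact ⟨[.turn, .along], by simp [pathEnd, stepEnd, next], by simp [pathWord]⟩
  have hj : ∀ i j : Fin 3, j = i ∨ j = i + 1 ∨ j = i + 1 + 1 := by decide
  obtain ⟨ks, h1, h2⟩ : ∃ ks, T.pathEnd ((Δ, i), b) ks = ((Δ, j), b) ∧
      T.pathWord ((Δ, i), b) ks = [] := by
    rcases hj i j with rfl | rfl | rfl
    · exact ⟨[], rfl, rfl⟩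
    · exact h i b
    · obtain ⟨ks, h1, h2⟩ := h i b
      obtain ⟨ks', h1', h2'⟩ := h (i + 1) b
      exact ⟨ks ++ ks', by rw [pathEnd_append, h1, h1'],
        by rw [pathWord_append, h1, h2, h2']; rfl⟩
  by_cases hbc : b = c
  · exact ⟨ks, by rw [h1, hbc], h2⟩
  · refine ⟨ks ++ [.along], ?_, ?_⟩
    · rw [pathEnd_append, h1]
      simp only [pathEnd, stepEnd]
      cases b <;> cases c <;> simp_all
    · rw [pathWord_append, h2]
      simp [pathWord]

/-- Inside a triangle all points are connected by steps without crossings (`exists_path_triangle`),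
so any word can be realized between any two points of its end triangles. -/
theorem exists_path (w : List (TSide Tri)) (p q : MPoint Tri) (h : T.IsWalk p.1.1 w q.1.1) :
    ∃ ks, T.pathEnd p ks = q ∧ T.pathWord p ks = w := by
  induction w generalizing p with
  | nil =>
    obtain ⟨⟨Δ, i⟩, b⟩ := p
    obtain ⟨⟨Δ', j⟩, c⟩ := q
    change Δ = Δ' at h
    subst h
    exact T.exists_path_triangle _ _ _ _ _
  | cons s w ih =>
    obtain ⟨hs, _, hw⟩ := h
    obtain ⟨⟨Δ, i⟩, b⟩ := p
    obtain ⟨Δ', j⟩ := s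
    change Δ' = Δ at hs
    subst hs
    obtain ⟨ks, h1, h2⟩ := T.exists_path_triangle Δ' i j b false
    obtain ⟨ks', h1', h2'⟩ := ih (T.stepEnd .cross ((Δ', j), false)) hw
    refine ⟨ks ++ .cross :: ks', ?_, ?_⟩
    · rw [pathEnd_append, h1]; exact h1'
    · rw [pathWord_append, h1, h2]; simp [pathWord, h2']

theorem exists_isMPathOfArc (γ : T.ArcCurve) : ∃ ρ, T.IsMPathOfArc ρ γ := by
  obtain ⟨ks, h1, h2⟩ := T.exists_path γ.word (γ.init, false) (γ.fin, false) γ.walk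
  exact ⟨⟨(γ.init, false), ks⟩, γ, rfl, h2.symm, by rw [h1]; rfl, Relation.EqvGen.refl _, rfl⟩

theorem exists_isMPathOfLoop (γ : T.LoopCurve) : ∃ ρ, T.IsMPathOfLoop ρ γ := by
  obtain ⟨ks, h1, h2⟩ := T.exists_path γ.word ((γ.base, 0), false) ((γ.base, 0), false) γ.walk
  exact ⟨⟨((γ.base, 0), false), ks⟩, h1, γ, rfl, h2.symm, Relation.EqvGen.refl _, rfl⟩

end TriangulatedSurface

/-! ### Perfect matchings as sequences of states -/

namespace TriangulatedSurface

variable {Tri : Type*} (T : TriangulatedSurface Tri)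

/-! ### Perfect matchings of layered graphs -/

/-- A graph with vertices `vtx j β` for `1 ≤ j ≤ d`, a source `vtx 0 1` and a sink `vtx (d + 1) 0`,
whose edges join successive layers. An edge of the layer `j` is determined by `β, β'`, where it
leaves `vtx j (β + 1)` and arrives at `vtx (j + 1) β'`. -/
structure LayeredGraph (d : ℕ) where
  vtx : ℕ → Fin 2 → ℤ × ℤ
  lab : ℕ → Fin 2 → Fin 2 → T.Edge
  ok : ℕ → Fin 2 → Fin 2 → Prop
  edges : Finset T.SnakeEdge
  level : ∀ j β, (vtx j β).1 + (vtx j β).2 = j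
  vtx_ne : ∀ j, vtx j 0 ≠ vtx j 1
  mem_edges : ∀ e, e ∈ edges ↔
    ∃ j ≤ d, ∃ β β', ok j β β' ∧ e = (vtx j (β + 1), vtx (j + 1) β', lab j β β')
  ok_zero : ∀ β β', ok 0 β β' → β = 0
  ok_last : ∀ β β', ok d β β' → β' = 0
  covers : ∀ j ≤ d, ∀ β, (j = 0 → β = 0) → Covers edges (vtx j (β + 1))

variable {T}

/-- Every vertex that is covered by `E` is covered by exactly one edge of `P ⊆ E`. -/
def IsPM (E P : Finset T.SnakeEdge) : Prop :=
  P ⊆ E ∧ ∀ v, Covers E v → ∃! e, e ∈ P ∧ (e.1 = v ∨ e.2.1 = v)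

namespace LayeredGraph

variable {d : ℕ} (G : T.LayeredGraph d)

/-- The edge of the layer `j` with given states. -/
def ed (j : ℕ) (β β' : Fin 2) : T.SnakeEdge := (G.vtx j (β + 1), G.vtx (j + 1) β', G.lab j β β')

open Classical in
/-- The edges of a sequence of states. -/
def pathSet (o : ℕ → Fin 2) : Finset T.SnakeEdge :=
  (Finset.range (d + 1)).image fun j => G.ed j (o j) (o (j + 1))

/-- The states are joined by edges of the graph. -/
def Good (o : ℕ → Fin 2) : Prop := ∀ j ≤ d, G.ok j (o j) (o (j + 1))

variable {G}

theorem vtx_inj {i j : ℕ} {β β' : Fin 2} (h : G.vtx i β = G.vtx j β') : i = j ∧ β = β' := by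
  have h1 := G.level i β
  rw [h, G.level] at h1
  have hij : i = j := by exact_mod_cast h1.symm
  subst hij
  refine ⟨rfl, ?_⟩
  have hne := G.vtx_ne i
  fin_cases β <;> fin_cases β'
  · rfl
  · exact (hne h).elim
  · exact (hne h.symm).elim
  · rfl

theorem _root_.Fin.two_eq_or (a b : Fin 2) : a = b ∨ a = b + 1 := by
  revert a b; decide

theorem _root_.Fin.two_ne_add_one (a : Fin 2) : a ≠ a + 1 := by
  revert a; decide

theorem ed_mem (j : ℕ) (hj : j ≤ d) {β β' : Fin 2} (h : G.ok j β β') : G.ed j β β' ∈ G.edges :=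
  (G.mem_edges _).2 ⟨j, hj, β, β', h, rfl⟩

theorem mem_pathSet {o : ℕ → Fin 2} {e : T.SnakeEdge} :
    e ∈ G.pathSet o ↔ ∃ j ≤ d, e = G.ed j (o j) (o (j + 1)) := by
  simp only [pathSet, Finset.mem_image, Finset.mem_range, Nat.lt_succ_iff]
  exact ⟨fun ⟨j, h, h'⟩ => ⟨j, h, h'.symm⟩, fun ⟨j, h, h'⟩ => ⟨j, h, h'.symm⟩⟩

/-- The edge below a level covers the vertex named by the state, and the edge above covers the other
one; edges of other layers are on other levels. -/
theorem isPM_pathSet {o : ℕ → Fin 2} (ho : G.Good o) : IsPM G.edges (G.pathSet o) := by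
  refine ⟨fun e he => ?_, ?_⟩
  · obtain ⟨j, hj, rfl⟩ := mem_pathSet.1 he
    exact ed_mem j hj (ho j hj)
  have h0 : o 0 = 0 := G.ok_zero _ _ (ho 0 (Nat.zero_le _))
  have hd : o (d + 1) = 0 := G.ok_last _ _ (ho d le_rfl)
  have key : ∀ j ≤ d + 1, ∀ β, (j = 0 → β ≠ o j) → (j = d + 1 → β = o j) →
      ∃! e, e ∈ G.pathSet o ∧ (e.1 = G.vtx j β ∨ e.2.1 = G.vtx j β) := by
    intro j hj β hβ0 hβd
    rcases Fin.two_eq_or β (o j) with h | h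
    · obtain _ | j := j
      · exact (hβ0 rfl h).elim
      refine ⟨G.ed j (o j) (o (j + 1)), ⟨mem_pathSet.2 ⟨j, by omega, rfl⟩, Or.inr ?_⟩, ?_⟩
      · rw [h]; rfl
      · rintro e ⟨he, he'⟩
        obtain ⟨i, hi, rfl⟩ := mem_pathSet.1 he
        rcases he' with he' | he'
        · obtain ⟨rfl, h'⟩ := vtx_inj he'
          exact (Fin.two_ne_add_one _ (h.symm.trans h'.symm)).elim
        · obtain ⟨h', _⟩ := vtx_inj he'
          obtain rfl : i = j := by omega
          rfl
    · have hjd : j ≤ d := by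
        by_contra hj'
        obtain rfl : j = d + 1 := by omega
        exact Fin.two_ne_add_one _ ((hβd rfl).symm.trans h)
      refine ⟨G.ed j (o j) (o (j + 1)), ⟨mem_pathSet.2 ⟨j, hjd, rfl⟩, Or.inl ?_⟩, ?_⟩
      · rw [h]; rfl
      · rintro e ⟨he, he'⟩
        obtain ⟨i, hi, rfl⟩ := mem_pathSet.1 he
        rcases he' with he' | he'
        · obtain ⟨rfl, h'⟩ := vtx_inj he'
          rfl
        · obtain ⟨rfl, h'⟩ := vtx_inj he'
          exact (Fin.two_ne_add_one _ (h'.trans h)).elim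
  rintro v ⟨e, he, hv⟩
  obtain ⟨j, hj, β, β', hok, rfl⟩ := (G.mem_edges e).1 he
  rcases hv with rfl | rfl
  · refine key j (by omega) _ ?_ (by omega)
    rintro rfl
    rw [G.ok_zero _ _ hok, h0]; decide
  · refine key (j + 1) (by omega) _ (by omega) ?_
    intro hj'
    obtain rfl : j = d := by omega
    rw [G.ok_last _ _ hok, hd]

/-- Climb the levels: one matching edge leaves the source, and at each level the vertex that was not
reached from below must be matched upwards, while the reached one cannot be. So there is one
matching edge per layer. -/
theorem exists_of_isPM {P : Finset T.SnakeEdge} (hP : IsPM G.edges P) :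
    ∃ o, G.Good o ∧ P = G.pathSet o := by
  classical
  -- The state records the vertex of the level at which a matching edge arrives from below; the
  -- source has state `0` because its edge leaves from the vertex `1`.
  let o : ℕ → Fin 2 := fun j => if j = 0 then 0 else if ∃ e ∈ P, e.2.1 = G.vtx j 1 then 1 else 0
  have key : ∀ j ≤ d, G.ok j (o j) (o (j + 1)) ∧ G.ed j (o j) (o (j + 1)) ∈ P ∧
      ∀ e ∈ P, e.1.1 + e.1.2 = (j : ℤ) → e = G.ed j (o j) (o (j + 1)) := by
    intro j
    induction j with
    | zero =>
      intro _
      obtain ⟨e, ⟨heP, hev⟩, huniq⟩ := hP.2 _ (G.covers 0 (Nat.zero_le _) 0 fun _ => rfl)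
      obtain ⟨i, hi, β, β', hok, rfl⟩ := (G.mem_edges e).1 (hP.1 heP)
      have hi0 : i = 0 := by
        rcases hev with h | h
        · exact (vtx_inj h).1
        · exact absurd (vtx_inj h).1 (by omega)
      subst hi0
      have hβ := G.ok_zero _ _ hok
      subst hβ
      have hall : ∀ e ∈ P, e.1.1 + e.1.2 = ((0 : ℕ) : ℤ) → e = G.ed 0 0 β' := by
        intro e' he' hl
        obtain ⟨i, hi, b, b', hok', rfl⟩ := (G.mem_edges e').1 (hP.1 he')
        have hl' := G.level i (b + 1)
        have hi0 : i = 0 := by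
          have : (i : ℤ) = (0 : ℕ) := hl'.symm.trans hl
          exact_mod_cast this
        subst hi0
        have hb := G.ok_zero _ _ hok'
        subst hb
        exact huniq _ ⟨he', Or.inl rfl⟩
      have ho : o (0 + 1) = β' := by
        rcases Fin.two_eq_or β' 1 with h | h
        · subst h
          simp only [o]
          rw [if_neg (by omega), if_pos ⟨_, heP, rfl⟩]
        · simp only [o]
          rw [if_neg (by omega), if_neg, h]
          · rfl
          rintro ⟨e', he', h'⟩
          obtain ⟨i, hi, b, b', hok', rfl⟩ := (G.mem_edges e').1 (hP.1 he')
          have hi0 : i = 0 := by have := (vtx_inj h').1; omega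
          subst hi0
          have heq := hall _ he' (G.level _ _)
          have h3 : G.vtx (0 + 1) b' = G.vtx (0 + 1) β' := congrArg (fun e => e.2.1) heq
          have h1 := (vtx_inj h').2
          have h2 := (vtx_inj h3).2
          simp only [h1, h] at h2
          exact absurd h2 (by decide)
      have ho0 : o 0 = 0 := rfl
      rw [ho, ho0]
      exact ⟨hok, heP, hall⟩
    | succ j ih =>
      intro hj
      obtain ⟨hokj, hfP, hallj⟩ := ih (by omega)
      obtain ⟨e, ⟨heP, hev⟩, huniq⟩ :=
        hP.2 _ (G.covers (j + 1) hj (o (j + 1)) fun h => absurd h (by omega))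
      obtain ⟨i, hi, β, β', hok, rfl⟩ := (G.mem_edges e).1 (hP.1 heP)
      have hiβ : i = j + 1 ∧ β = o (j + 1) := by
        rcases hev with h | h
        · obtain ⟨h1, h2⟩ := vtx_inj h
          exact ⟨h1, add_right_cancel h2⟩
        · obtain ⟨h1, h2⟩ := vtx_inj h
          obtain rfl : i = j := by omega
          have := hallj _ heP (G.level _ _)
          have h3 : G.vtx (i + 1) β' = G.vtx (i + 1) (o (i + 1)) := congrArg (fun e => e.2.1) this
          exact (Fin.two_ne_add_one _ ((vtx_inj h3).2.symm.trans h2)).elim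
      obtain ⟨rfl, rfl⟩ := hiβ
      have hall : ∀ e ∈ P, e.1.1 + e.1.2 = ((j + 1 : ℕ) : ℤ) →
          e = G.ed (j + 1) (o (j + 1)) β' := by
        intro e' he' hl
        obtain ⟨i, hi, b, b', hok', rfl⟩ := (G.mem_edges e').1 (hP.1 he')
        have hl' := G.level i (b + 1)
        have hi0 : i = j + 1 := by
          have : (i : ℤ) = (j + 1 : ℕ) := hl'.symm.trans hl
          exact_mod_cast this
        subst hi0
        rcases Fin.two_eq_or b (o (j + 1)) with h | h
        · subst h
          exact huniq _ ⟨he', Or.inl rfl⟩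
        -- This vertex is already covered by the edge from the level below, so a second edge leaving
        -- it contradicts uniqueness.
        · obtain ⟨f, _, hf⟩ := hP.2 (G.vtx (j + 1) (o (j + 1)))
            ⟨_, hP.1 hfP, Or.inr rfl⟩
          have h1 := hf _ ⟨hfP, Or.inr rfl⟩
          have h2 := hf _ ⟨he', Or.inl (by
            change G.vtx (j + 1) (b + 1) = _
            rw [h, add_assoc]; congr 1; exact add_zero _)⟩
          have h3 : G.vtx j (o j + 1) = G.vtx (j + 1) (b + 1) :=
            congrArg (fun e => e.1) (h1.trans h2.symm)
          exact absurd (vtx_inj h3).1 (by omega)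
      have ho : o (j + 1 + 1) = β' := by
        rcases Fin.two_eq_or β' 1 with h | h
        · subst h
          simp only [o]
          rw [if_neg (by omega), if_pos ⟨_, heP, rfl⟩]
        · simp only [o]
          rw [if_neg (by omega), if_neg, h]
          · rfl
          rintro ⟨e', he', h'⟩
          obtain ⟨i, hi, b, b', hok', rfl⟩ := (G.mem_edges e').1 (hP.1 he')
          have hi0 : i = j + 1 := by have := (vtx_inj h').1; omega
          subst hi0
          have heq := hall _ he' (G.level _ _)
          have h3 : G.vtx (j + 1 + 1) b' = G.vtx (j + 1 + 1) β' := congrArg (fun e => e.2.1) heq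
          have h1 := (vtx_inj h').2
          have h2 := (vtx_inj h3).2
          simp only [h1, h] at h2
          exact absurd h2 (by decide)
      rw [ho]
      exact ⟨hok, heP, hall⟩
  refine ⟨o, fun j hj => (key j hj).1, ?_⟩
  ext e
  rw [mem_pathSet]
  constructor
  · intro he
    obtain ⟨i, hi, β, β', hok, h⟩ := (G.mem_edges e).1 (hP.1 he)
    refine ⟨i, hi, (key i hi).2.2 e he ?_⟩
    rw [h]
    exact G.level _ _
  · rintro ⟨j, hj, rfl⟩
    exact (key j hj).2.1

theorem Good.eq_of_pathSet_eq {o o' : ℕ → Fin 2} (ho : G.Good o) (ho' : G.Good o')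
    (h : G.pathSet o = G.pathSet o') : ∀ j ≤ d + 1, o j = o' j := by
  intro j hj
  obtain _ | j := j
  · rw [G.ok_zero _ _ (ho 0 (Nat.zero_le _)), G.ok_zero _ _ (ho' 0 (Nat.zero_le _))]
  have h1 : G.ed j (o j) (o (j + 1)) ∈ G.pathSet o' := by
    rw [← h]; exact mem_pathSet.2 ⟨j, by omega, rfl⟩
  obtain ⟨i, hi, h2⟩ := mem_pathSet.1 h1
  have h3 : G.vtx (j + 1) (o (j + 1)) = G.vtx (i + 1) (o' (i + 1)) := congrArg (fun e => e.2.1) h2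
  obtain ⟨h4, h5⟩ := vtx_inj h3
  rw [h5, h4]

/-- Identifies the matching steps of the alternating path: from the far end of one diagonal it can
only go on to the vertex named by the next state. -/
theorem joined_pathSet {o : ℕ → Fin 2} {j : ℕ} (hj : j ≤ d) {β : Fin 2} :
    Joined (G.pathSet o) (G.vtx j (o j + 1)) (G.vtx (j + 1) β) ↔ β = o (j + 1) := by
  constructor
  · rintro ⟨e, he, h⟩
    obtain ⟨i, hi, rfl⟩ := mem_pathSet.1 he
    rcases h with ⟨h1, h2⟩ | ⟨h1, h2⟩
    · obtain ⟨h3, h4⟩ := vtx_inj h2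
      obtain rfl : i = j := by omega
      exact h4.symm
    · have := (vtx_inj h1).1
      have := (vtx_inj h2).1
      omega
  · rintro rfl
    exact ⟨_, mem_pathSet.2 ⟨j, hj, rfl⟩, Or.inl ⟨rfl, rfl⟩⟩

theorem xMon_pathSet (o : ℕ → Fin 2) :
    T.xMon (G.pathSet o) = ∏ j ∈ Finset.range (d + 1), T.x (G.lab j (o j) (o (j + 1))) := by
  classical
  rw [xMon, pathSet, Finset.prod_image]
  · rfl
  · intro i _ j _ h
    exact (vtx_inj (congrArg (fun e => e.1) h : G.vtx i _ = G.vtx j _)).1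

/-- The extension of a finite sequence of states by zeros. -/
def _root_.Fin.extendZero {d : ℕ} (o : Fin d → Fin 2) (j : ℕ) : Fin 2 :=
  if h : 1 ≤ j ∧ j - 1 < d then o ⟨j - 1, h.2⟩ else 0

open Classical in
theorem sum_isPM {K : Type*} [AddCommMonoid K] (f : Finset T.SnakeEdge → K) :
    ∑ P ∈ G.edges.powerset with IsPM G.edges P, f P =
      ∑ o : Fin d → Fin 2,
        if G.Good (Fin.extendZero o) then f (G.pathSet (Fin.extendZero o)) else 0 := by
  rw [← Finset.sum_filter]
  symm
  refine Finset.sum_bij (fun o _ => G.pathSet (Fin.extendZero o)) ?_ ?_ ?_ (fun _ _ => rfl)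
  · intro o ho
    have hPM := isPM_pathSet (Finset.mem_filter.1 ho).2
    exact Finset.mem_filter.2 ⟨Finset.mem_powerset.2 hPM.1, hPM⟩
  · intro o ho o' ho' h
    have h' := (Finset.mem_filter.1 ho).2.eq_of_pathSet_eq (Finset.mem_filter.1 ho').2 h
    funext k
    have := h' (k + 1) (by omega)
    simpa [Fin.extendZero] using this
  · intro P hP
    obtain ⟨o, ho, rfl⟩ := exists_of_isPM (Finset.mem_filter.1 hP).2
    have heq : ∀ j ≤ d + 1, Fin.extendZero (fun k : Fin d => o (k + 1)) j = o j := by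
      intro j hj
      obtain _ | j := j
      · rw [G.ok_zero _ _ (ho 0 (Nat.zero_le _))]; rfl
      · by_cases hjd : j < d
        · simp [Fin.extendZero, hjd]
        · obtain rfl : j = d := by omega
          rw [G.ok_last _ _ (ho j le_rfl)]
          simp [Fin.extendZero]
    refine ⟨fun k => o (k + 1), ?_, ?_⟩
    · refine Finset.mem_filter.2 ⟨Finset.mem_univ _, fun j hj => ?_⟩
      rw [heq j (by omega), heq (j + 1) (by omega)]
      exact ho j hj
    · ext e
      rw [mem_pathSet, mem_pathSet]
      refine exists_congr fun j => and_congr_right fun hj => ?_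
      rw [heq j (by omega), heq (j + 1) (by omega)]

end LayeredGraph

end TriangulatedSurface

namespace TSide

variable {Tri : Type*} (s : TSide Tri)

@[simp] theorem next_prev : next (prev s) = s := by
  obtain ⟨Δ, i⟩ := s
  simp only [next, prev, add_assoc]
  congr 1
  exact add_zero i

@[simp] theorem prev_next : prev (next s) = s := by
  obtain ⟨Δ, i⟩ := s
  simp only [next, prev, add_assoc]
  congr 1
  exact add_zero i

@[simp] theorem next_next : next (next s) = prev s := by
  obtain ⟨Δ, i⟩ := s
  simp only [next, prev, add_assoc]
  rfl

@[simp] theorem prev_prev : prev (prev s) = next s := by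
  obtain ⟨Δ, i⟩ := s
  simp only [next, prev, add_assoc]
  rfl

theorem next_ne : next s ≠ s := by
  obtain ⟨Δ, i⟩ := s
  intro h
  have := congrArg Prod.snd h
  simp [next] at this

theorem prev_ne : prev s ≠ s := fun h => next_ne s (by conv_lhs => rw [← h, next_prev])

theorem next_ne_prev : next s ≠ prev s := fun h => next_ne (next s) (by rw [next_next, h])

end TSide

namespace TriangulatedSurface

variable {Tri : Type*} (T : TriangulatedSurface Tri)

/-! ### Snake graphs as layered graphs -/

/-- The parity of the tile with a given index (the first tile has index `0` and is odd). -/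
def parity : ℕ → Bool
  | 0 => true
  | k + 1 => !parity k

theorem parity_eq (k : ℕ) : parity k = decide (Even k) := by
  induction k with
  | zero => rfl
  | succ k ih => simp only [parity, ih, Nat.even_add_one, decide_not]

section Snake

variable (sd : ℕ → TSide Tri)

/-- The position of a tile of the snake graph of a sequence of crossings. -/
def tilePos : ℕ → ℤ × ℤ
  | 0 => (0, 0)
  | k + 1 => tilePos k + if T.gluesNorth (parity k) (sd k) (sd (k + 1)) then (0, 1) else (1, 0)

/-- A tile of the snake graph of a sequence of crossings. -/
def tileAt (k : ℕ) : Tile Tri := ⟨T.tilePos sd k, sd k, parity k⟩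

theorem tilesFrom_eq (n k : ℕ) :
    T.tilesFrom (T.tilePos sd k) (parity k) ((List.range' k n).map sd) =
      (List.range' k n).map (T.tileAt sd) := by
  induction n generalizing k with
  | zero => rfl
  | succ n ih =>
    obtain _ | n := n
    · rfl
    · have := ih (k + 1)
      simp only [List.range'_succ, List.map_cons] at this ⊢
      rw [tilesFrom]
      congr 1

theorem tiles_eq (d : ℕ) :
    T.tiles ((List.range' 0 d).map sd) = (List.range' 0 d).map (T.tileAt sd) :=
  T.tilesFrom_eq sd d 0

theorem level_tilePos (k : ℕ) : (T.tilePos sd k).1 + (T.tilePos sd k).2 = k := by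
  induction k with
  | zero => rfl
  | succ k ih =>
    rw [tilePos]
    split_ifs <;> simp only [Prod.fst_add, Prod.snd_add] <;> push_cast <;> linarith

/-- Successive crossings form a reduced walk. -/
def ReducedSeq (d : ℕ) : Prop :=
  ∀ k, k + 1 < d → sd (k + 1) = next (T.glue (sd k)) ∨ sd (k + 1) = prev (T.glue (sd k))

open Classical in
/-- The vertex at which the diagonal of the `k`-th tile starts if it has the state `β`. -/
def inVtx (k : ℕ) (β : Fin 2) : ℤ × ℤ :=
  if decide (β = 1) = parity k then (T.tileAt sd k).nw else (T.tileAt sd k).se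

/-- The vertices of the snake graph with `d` tiles. -/
def snakeVtx (d j : ℕ) (β : Fin 2) : ℤ × ℤ :=
  if j = 0 then (if β = 1 then (0, 0) else (-1, 1))
  else if j = d + 1 then
    (if β = 0 then (T.tileAt sd (d - 1)).ne else (T.tileAt sd (d - 1)).ne + (1, -1))
  else T.inVtx sd (j - 1) β

open Classical in
/-- The label of the edge between two states in a passage from `e` to `s'`. -/
def turnLab (e s' : TSide Tri) (β β' : Fin 2) : T.Edge :=
  if s' = next e then
    (if β = β' then (if β = 1 then T.edge s' else T.edge e) else T.edge (prev e))
  else (if β = β' then (if β = 1 then T.edge e else T.edge s') else T.edge (next e))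

variable {T} in
/-- Whether there is an edge between two states in a passage from `e` to `s'`. -/
def turnOk (e s' : TSide Tri) (β β' : Fin 2) : Prop :=
  (s' = next e → ¬(β = 1 ∧ β' = 0)) ∧ (s' ≠ next e → ¬(β = 0 ∧ β' = 1))

/-- The labels of the edges of the snake graph with `d` tiles. -/
def snakeLab (d j : ℕ) (β β' : Fin 2) : T.Edge :=
  if j = 0 then (if β' = 0 then T.edge (prev (sd 0)) else T.edge (next (sd 0)))
  else if j = d then
    (if β = 0 then T.edge (prev (T.glue (sd (d - 1)))) else T.edge (next (T.glue (sd (d - 1)))))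
  else T.turnLab (T.glue (sd (j - 1))) (sd j) β β'

/-- The edges of the snake graph with `d` tiles. -/
def snakeOk (d j : ℕ) (β β' : Fin 2) : Prop :=
  if j = 0 then β = 0
  else if j = d then β' = 0
  else turnOk (T.glue (sd (j - 1))) (sd j) β β'

variable {sd} {T}

theorem mem_snakeEdges {d : ℕ} (e : T.SnakeEdge) :
    e ∈ T.snakeEdges ((List.range' 0 d).map sd) ↔ ∃ k < d,
      e = T.southEdge (T.tileAt sd k) ∨ e = T.westEdge (T.tileAt sd k) ∨
      e = T.eastEdge (T.tileAt sd k) ∨ e = T.northEdge (T.tileAt sd k) := by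
  classical
  simp [snakeEdges, tiles_eq]

theorem level_inVtx (k : ℕ) (β : Fin 2) :
    (T.inVtx sd k β).1 + (T.inVtx sd k β).2 = (k + 1 : ℕ) := by
  have := T.level_tilePos sd k
  unfold inVtx
  split_ifs <;> simp only [Tile.nw, Tile.se, tileAt, Prod.fst_add, Prod.snd_add] <;>
    push_cast <;> linarith

theorem inVtx_ne (k : ℕ) : T.inVtx sd k 0 ≠ T.inVtx sd k 1 := by
  cases h : parity k <;> simp [inVtx, h, Tile.nw, Tile.se]

theorem snakeVtx_succ {d k : ℕ} (hk : k < d) (β : Fin 2) :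
    T.snakeVtx sd d (k + 1) β = T.inVtx sd k β := by
  simp [snakeVtx, show k ≠ d by omega]

/-- Between two consecutive inner levels lie the east and north edges of one tile and the south and
west edges of the next. Two of these four coincide, and the remaining three carry the three sides of
the triangle that the curve passes. One of the four pairs of states is thus not joined, which one
depending on the direction of the turn. -/
theorem mid_edges {k : ℕ} (h : sd (k + 1) = next (T.glue (sd k)) ∨ sd (k + 1) = prev (T.glue (sd k)))
    (e : T.SnakeEdge) :
    (e = T.eastEdge (T.tileAt sd k) ∨ e = T.northEdge (T.tileAt sd k) ∨
      e = T.southEdge (T.tileAt sd (k + 1)) ∨ e = T.westEdge (T.tileAt sd (k + 1))) ↔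
    ∃ β β', turnOk (T.glue (sd k)) (sd (k + 1)) β β' ∧
      e = (T.inVtx sd k (β + 1), T.inVtx sd (k + 1) β',
        T.turnLab (T.glue (sd k)) (sd (k + 1)) β β') := by
  have hne := next_ne_prev (T.glue (sd k))
  have h1 : ∀ p : ℤ × ℤ, p + (1, 0) + (0, 1) = p + (1, 1) := fun p => by rw [add_assoc]; rfl
  have h2 : ∀ p : ℤ × ℤ, p + (0, 1) + (1, 0) = p + (1, 1) := fun p => by rw [add_assoc]; rfl
  rcases h with h | h <;> cases hp : parity k
  all_goals
    simp only [Fin.exists_fin_two]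
    simp [inVtx, hp, turnOk, turnLab, h, hne.symm, tileAt, tilePos, gluesNorth, parity,
      eastEdge, northEdge, southEdge, westEdge, Tile.se, Tile.ne, Tile.nw, Tile.sw, edge_glue,
      h1, h2]
    try tauto

theorem first_edges (e : T.SnakeEdge) :
    (e = T.southEdge (T.tileAt sd 0) ∨ e = T.westEdge (T.tileAt sd 0)) ↔
    ∃ β', e = ((0, 0), T.inVtx sd 0 β',
      if β' = 0 then T.edge (prev (sd 0)) else T.edge (next (sd 0))) := by
  simp [Fin.exists_fin_two, inVtx, parity, southEdge, westEdge, tileAt, tilePos, Tile.se,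
    Tile.nw, Tile.sw]

theorem last_edges (k : ℕ) (e : T.SnakeEdge) :
    (e = T.eastEdge (T.tileAt sd k) ∨ e = T.northEdge (T.tileAt sd k)) ↔
    ∃ β, e = (T.inVtx sd k (β + 1), (T.tileAt sd k).ne,
      if β = 0 then T.edge (prev (T.glue (sd k))) else T.edge (next (T.glue (sd k)))) := by
  cases hp : parity k <;>
  (simp [Fin.exists_fin_two, inVtx, hp, eastEdge, northEdge, tileAt, Tile.ne]; try tauto)

variable (T sd) in
/-- The snake graph of a reduced sequence of crossings as a layered graph. -/
def snakeGraph {d : ℕ} (hd : 1 ≤ d) (h : T.ReducedSeq sd d) : T.LayeredGraph d where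
  vtx := T.snakeVtx sd d
  lab := T.snakeLab sd d
  ok := T.snakeOk sd d
  edges := T.snakeEdges ((List.range' 0 d).map sd)
  level j β := by
    obtain _ | j := j
    · unfold snakeVtx; split_ifs <;> simp_all
    · by_cases hj : j = d
      · subst hj
        have := T.level_tilePos sd (j - 1)
        simp only [snakeVtx, Tile.ne, tileAt]
        split_ifs <;> simp only [Prod.fst_add, Prod.snd_add] <;> push_cast [Nat.cast_sub hd] at * <;>
          omega
      · rw [snakeVtx, if_neg (by omega), if_neg (by omega)]
        exact level_inVtx _ _
  vtx_ne j := by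
    obtain _ | j := j
    · simp [snakeVtx]
    · by_cases hj : j = d
      · subst hj; simp [snakeVtx]
      · simp only [snakeVtx, if_neg (show j + 1 ≠ 0 by omega), if_neg (show j + 1 ≠ d + 1 by omega)]
        exact inVtx_ne _
  mem_edges e := by
    rw [mem_snakeEdges]
    have h0 : ∀ β β', T.snakeVtx sd d 0 (0 + 1) = (0, 0) ∧
        T.snakeVtx sd d (0 + 1) β' = T.inVtx sd 0 β' ∧
        T.snakeLab sd d 0 β β' = if β' = 0 then T.edge (prev (sd 0)) else T.edge (next (sd 0)) :=
      fun β β' => ⟨by simp [snakeVtx], snakeVtx_succ (by omega) _, by simp [snakeLab]⟩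
    have hl : ∀ β β', T.snakeVtx sd d d β = T.inVtx sd (d - 1) β ∧
        T.snakeVtx sd d (d + 1) 0 = (T.tileAt sd (d - 1)).ne ∧ T.snakeLab sd d d β β' =
          if β = 0 then T.edge (prev (T.glue (sd (d - 1)))) else
            T.edge (next (T.glue (sd (d - 1)))) := by
      intro β β'
      have hd0 : d ≠ 0 := by omega
      exact ⟨by simp [snakeVtx, hd0], by simp [snakeVtx], by simp [snakeLab, hd0]⟩
    have hm : ∀ k, k + 1 < d → ∀ β β', T.snakeOk sd d (k + 1) β β' ↔
        turnOk (T.glue (sd k)) (sd (k + 1)) β β' := by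
      intro k hk β β'
      simp [snakeOk, show k + 1 ≠ d by omega]
    have hm' : ∀ k, k + 1 < d → ∀ β β', T.snakeVtx sd d (k + 1) β = T.inVtx sd k β ∧
        T.snakeVtx sd d (k + 1 + 1) β' = T.inVtx sd (k + 1) β' ∧
        T.snakeLab sd d (k + 1) β β' = T.turnLab (T.glue (sd k)) (sd (k + 1)) β β' := by
      intro k hk β β'
      refine ⟨snakeVtx_succ (by omega) _, snakeVtx_succ (by omega) _, ?_⟩
      simp [snakeLab, show k + 1 ≠ d by omega]
    have key : ∀ k, k + 1 < d → _ := fun k hk => mid_edges (h k hk) e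
    constructor
    · rintro ⟨k, hk, hS | hW | hEN⟩
      iterate 2
        obtain _ | k := k
        · obtain ⟨β', hβ'⟩ := (first_edges e).1 (by tauto)
          refine ⟨0, by omega, 0, β', by simp [snakeOk], ?_⟩
          rw [(h0 0 β').1, (h0 0 β').2.1, (h0 0 β').2.2]; exact hβ'
        · obtain ⟨β, β', hok, he⟩ := (key k hk).1 (by tauto)
          refine ⟨k + 1, by omega, β, β', (hm k hk _ _).2 hok, ?_⟩
          rw [(hm' k hk _ β').1, (hm' k hk β β').2.1, (hm' k hk β β').2.2]; exact he
      by_cases hkd : k + 1 < d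
      · obtain ⟨β, β', hok, he⟩ := (key k hkd).1 (by tauto)
        refine ⟨k + 1, by omega, β, β', (hm k hkd _ _).2 hok, ?_⟩
        rw [(hm' k hkd _ β').1, (hm' k hkd β β').2.1, (hm' k hkd β β').2.2]; exact he
      · obtain rfl : k = d - 1 := by omega
        obtain ⟨β, hβ⟩ := (last_edges _ e).1 (by tauto)
        refine ⟨d, le_rfl, β, 0, ?_, ?_⟩
        · simp [snakeOk, show d ≠ 0 by omega]
        · rw [(hl _ 0).1, (hl β 0).2.1, (hl β 0).2.2]; exact hβ
    · rintro ⟨j, hj, β, β', hok, he⟩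
      obtain _ | k := j
      · have hβ : β = 0 := by simpa [snakeOk] using hok
        subst hβ
        rw [(h0 0 β').1, (h0 0 β').2.1, (h0 0 β').2.2] at he
        have := (first_edges (T := T) (sd := sd) e).2 ⟨β', he⟩
        exact ⟨0, by omega, by tauto⟩
      · by_cases hkd : k + 1 < d
        · rw [(hm' k hkd _ β').1, (hm' k hkd β β').2.1, (hm' k hkd β β').2.2] at he
          have := (key k hkd).2 ⟨β, β', (hm k hkd _ _).1 hok, he⟩
          rcases this with h1 | h1 | h1 | h1
          · exact ⟨k, by omega, by tauto⟩
          · exact ⟨k, by omega, by tauto⟩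
          · exact ⟨k + 1, by omega, by tauto⟩
          · exact ⟨k + 1, by omega, by tauto⟩
        · obtain rfl : k + 1 = d := by omega
          have hβ : β' = 0 := by simpa [snakeOk] using hok
          subst hβ
          rw [(hl _ 0).1, (hl β 0).2.1, (hl β 0).2.2] at he
          have := (last_edges (T := T) (sd := sd) _ e).2 ⟨β, he⟩
          exact ⟨k, by omega, by tauto⟩
  ok_zero β β' h := by simpa [snakeOk] using h
  ok_last β β' h := by simpa [snakeOk, show d ≠ 0 by omega] using h
  covers j hj β hβ := by
    obtain _ | k := j
    · refine ⟨T.southEdge (T.tileAt sd 0), (mem_snakeEdges _).2 ⟨0, by omega, Or.inl rfl⟩, Or.inl ?_⟩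
      simp [hβ rfl, snakeVtx, southEdge, Tile.sw, tileAt, tilePos]
    · rw [snakeVtx_succ (by omega), inVtx]
      split_ifs
      · exact ⟨T.westEdge (T.tileAt sd k), (mem_snakeEdges _).2 ⟨k, by omega, by tauto⟩,
          Or.inr rfl⟩
      · exact ⟨T.southEdge (T.tileAt sd k), (mem_snakeEdges _).2 ⟨k, by omega, by tauto⟩,
          Or.inr rfl⟩

/-! ### Orientation of diagonals -/

/-- The orientation of the diagonal of a tile with a given state. -/
def stateDown (k : ℕ) (β : Fin 2) : Bool := decide (β = 1) == parity k

theorem stateDown_inj (k : ℕ) {β β' : Fin 2} : stateDown k β = stateDown k β' ↔ β = β' := by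
  cases h : parity k <;> fin_cases β <;> fin_cases β' <;> simp [stateDown, h]

theorem exists_stateDown (k : ℕ) (b : Bool) : ∃ β, b = stateDown k β := by
  cases h : parity k <;> cases b
  · exact ⟨1, by simp [stateDown, h]⟩
  · exact ⟨0, by simp [stateDown, h]⟩
  · exact ⟨0, by simp [stateDown, h]⟩
  · exact ⟨1, by simp [stateDown, h]⟩

theorem inVtx_stateDown (k : ℕ) (β : Fin 2) :
    (if stateDown k β then (T.tileAt sd k).nw else (T.tileAt sd k).se) = T.inVtx sd k β := by
  simp [stateDown, inVtx]

theorem inVtx_stateDown' (k : ℕ) (β : Fin 2) :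
    (if stateDown k β then (T.tileAt sd k).se else (T.tileAt sd k).nw) = T.inVtx sd k (β + 1) := by
  cases h : parity k <;> fin_cases β <;> simp [stateDown, inVtx, h]

variable {d : ℕ} {hd : 1 ≤ d} {hr : T.ReducedSeq sd d}

/-- The alternating path has no choice: each matching edge leads to the vertex given by the next
state, and this decides the direction of the next diagonal. -/
theorem altPath_iff {o : ℕ → Fin 2} (ho : (T.snakeGraph sd hd hr).Good o) (n k : ℕ)
    (hk : k + n = d) (ol : List Bool) (hl : ol.length = n) :
    AltPath ((T.snakeGraph sd hd hr).pathSet o) (T.tileAt sd (d - 1)).ne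
      (T.snakeVtx sd d k (o k + 1)) (((List.range' k n).map (T.tileAt sd)).zip ol) ↔
    ∀ i < n, ol[i]? = some (stateDown (k + i) (o (k + i + 1))) := by
  induction n generalizing k ol with
  | zero =>
    obtain rfl : k = d := hk
    have h1 := LayeredGraph.joined_pathSet (G := T.snakeGraph sd hd hr) (o := o) (le_refl k) (β := 0)
    have h2 := (T.snakeGraph sd hd hr).ok_last _ _ (ho k le_rfl)
    have h3 : (T.snakeGraph sd hd hr).vtx (k + 1) 0 = (T.tileAt sd (k - 1)).ne := by
      simp [snakeGraph, snakeVtx]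
    rw [h3, h2] at h1
    have h4 : Joined ((T.snakeGraph sd hd hr).pathSet o) (T.snakeVtx sd k k (o k + 1))
        (T.tileAt sd (k - 1)).ne := h1.2 rfl
    simpa [AltPath] using h4
  | succ n ih =>
    obtain _ | ⟨b, ol⟩ := ol
    · simp at hl
    obtain ⟨β, rfl⟩ := exists_stateDown k b
    rw [List.range'_succ, List.map_cons, List.zip_cons_cons, AltPath, inVtx_stateDown,
      inVtx_stateDown', ← snakeVtx_succ (show k < d by omega), ← snakeVtx_succ (show k < d by omega)]
    have h1 := LayeredGraph.joined_pathSet (G := T.snakeGraph sd hd hr) (o := o)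
      (show k ≤ d by omega) (β := β)
    change Joined _ (T.snakeVtx sd d k (o k + 1)) (T.snakeVtx sd d (k + 1) β) ↔ _ at h1
    rw [h1]
    constructor
    · rintro ⟨rfl, h2⟩ i hi
      obtain _ | i := i
      · simp
      · have := (ih (k + 1) (by omega) ol (by simpa using hl)).1 h2 i (by omega)
        rw [List.getElem?_cons_succ, this]
        simp only [show k + 1 + i = k + (i + 1) by omega]
    · intro h2
      have h3 := h2 0 (by omega)
      simp only [List.getElem?_cons_zero, Option.some_inj, add_zero, stateDown_inj] at h3
      refine ⟨h3, ?_⟩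
      rw [h3]
      refine (ih (k + 1) (by omega) ol (by simpa using hl)).2 fun i hi => ?_
      have := h2 (i + 1) (by omega)
      rw [List.getElem?_cons_succ] at this
      rw [this]
      simp only [show k + 1 + i = k + (i + 1) by omega]

theorem diagOriented_iff {o : ℕ → Fin 2} (ho : (T.snakeGraph sd hd hr).Good o) {k : ℕ} (hk : k < d)
    (b : Bool) :
    T.DiagOriented ((List.range' 0 d).map sd) ((T.snakeGraph sd hd hr).pathSet o) k b ↔
      b = stateDown k (o (k + 1)) := by
  have hhead : (T.tiles ((List.range' 0 d).map sd)).head? = some (T.tileAt sd 0) := by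
    rw [tiles_eq]
    obtain ⟨n, rfl⟩ : ∃ n, d = n + 1 := ⟨d - 1, by omega⟩
    simp [List.range'_succ]
  have hlast : (T.tiles ((List.range' 0 d).map sd)).getLast? = some (T.tileAt sd (d - 1)) := by
    rw [tiles_eq, List.getLast?_map, List.getLast?_range']
    simp [show d ≠ 0 by omega]
  have hsw : (T.tileAt sd 0).sw = T.snakeVtx sd d 0 (o 0 + 1) := by
    have h2 := (T.snakeGraph sd hd hr).ok_zero _ _ (ho 0 (Nat.zero_le _))
    rw [h2]
    simp [snakeVtx, tileAt, Tile.sw, tilePos]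
  constructor
  · rintro ⟨ol, t, t', hol, h1, h2, h3, h4⟩
    rw [hhead, Option.some_inj] at h1
    rw [hlast, Option.some_inj] at h2
    subst h1 h2
    rw [hsw, tiles_eq] at h3
    have := (altPath_iff ho d 0 (by omega) ol (by simpa using hol)).1 h3 k hk
    rw [h4] at this
    simpa using this
  · rintro rfl
    refine ⟨(List.range' 0 d).map fun i => stateDown i (o (i + 1)), _, _, by simp, hhead, hlast,
      ?_, ?_⟩
    · rw [hsw, tiles_eq]
      refine (altPath_iff ho d 0 (by omega) _ (by simp)).2 fun i hi => ?_
      simp [hi]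
    · simp [hk]

/-- The diagonal entries of the matrix of a crossing. -/
def crossWt (L : T.PrincipalLamination) (s : TSide Tri) (β : Fin 2) : T.Fld :=
  T.stepMatrix L .cross (s, false) β β

/-- States are numbered by the ends of the side rather than by north-west and south-east, so the
reversal of orientation on even tiles and the sign `(-1)^(k+1)` in the definition of `LOriented`
cancel. The weight of a state is then a diagonal entry of the clockwise crossing matrix, whatever
the parity. -/
theorem yMon_pathSet (L : T.PrincipalLamination) {o : ℕ → Fin 2}
    (ho : (T.snakeGraph sd hd hr).Good o) :
    T.yMon L ((List.range' 0 d).map sd) ((T.snakeGraph sd hd hr).pathSet o) =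
      ∏ k ∈ Finset.range d, crossWt L (sd k) (o (k + 1)) := by
  classical
  set P := (T.snakeGraph sd hd hr).pathSet o with hP
  have hget : ∀ k : Fin ((List.range' 0 d).map sd).length,
      ((List.range' 0 d).map sd).get k = sd k := fun k => by simp
  have hlen : ((List.range' 0 d).map sd).length = d := by simp
  unfold yMon
  simp only [hget]
  rw [Finset.prod_range]
  refine Fintype.prod_equiv (finCongr (by simp)) _ _ fun k => ?_
  have hk : (k : ℕ) < d := by have := k.2; omega
  simp only [finCongr_apply, Fin.val_cast, LOriented]
  have hor := fun b => diagOriented_iff ho hk b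
  rw [← hP] at hor
  simp only [hor, crossWt]
  generalize o (k + 1) = β
  have hpar := parity_eq (k : ℕ)
  by_cases hev : Even (k : ℕ)
  · simp only [hev, decide_true] at hpar
    simp only [hev, Nat.not_odd_iff_even.2 hev, stateDown, hpar]
    fin_cases β <;> simp [stepMatrix]
  · simp only [hev, decide_false] at hpar
    simp only [hev, Nat.not_even_iff_odd.1 hev, stateDown, hpar]
    fin_cases β <;> simp [stepMatrix]

end Snake

end TriangulatedSurface

/-! ### Matching sums as products of transfer matrices -/

namespace TriangulatedSurface

variable {Tri : Type*} {T : TriangulatedSurface Tri}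

/-! ### Sums over paths -/

/-- The product of the first matrices of a sequence. -/
def matProd {K : Type*} [CommSemiring K] (M : ℕ → Matrix (Fin 2) (Fin 2) K) :
    ℕ → Matrix (Fin 2) (Fin 2) K
  | 0 => 1
  | n + 1 => M n * matProd M n

theorem sum_path {K : Type*} [CommSemiring K] (M : ℕ → Matrix (Fin 2) (Fin 2) K) (n : ℕ)
    (f : Fin 2 → Fin 2 → K) :
    ∑ o : Fin (n + 1) → Fin 2, f (o 0) (o (Fin.last n)) *
      ∏ k : Fin n, M k (o k.succ) (o k.castSucc) =
    ∑ a, ∑ b, f a b * matProd M n b a := by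
  induction n generalizing f with
  | zero =>
    rw [← (Equiv.funUnique (Fin 1) (Fin 2)).symm.sum_comp]
    simp [matProd, Matrix.one_apply]
  | succ n ih =>
    rw [← (Fin.snocEquiv (fun _ : Fin (n + 2) => Fin 2)).sum_comp, Fintype.sum_prod_type]
    simp only [Fin.snocEquiv_apply, Fin.prod_univ_castSucc, Fin.snoc_last, Fin.succ_last,
      Fin.snoc_castSucc, Fin.succ_castSucc, Fin.val_castSucc, Fin.val_last]
    have h0 : ∀ (c : Fin 2) (o : Fin (n + 1) → Fin 2),
        Fin.snoc (α := fun _ : Fin (n + 2) => Fin 2) o c 0 = o 0 := fun c o => by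
      rw [← Fin.castSucc_zero, Fin.snoc_castSucc]
    simp only [h0]
    have h1 := fun c : Fin 2 => ih fun a b => f a c * M n c b
    have h2 : ∀ c : Fin 2, ∑ o : Fin (n + 1) → Fin 2, f (o 0) c *
        ((∏ k : Fin n, M k (o k.succ) (o k.castSucc)) * M n c (o (Fin.last n))) =
        ∑ a, ∑ b, f a c * M n c b * matProd M n b a := fun c => by
      rw [← h1 c]
      exact Finset.sum_congr rfl fun o _ => by ring
    simp only [h2]
    rw [Finset.sum_comm]
    refine Finset.sum_congr rfl fun a _ => Finset.sum_congr rfl fun c _ => ?_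
    rw [matProd, Matrix.mul_apply, Finset.mul_sum]
    exact Finset.sum_congr rfl fun b _ => by ring

/-! ### Transfer matrices -/

open Classical in
/-- The transfer matrix of a passage from `e` to `s'`. -/
def turnMat (e s' : TSide Tri) : Matrix (Fin 2) (Fin 2) T.Fld :=
  fun β' β => if turnOk e s' β β' then T.x (T.turnLab e s' β β') else 0

/-- The matrix of a crossing in clockwise direction. -/
def crossMat (L : T.PrincipalLamination) (s : TSide Tri) : Matrix (Fin 2) (Fin 2) T.Fld :=
  T.stepMatrix L .cross (s, false)

theorem crossMat_eq (L : T.PrincipalLamination) (s : TSide Tri) :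
    crossMat L s = Matrix.diagonal (crossWt L s) := by
  ext i j
  fin_cases i <;> fin_cases j <;> simp [crossMat, crossWt, stepMatrix]

/-- The transfer matrices of a sequence of crossings. -/
def transfer (L : T.PrincipalLamination) (sd : ℕ → TSide Tri) (k : ℕ) :
    Matrix (Fin 2) (Fin 2) T.Fld :=
  turnMat (T.glue (sd k)) (sd (k + 1)) * crossMat L (sd k)

/-- The matrix of a sequence of crossings. -/
def coreMat (L : T.PrincipalLamination) (sd : ℕ → TSide Tri) (n : ℕ) :
    Matrix (Fin 2) (Fin 2) T.Fld :=
  crossMat L (sd n) * matProd (transfer L sd) n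

theorem coreMat_succ (L : T.PrincipalLamination) (sd : ℕ → TSide Tri) (n : ℕ) :
    coreMat L sd (n + 1) =
      crossMat L (sd (n + 1)) * (turnMat (T.glue (sd n)) (sd (n + 1)) * coreMat L sd n) := by
  simp only [coreMat, matProd, transfer, Matrix.mul_assoc]

variable (T) in
/-- The diagonal matrix by which frames at a side are rescaled. -/
def scaleMat (c : T.Fld) : Matrix (Fin 2) (Fin 2) T.Fld := Matrix.diagonal ![1, c]

theorem scaleMat_mul (c c' : T.Fld) : T.scaleMat c * T.scaleMat c' = T.scaleMat (c * c') := by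
  rw [scaleMat, scaleMat, scaleMat, Matrix.diagonal_mul_diagonal]
  congr 1
  funext i
  fin_cases i <;> simp

theorem scaleMat_inv_mul {c : T.Fld} (h : c ≠ 0) : T.scaleMat c * T.scaleMat c⁻¹ = 1 := by
  rw [scaleMat_mul, mul_inv_cancel₀ h, scaleMat, ← Matrix.diagonal_one]
  congr 1
  funext i
  fin_cases i <;> simp

theorem scaleMat_comm (L : T.PrincipalLamination) (s : TSide Tri) (c : T.Fld) :
    crossMat L s * T.scaleMat c = T.scaleMat c * crossMat L s := by
  rw [crossMat_eq, scaleMat, Matrix.diagonal_mul_diagonal, Matrix.diagonal_mul_diagonal]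
  congr 1
  funext i
  exact mul_comm _ _

theorem frame_inv_mul_frame (L : T.PrincipalLamination) (p : MPoint Tri) (ks : List StepType)
    (h : T.pathWord p ks = []) :
    EqNeg ((T.frame (T.pathEnd p ks))⁻¹ * T.frame p) (T.pathMatrix L p ks) := by
  have := T.pathMatrix_eqNeg L p ks
  rw [h, transport, Matrix.mul_one] at this
  exact this.symm

/-- The bridge between frames and matchings. Rescaling the first coordinate against the second by
the variable of the side turns the change of frame into a matrix whose entries are variables or
zero, without minus signs, up to one overall sign. -/
theorem frame_turn_eq (L : T.PrincipalLamination) (e s' : TSide Tri)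
    (h : s' = next e ∨ s' = prev e) :
    EqNeg ((T.frame (s', false))⁻¹ * T.frame (e, true))
      ((T.x (T.edge e))⁻¹ • (T.scaleMat (T.x (T.edge s'))⁻¹ * turnMat e s' *
        T.scaleMat (T.x (T.edge e)))) := by
  have he := T.x_ne_zero (T.edge e)
  have hs := T.x_ne_zero (T.edge s')
  rcases h with rfl | rfl
  · refine (frame_inv_mul_frame L (e, true) [.turn] rfl).trans (Or.inl ?_)
    ext i j
    fin_cases i <;> fin_cases j <;>
      simp [pathMatrix, stepMatrix, turnMat, turnOk, turnLab, scaleMat] <;>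
      field_simp
  · have hne := (next_ne_prev e).symm
    -- The single step `turn` at the head of `e` leads to `next e`. To reach `prev e` the path goes
    -- along `e`, turns about its tail and runs back along `prev e`; this produces the overall sign.
    refine (frame_inv_mul_frame L (e, true) [.along, .turn, .along] rfl).trans (Or.inr ?_)
    ext i j
    fin_cases i <;> fin_cases j <;>
      simp [pathMatrix, stepMatrix, turnMat, turnOk, turnLab, scaleMat, stepEnd, hne] <;>
      field_simp

theorem transport_append (L : T.PrincipalLamination) (w w' : List (TSide Tri)) :
    T.transport L (w ++ w') = T.transport L w' * T.transport L w := by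
  induction w with
  | nil => simp [transport]
  | cons s w ih => rw [List.cons_append, transport, ih, transport, Matrix.mul_assoc]

theorem range'_map_succ {α : Type*} (sd : ℕ → α) (n : ℕ) :
    (List.range' 0 (n + 1)).map sd = (List.range' 0 n).map sd ++ [sd n] := by
  simp [List.range'_concat]

theorem crossMon_succ (sd : ℕ → TSide Tri) (n : ℕ) :
    T.crossMon ((List.range' 0 (n + 1)).map sd) =
      T.crossMon ((List.range' 0 n).map sd) * T.x (T.edge (sd n)) := by
  rw [range'_map_succ, crossMon, crossMon]
  simp

theorem crossMon_ne_zero (w : List (TSide Tri)) : T.crossMon w ≠ 0 := by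
  induction w with
  | nil => simp [crossMon]
  | cons s w ih =>
    rw [crossMon, List.map_cons, List.prod_cons]
    exact mul_ne_zero (T.x_ne_zero _) ih

/-- In the induction the rescaling at the end of one turn cancels against that at the start of the
next one, since it commutes with the diagonal crossing matrix. The scalars left over accumulate to
the crossing monomial of all but the last crossing. -/
theorem transport_frame (L : T.PrincipalLamination) (sd : ℕ → TSide Tri) (n : ℕ)
    (h : T.ReducedSeq sd (n + 1)) :
    EqNeg (T.transport L ((List.range' 0 (n + 1)).map sd) * T.frame (sd 0, false))
      ((T.crossMon ((List.range' 0 n).map sd))⁻¹ • (T.frame (T.glue (sd n), true) *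
        (T.scaleMat (T.x (T.edge (sd n)))⁻¹ * (coreMat L sd n *
          T.scaleMat (T.x (T.edge (sd 0))))))) := by
  induction n with
  | zero =>
    refine Or.inl ?_
    have h1 := T.frame_cross_false L (sd 0)
    simp only [List.range', List.map_cons, List.map_nil, transport, Matrix.one_mul, ← h1]
    simp only [crossMon, List.map_nil, List.prod_nil, inv_one, one_smul, coreMat, matProd,
      Matrix.mul_one, scaleMat_comm]
    rw [← Matrix.mul_assoc (T.scaleMat _), scaleMat_mul, inv_mul_cancel₀ (T.x_ne_zero _), scaleMat]
    have : (Matrix.diagonal ![1, 1] : Matrix (Fin 2) (Fin 2) T.Fld) = 1 := by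
      ext i j; fin_cases i <;> fin_cases j <;> simp
    rw [this, Matrix.one_mul]
    rfl
  | succ n ih =>
    have ih := ih fun k hk => h k (by omega)
    have hx := T.x_ne_zero (T.edge (sd n))
    rw [range'_map_succ, transport_append]
    simp only [transport, Matrix.one_mul]
    rw [Matrix.mul_assoc]
    refine ((EqNeg.refl _).mul ih).trans ?_
    have hturn := frame_turn_eq L (T.glue (sd n)) (sd (n + 1)) (h n (by omega))
    have h1 := ((EqNeg.refl (T.frame (T.glue (sd (n + 1)), true) * crossMat L (sd (n + 1)))).mul
      hturn).mul (EqNeg.refl (T.scaleMat (T.x (T.edge (sd n)))⁻¹ * (coreMat L sd n *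
          T.scaleMat (T.x (T.edge (sd 0))))))
    have h2 := h1.map (fun M => (T.crossMon ((List.range' 0 n).map sd))⁻¹ • M) (fun M => smul_neg _ M)
    refine EqNeg.trans (Or.inl ?_) (h2.trans (Or.inl ?_))
    · simp only [crossing, crossMat, Matrix.mul_smul, Matrix.mul_assoc]
    · rw [crossMon_succ, coreMat_succ, edge_glue, mul_inv, ← smul_smul]
      congr 1
      simp only [Matrix.mul_smul, Matrix.smul_mul]
      congr 1
      simp only [Matrix.mul_assoc]
      rw [← Matrix.mul_assoc (T.scaleMat (T.x (T.edge (sd n)))), scaleMat_inv_mul hx,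
        Matrix.one_mul, ← Matrix.mul_assoc (crossMat L _), scaleMat_comm, Matrix.mul_assoc]

/-! ### Snake graph expansions -/

/-- The weights of the first edges of a snake graph. -/
def firstWt (s : TSide Tri) (β : Fin 2) : T.Fld :=
  if β = 0 then T.x (T.edge (prev s)) else T.x (T.edge (next s))

/-- The numerator of the expansion of an arc. -/
def arcCore (L : T.PrincipalLamination) (sd : ℕ → TSide Tri) (n : ℕ) : T.Fld :=
  ∑ a, ∑ b, firstWt (T.glue (sd n)) b * coreMat L sd n b a * firstWt (sd 0) a

/-- For a first factor of determinant one the inverse is the adjugate, so only the second columns of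
the two outer matrices enter. -/
theorem inv_mul_apply_zero_one (A M B : Matrix (Fin 2) (Fin 2) T.Fld) (hA : A.det = 1) :
    (A⁻¹ * M * B) 0 1 = (M 0 0 * B 0 1 + M 0 1 * B 1 1) * A 1 1 -
      (M 1 0 * B 0 1 + M 1 1 * B 1 1) * A 0 1 := by
  rw [Matrix.inv_def, hA, Matrix.adjugate_fin_two]
  simp only [Matrix.mul_apply, Fin.sum_univ_two, Ring.inverse_one, one_smul, Matrix.of_apply,
    Matrix.cons_val_zero, Matrix.cons_val_one]
  ring

/-- The upper right entry of the matrix of a path depends only on its word and on the corners of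
its ends. -/
theorem frame_inv_mul_apply_congr {p p' q q' : MPoint Tri} (hp : p.corner = p'.corner)
    (hq : q.corner = q'.corner) (M : Matrix (Fin 2) (Fin 2) T.Fld) :
    ((T.frame q)⁻¹ * M * T.frame p) 0 1 = ((T.frame q')⁻¹ * M * T.frame p') 0 1 := by
  rw [inv_mul_apply_zero_one _ _ _ (T.det_frame _), inv_mul_apply_zero_one _ _ _ (T.det_frame _)]
  simp only [frame_apply_one, hp, hq]

/-- The end points are the corners opposite to the first and the last crossed side. Moving from the
frames at these corners to the frames at the sides supplies the weights of the two outermost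
matching edges and the missing factor of the crossing monomial. -/
theorem frame_transport_arc (L : T.PrincipalLamination) (sd : ℕ → TSide Tri) (n : ℕ)
    (h : T.ReducedSeq sd (n + 1)) (p q : MPoint Tri) (hp : p.corner = prev (sd 0))
    (hq : q.corner = prev (T.glue (sd n))) :
    EqNeg (((T.frame q)⁻¹ * T.transport L ((List.range' 0 (n + 1)).map sd) * T.frame p) 0 1)
      (1 / T.crossMon ((List.range' 0 (n + 1)).map sd) * arcCore L sd n) := by
  set e := T.glue (sd n) with he
  have hxe := T.x_ne_zero (T.edge e)
  have hx0 := T.x_ne_zero (T.edge (sd 0))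
  have hxp := T.x_ne_zero (T.edge (prev (sd 0)))
  have hxn := T.x_ne_zero (T.edge (next e))
  have hcr := crossMon_ne_zero (T := T) ((List.range' 0 n).map sd)
  -- The points at the ends may be changed within their corners; these ones are reached from the
  -- crossed sides by one turn and one step along a side.
  rw [frame_inv_mul_apply_congr (T := T) (p' := (prev (sd 0), false)) (q' := (next e, true))
    (by rw [hp]; rfl) (by rw [hq]; simp [MPoint.corner])]
  have h1 : EqNeg (T.frame (prev (sd 0), false))
      (T.frame (sd 0, false) * T.pathMatrix L (prev (sd 0), false) [.along, .turn]) := by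
    have := (EqNeg.refl (T.frame (sd 0, false))).mul
      (frame_inv_mul_frame L (prev (sd 0), false) [.along, .turn] rfl)
    simp only [pathEnd, stepEnd, Bool.not_false, next_prev] at this
    rwa [← Matrix.mul_assoc, Matrix.mul_nonsing_inv _ (T.isUnit_det_frame _),
      Matrix.one_mul] at this
  have h2 := frame_inv_mul_frame L (e, true) [.turn, .along] rfl
  simp only [pathEnd, stepEnd, Bool.not_false] at h2
  have h3 := transport_frame L sd n h
  have h4 := ((EqNeg.refl ((T.frame (next e, true))⁻¹)).mul
    (EqNeg.refl (T.transport L ((List.range' 0 (n + 1)).map sd)))).mul h1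
  rw [← Matrix.mul_assoc, Matrix.mul_assoc _ _ (T.frame (sd 0, false))] at h4
  have h5 := ((EqNeg.refl ((T.frame (next e, true))⁻¹)).mul h3).mul
    (EqNeg.refl (T.pathMatrix L (prev (sd 0), false) [.along, .turn]))
  rw [Matrix.mul_smul, ← Matrix.mul_assoc _ (T.frame _)] at h5
  have h6 := ((h2.mul (EqNeg.refl (T.scaleMat (T.x (T.edge (sd n)))⁻¹ * (coreMat L sd n *
    T.scaleMat (T.x (T.edge (sd 0))))))).map
    (fun M => (T.crossMon ((List.range' 0 n).map sd))⁻¹ • M) (fun M => smul_neg _ M)).mul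
    (EqNeg.refl (T.pathMatrix L (prev (sd 0), false) [.along, .turn]))
  have h7 := (h4.trans (h5.trans h6)).map (fun M => M 0 1) (fun M => rfl)
  refine h7.trans (Or.inl ?_)
  have hxs : T.x (T.edge (sd n)) = T.x (T.edge e) := by rw [he, edge_glue]
  simp only [crossMon_succ, arcCore, firstWt, pathMatrix, stepMatrix, stepEnd, Matrix.one_mul,
    scaleMat, Matrix.smul_apply, Matrix.mul_apply, Fin.sum_univ_two,
    Matrix.diagonal_apply, hxs]
  simp
  field_simp
  ring

-- The function `g` holds whatever depends on the first and the last state only: the two end edges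
-- for an arc, the closing turn for a band. This lets arcs and loops share one computation.
open Classical in
theorem sum_perfectMatchings (L : T.PrincipalLamination) (sd : ℕ → TSide Tri) (n : ℕ)
    (h : T.ReducedSeq sd (n + 1)) (g : Fin 2 → Fin 2 → T.Fld)
    (f : Finset T.SnakeEdge → T.Fld)
    (hf : ∀ o, (T.snakeGraph sd (Nat.le_add_left 1 n) h).Good o →
      f ((T.snakeGraph sd (Nat.le_add_left 1 n) h).pathSet o) = g (o 1) (o (n + 1)) *
        ∏ k ∈ Finset.range n, T.x (T.turnLab (T.glue (sd k)) (sd (k + 1)) (o (k + 1)) (o (k + 2)))) :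
    ∑ P ∈ (T.snakeEdges ((List.range' 0 (n + 1)).map sd)).powerset with
        T.IsPerfectMatching ((List.range' 0 (n + 1)).map sd) P,
      f P * T.yMon L ((List.range' 0 (n + 1)).map sd) P =
    ∑ a, ∑ b, g a b * coreMat L sd n b a := by
  set G := T.snakeGraph sd (Nat.le_add_left 1 n) h with hG
  have h1 := G.sum_isPM fun P => f P * T.yMon L ((List.range' 0 (n + 1)).map sd) P
  have h2 := sum_path (transfer L sd) n fun a b => g a b * crossWt L (sd n) b
  have h3 : ∀ a b, g a b * coreMat L sd n b a =
      g a b * crossWt L (sd n) b * matProd (transfer L sd) n b a := fun a b => by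
    rw [coreMat, crossMat_eq, Matrix.diagonal_mul, mul_assoc]
  simp only [h3, ← h2]
  refine h1.trans (Finset.sum_congr rfl fun o _ => ?_)
  set o' := Fin.extendZero o with ho'
  have ho0 : o' 0 = 0 := rfl
  have hol : o' (n + 1 + 1) = 0 := by simp [ho', Fin.extendZero]
  have hok : ∀ k (hk : k < n + 1), o' (k + 1) = o ⟨k, hk⟩ := fun k hk => by
    simp [ho', Fin.extendZero, hk]
  have hgood : G.Good o' ↔
      ∀ k : Fin n, turnOk (T.glue (sd k)) (sd (k + 1)) (o k.castSucc) (o k.succ) := by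
    constructor
    · intro hg k
      have := hg (k + 1) (by omega)
      change T.snakeOk sd (n + 1) (k + 1) _ _ at this
      rw [hok k (by omega), hok (k + 1) (by omega)] at this
      rw [snakeOk, if_neg (by omega), if_neg (by omega)] at this
      exact this
    · intro hg j hj
      change T.snakeOk sd (n + 1) j _ _
      obtain _ | j := j
      · simp [snakeOk, ho0]
      · by_cases hjn : j = n
        · subst hjn; simp [snakeOk, hol]
        · have := hg ⟨j, by omega⟩
          rw [hok j (by omega), hok (j + 1) (by omega)]
          simpa [snakeOk, hjn] using this
  have hprod : ∏ k : Fin n, transfer L sd k (o k.succ) (o k.castSucc) =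
      (if G.Good o' then ∏ k ∈ Finset.range n,
        T.x (T.turnLab (T.glue (sd k)) (sd (k + 1)) (o' (k + 1)) (o' (k + 2))) else 0) *
      ∏ k ∈ Finset.range n, crossWt L (sd k) (o' (k + 1)) := by
    have hentry : ∀ k : Fin n, transfer L sd k (o k.succ) (o k.castSucc) =
        (if turnOk (T.glue (sd k)) (sd (k + 1)) (o k.castSucc) (o k.succ) then
          T.x (T.turnLab (T.glue (sd k)) (sd (k + 1)) (o' (k + 1)) (o' (k + 2))) else 0) *
        crossWt L (sd k) (o' (k + 1)) := by
      intro k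
      rw [transfer, crossMat_eq, Matrix.mul_diagonal, hok k (by omega), hok (k + 1) (by omega)]
      rfl
    simp only [hentry, Finset.prod_mul_distrib, hgood]
    rw [Finset.prod_range fun k => crossWt L (sd k) (o' (k + 1))]
    congr 1
    rw [Finset.prod_ite_zero, Finset.prod_range]
    simp
  rw [hprod]
  split_ifs with hg
  · rw [hf o' hg, hG, yMon_pathSet L hg, Finset.prod_range_succ, hok 0 (by omega), hok n (by omega)]
    simp only [Fin.last, Fin.zero_eta]
    ring
  · ring

end TriangulatedSurface

/-! ### Good matchings and the trace formula -/

namespace TriangulatedSurface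

variable {Tri : Type*} {T : TriangulatedSurface Tri}

/-! ### Good matchings of band graphs -/

/-- Two vertices become equal if the edges `a` and `a'` are identified. -/
def BandRel (a a' : T.SnakeEdge) (u v : ℤ × ℤ) : Prop :=
  u = v ∨ (u = a.1 ∧ v = a'.1) ∨ (u = a'.1 ∧ v = a.1) ∨ (u = a.2.1 ∧ v = a'.2.1) ∨
    (u = a'.2.1 ∧ v = a.2.1)

/-- The two ends of `a` and of `a'` are four vertices, and no edge joins vertices which are
identified. -/
structure BandPair (E : Finset T.SnakeEdge) (a a' : T.SnakeEdge) : Prop where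
  mem : a ∈ E
  mem' : a' ∈ E
  ne : a.1 ≠ a.2.1
  ne' : a'.1 ≠ a'.2.1
  ne₁₁ : a.1 ≠ a'.1
  ne₁₂ : a.1 ≠ a'.2.1
  ne₂₁ : a.2.1 ≠ a'.1
  ne₂₂ : a.2.1 ≠ a'.2.1
  inc₁ : ∀ e ∈ E, (e.1 = a.1 ∨ e.2.1 = a.1) → ¬(e.1 = a'.1 ∨ e.2.1 = a'.1)
  inc₂ : ∀ e ∈ E, (e.1 = a.2.1 ∨ e.2.1 = a.2.1) → ¬(e.1 = a'.2.1 ∨ e.2.1 = a'.2.1)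

namespace BandPair

variable {E : Finset T.SnakeEdge} {a a' : T.SnakeEdge}

theorem symm (h : BandPair E a a') : BandPair E a' a :=
  ⟨h.mem', h.mem, h.ne', h.ne, h.ne₁₁.symm, h.ne₂₁.symm, h.ne₁₂.symm, h.ne₂₂.symm,
    fun e he h1 h2 => h.inc₁ e he h2 h1, fun e he h1 h2 => h.inc₂ e he h2 h1⟩

theorem bandVertex_eq_iff (h : BandPair E a a') (u v : ℤ × ℤ) :
    bandVertex a a' u = bandVertex a a' v ↔ BandRel a a' u v := by
  obtain ⟨_, _, h1, h2, h3, h4, h5, h6, _, _⟩ := h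
  unfold bandVertex BandRel
  constructor
  · intro h
    split_ifs at h <;> simp_all
  · rintro (h | ⟨rfl, rfl⟩ | ⟨rfl, rfl⟩ | ⟨rfl, rfl⟩ | ⟨rfl, rfl⟩)
    · rw [h]
    · simp [h3, h4]
    · simp [h3, h4]
    · simp [h2.symm, h5, h6]
    · simp [h2.symm, h5, h6]

end BandPair

theorem BandRel.swap {a a' : T.SnakeEdge} {u v : ℤ × ℤ} : BandRel a a' u v ↔ BandRel a' a u v := by
  unfold BandRel; tauto

theorem BandRel.of_inc {a a' e : T.SnakeEdge} {u v : ℤ × ℤ} (h : BandRel a a' u v)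
    (he : e.1 = u ∨ e.2.1 = u) : BandRel a a' e.1 v ∨ BandRel a a' e.2.1 v := by
  rcases he with rfl | rfl
  · exact Or.inl h
  · exact Or.inr h

theorem BandRel.fst (a a' : T.SnakeEdge) : BandRel a a' a.1 a'.1 := Or.inr (Or.inl ⟨rfl, rfl⟩)

theorem BandRel.snd (a a' : T.SnakeEdge) : BandRel a a' a.2.1 a'.2.1 :=
  Or.inr (Or.inr (Or.inr (Or.inl ⟨rfl, rfl⟩)))

theorem BandRel.refl (a a' : T.SnakeEdge) (v : ℤ × ℤ) : BandRel a a' v v := Or.inl rfl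

/-- Up to identification of vertices, every vertex covered by `E` is covered by exactly one edge
of `P`. -/
def BandMatching (E : Finset T.SnakeEdge) (a a' : T.SnakeEdge) (P : Finset T.SnakeEdge) : Prop :=
  ∀ v, Covers E v → ∃! e, e ∈ P ∧ (BandRel a a' e.1 v ∨ BandRel a a' e.2.1 v)

theorem BandMatching.swap {E : Finset T.SnakeEdge} {a a' : T.SnakeEdge} {P : Finset T.SnakeEdge}
    (h : BandMatching E a a' P) : BandMatching E a' a P := by
  intro v hv
  simp only [BandRel.swap (a := a') (a' := a)]
  exact h v hv

-- If both ends of `a` are matched by edges at these very vertices, then the ends of `a'` are free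
-- in the cut-open graph: an edge there would compete for the same identified vertex, and it could
-- not be the same edge because no edge meets both copies.
open Classical in
theorem BandMatching.isPM_insert {E : Finset T.SnakeEdge} {a a' : T.SnakeEdge}
    {P : Finset T.SnakeEdge} (hE : BandPair E a a') (hPE : P ⊆ E) (h : BandMatching E a a' P)
    (h1 : Covers P a.1) (h2 : Covers P a.2.1) : IsPM E (insert a' P) := by
  refine ⟨Finset.insert_subset hE.mem' hPE, fun v hv => ?_⟩
  have huniq : ∀ v, Covers E v → ∀ e ∈ P, ∀ e' ∈ P, (BandRel a a' e.1 v ∨ BandRel a a' e.2.1 v) →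
      (BandRel a a' e'.1 v ∨ BandRel a a' e'.2.1 v) → e = e' := by
    intro v hv e he e' he' h1 h2
    exact (h v hv).unique ⟨he, h1⟩ ⟨he', h2⟩
  by_cases hv1 : v = a'.1
  · subst hv1
    refine ⟨a', ⟨Finset.mem_insert_self _ _, Or.inl rfl⟩, ?_⟩
    rintro e ⟨he, hev⟩
    rcases Finset.mem_insert.1 he with rfl | he
    · rfl
    · obtain ⟨e0, he0, hev0⟩ := h1
      have := huniq _ hv e he e0 he0 ((BandRel.refl _ _ _).of_inc hev)
        ((BandRel.fst a a').of_inc hev0)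
      subst this
      exact (hE.inc₁ e (hPE he) hev0 hev).elim
  by_cases hv2 : v = a'.2.1
  · subst hv2
    refine ⟨a', ⟨Finset.mem_insert_self _ _, Or.inr rfl⟩, ?_⟩
    rintro e ⟨he, hev⟩
    rcases Finset.mem_insert.1 he with rfl | he
    · rfl
    · obtain ⟨e0, he0, hev0⟩ := h2
      have := huniq _ hv e he e0 he0 ((BandRel.refl _ _ _).of_inc hev)
        ((BandRel.snd a a').of_inc hev0)
      subst this
      exact (hE.inc₂ e (hPE he) hev0 hev).elim
  have hcov : Covers P v := by
    obtain ⟨e, ⟨he, hev⟩, _⟩ := h v hv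
    by_cases hva : v = a.1
    · subst hva; exact h1
    by_cases hva2 : v = a.2.1
    · subst hva2; exact h2
    refine ⟨e, he, ?_⟩
    have hrel : ∀ u, BandRel a a' u v → u = v := by
      rintro u (h | h | h | h | h)
      · exact h
      · exact (hv1 h.2).elim
      · exact (hva h.2).elim
      · exact (hv2 h.2).elim
      · exact (hva2 h.2).elim
    rcases hev with h | h
    · exact Or.inl (hrel _ h)
    · exact Or.inr (hrel _ h)
  obtain ⟨e, he, hev⟩ := hcov
  refine ⟨e, ⟨Finset.mem_insert_of_mem he, hev⟩, ?_⟩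
  rintro e' ⟨he', hev'⟩
  rcases Finset.mem_insert.1 he' with rfl | he'
  · rcases hev' with h | h
    · exact (hv1 h.symm).elim
    · exact (hv2 h.symm).elim
  · exact huniq v hv e' he' e he ((BandRel.refl _ _ _).of_inc hev') ((BandRel.refl _ _ _).of_inc hev)

open Classical in
theorem IsPM.covers_erase {E : Finset T.SnakeEdge} {a a' : T.SnakeEdge} {Q : Finset T.SnakeEdge}
    (hE : BandPair E a a') (hQ : IsPM E Q) :
    Covers (Q.erase a') a.1 ∧ Covers (Q.erase a') a.2.1 := by
  constructor
  · obtain ⟨e, ⟨he, hev⟩, _⟩ := hQ.2 a.1 ⟨a, hE.mem, Or.inl rfl⟩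
    refine ⟨e, Finset.mem_erase.2 ⟨?_, he⟩, hev⟩
    rintro rfl
    rcases hev with h | h
    · exact hE.ne₁₁ h.symm
    · exact hE.ne₁₂ h.symm
  · obtain ⟨e, ⟨he, hev⟩, _⟩ := hQ.2 a.2.1 ⟨a, hE.mem, Or.inr rfl⟩
    refine ⟨e, Finset.mem_erase.2 ⟨?_, he⟩, hev⟩
    rintro rfl
    rcases hev with h | h
    · exact hE.ne₂₁ h.symm
    · exact hE.ne₂₂ h.symm

-- After removal of `a'` nothing is left at its two ends, so each identified vertex is covered
-- exactly once, by the edge at the corresponding end of `a`.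
open Classical in
theorem IsPM.bandMatching_erase {E : Finset T.SnakeEdge} {a a' : T.SnakeEdge}
    {Q : Finset T.SnakeEdge} (hE : BandPair E a a') (hQ : IsPM E Q) (ha' : a' ∈ Q) :
    BandMatching E a a' (Q.erase a') := by
  have hend : ∀ e ∈ Q.erase a', ¬(e.1 = a'.1 ∨ e.2.1 = a'.1) ∧
      ¬(e.1 = a'.2.1 ∨ e.2.1 = a'.2.1) := by
    intro e he
    obtain ⟨hne, he⟩ := Finset.mem_erase.1 he
    constructor
    · intro h
      exact hne ((hQ.2 a'.1 ⟨a', hE.mem', Or.inl rfl⟩).unique ⟨he, h⟩ ⟨ha', Or.inl rfl⟩)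
    · intro h
      exact hne ((hQ.2 a'.2.1 ⟨a', hE.mem', Or.inr rfl⟩).unique ⟨he, h⟩ ⟨ha', Or.inr rfl⟩)
  obtain ⟨hc1, hc2⟩ := hQ.covers_erase hE
  have key : ∀ v u, Covers E u → Covers (Q.erase a') u → BandRel a a' u v →
      (∀ e ∈ Q.erase a', ∀ z, (e.1 = z ∨ e.2.1 = z) → BandRel a a' z v → z = u) →
      ∃! e, e ∈ Q.erase a' ∧ (BandRel a a' e.1 v ∨ BandRel a a' e.2.1 v) := by
    rintro v u huE ⟨e, he, heu⟩ hrel hall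
    refine ⟨e, ⟨he, ?_⟩, ?_⟩
    · rcases heu with h | h
      · exact Or.inl (h ▸ hrel)
      · exact Or.inr (h ▸ hrel)
    · rintro e' ⟨he', h'⟩
      refine (hQ.2 u huE).unique ⟨(Finset.mem_erase.1 he').2, ?_⟩ ⟨(Finset.mem_erase.1 he).2, heu⟩
      rcases h' with h' | h'
      · exact Or.inl (hall e' he' _ (Or.inl rfl) h')
      · exact Or.inr (hall e' he' _ (Or.inr rfl) h')
  intro v hv
  by_cases hv1 : v = a'.1
  · subst hv1
    refine key _ a.1 ⟨a, hE.mem, Or.inl rfl⟩ hc1 (BandRel.fst a a') ?_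
    intro e he z hz hrel
    have h1 := hend e he
    unfold BandRel at hrel
    rcases hrel with h | h | h | h | h
    · subst h; exact (h1.1 hz).elim
    · exact h.1
    · exact (hE.ne₁₁ h.2.symm).elim
    · exact (hE.ne' h.2).elim
    · exact (hE.ne₂₁ h.2.symm).elim
  by_cases hv2 : v = a'.2.1
  · subst hv2
    refine key _ a.2.1 ⟨a, hE.mem, Or.inr rfl⟩ hc2 (BandRel.snd a a') ?_
    intro e he z hz hrel
    have h1 := hend e he
    unfold BandRel at hrel
    rcases hrel with h | h | h | h | h
    · subst h; exact (h1.2 hz).elim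
    · exact (hE.ne' h.2.symm).elim
    · exact (hE.ne₁₂ h.2.symm).elim
    · exact h.1
    · exact (hE.ne₂₂ h.2.symm).elim
  refine key v v hv ?_ (Or.inl rfl) ?_
  · obtain ⟨e, ⟨he, hev⟩, _⟩ := hQ.2 v hv
    refine ⟨e, Finset.mem_erase.2 ⟨?_, he⟩, hev⟩
    rintro rfl
    rcases hev with h | h
    · exact hv1 h.symm
    · exact hv2 h.symm
  · intro e he z hz hrel
    have h1 := hend e he
    unfold BandRel at hrel
    rcases hrel with h | h | h | h | h
    · exact h
    · exact (hv1 h.2).elim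
    · exact (h1.1 (h.1 ▸ hz)).elim
    · exact (hv2 h.2).elim
    · exact (h1.2 (h.1 ▸ hz)).elim

open Classical in
/-- The sum over good matchings as a sum over perfect matchings which contain the identified
edge. -/
theorem sum_goodMatchings (w : List (TSide Tri)) (a a' : T.SnakeEdge)
    (hE : BandPair (T.snakeEdges w) a a') (hlab : a.2.2 = a'.2.2)
    (F : Finset T.SnakeEdge → T.Fld) :
    ∑ P ∈ (T.snakeEdges w).powerset with T.IsGoodMatching w a a' P,
        T.xMon P * F (T.bandLift a a' P) =
      ∑ Q ∈ (T.snakeEdges w).powerset with T.IsPerfectMatching w Q,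
        (if a ∈ Q ∨ a' ∈ Q then T.xMon Q / T.x a.2.2 else 0) * F Q := by
  set E := T.snakeEdges w with hEdef
  have hgood : ∀ P, T.IsGoodMatching w a a' P ↔ P ⊆ E.erase a' ∧ BandMatching E a a' P ∧
      ((Covers P a.1 ∧ Covers P a.2.1) ∨ (Covers P a'.1 ∧ Covers P a'.2.1)) := by
    intro P
    simp only [IsGoodMatching, BandMatching, hE.bandVertex_eq_iff]
    exact Iff.rfl
  have hne : a ≠ a' := fun h => hE.ne₁₁ (by rw [h])
  have hsum : ∑ Q ∈ E.powerset with T.IsPerfectMatching w Q,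
      (if a ∈ Q ∨ a' ∈ Q then T.xMon Q / T.x a.2.2 else 0) * F Q =
      ∑ Q ∈ (E.powerset.filter fun Q => T.IsPerfectMatching w Q).filter fun Q => a ∈ Q ∨ a' ∈ Q,
        T.xMon Q / T.x a.2.2 * F Q := by
    rw [Finset.sum_filter (fun Q => a ∈ Q ∨ a' ∈ Q)]
    exact Finset.sum_congr rfl fun Q _ => by split_ifs <;> simp
  rw [hsum]
  have hx := T.x_ne_zero a.2.2
  -- A matching of the cut-open graph may contain both copies. Then `a'` is removed, in accordance
  -- with `bandLift`, which puts `a'` back as soon as both ends of `a` are covered.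
  refine Finset.sum_bij' (fun P _ => T.bandLift a a' P)
    (fun Q _ => if a' ∈ Q then Q.erase a' else Q.erase a) ?_ ?_ ?_ ?_ ?_
  · intro P hP
    obtain ⟨hPE, hM, hC⟩ := (hgood P).1 (Finset.mem_filter.1 hP).2
    have hPE' := hPE.trans (Finset.erase_subset _ _)
    have hPM : T.IsPerfectMatching w (T.bandLift a a' P) := by
      unfold bandLift
      split_ifs with h
      · exact hM.isPM_insert hE hPE' h.1 h.2
      · have h' := hC.resolve_left h
        exact hM.swap.isPM_insert hE.symm hPE' h'.1 h'.2
    refine Finset.mem_filter.2 ⟨Finset.mem_filter.2 ⟨Finset.mem_powerset.2 hPM.1, hPM⟩, ?_⟩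
    unfold bandLift
    split_ifs
    · exact Or.inr (Finset.mem_insert_self _ _)
    · exact Or.inl (Finset.mem_insert_self _ _)
  · intro Q hQ
    obtain ⟨hQ, ha⟩ := Finset.mem_filter.1 hQ
    have hPM : IsPM E Q := (Finset.mem_filter.1 hQ).2
    have hg : T.IsGoodMatching w a a' (if a' ∈ Q then Q.erase a' else Q.erase a) := by
      rw [hgood]
      split_ifs with ha'
      · exact ⟨Finset.erase_subset_erase _ hPM.1, hPM.bandMatching_erase hE ha',
          Or.inl (hPM.covers_erase hE)⟩
      · have haQ := ha.resolve_right ha'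
        refine ⟨fun e he => ?_, (hPM.bandMatching_erase hE.symm haQ).swap,
          Or.inr (hPM.covers_erase hE.symm)⟩
        have heQ := (Finset.mem_erase.1 he).2
        refine Finset.mem_erase.2 ⟨?_, hPM.1 heQ⟩
        rintro rfl
        exact ha' heQ
    exact Finset.mem_filter.2 ⟨Finset.mem_powerset.2
      (((hgood _).1 hg).1.trans (Finset.erase_subset _ _)), hg⟩
  · intro P hP
    obtain ⟨hPE, hM, hC⟩ := (hgood P).1 (Finset.mem_filter.1 hP).2
    have ha' : a' ∉ P := fun h => (Finset.mem_erase.1 (hPE h)).1 rfl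
    simp only [bandLift]
    split_ifs with h1 h2 h2
    · exact Finset.erase_insert ha'
    · exact (h2 (Finset.mem_insert_self _ _)).elim
    · rcases Finset.mem_insert.1 h2 with h | h
      · exact (hne h.symm).elim
      · exact (ha' h).elim
    · refine Finset.erase_insert fun h => h1 ⟨⟨a, h, Or.inl rfl⟩, ⟨a, h, Or.inr rfl⟩⟩
  · intro Q hQ
    obtain ⟨hQ, ha⟩ := Finset.mem_filter.1 hQ
    have hPM : IsPM E Q := (Finset.mem_filter.1 hQ).2
    by_cases ha' : a' ∈ Q
    · simp only [if_pos ha', bandLift, if_pos (hPM.covers_erase hE), Finset.insert_erase ha']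
    · have haQ := ha.resolve_right ha'
      have hnc : ¬(Covers (Q.erase a) a.1 ∧ Covers (Q.erase a) a.2.1) := by
        rintro ⟨⟨e, he, hev⟩, _⟩
        obtain ⟨hne, he⟩ := Finset.mem_erase.1 he
        exact hne ((hPM.2 a.1 ⟨a, hE.mem, Or.inl rfl⟩).unique ⟨he, hev⟩ ⟨haQ, Or.inl rfl⟩)
      simp only [if_neg ha', bandLift, if_neg hnc, Finset.insert_erase haQ]
  · intro P hP
    obtain ⟨hPE, hM, hC⟩ := (hgood P).1 (Finset.mem_filter.1 hP).2
    have ha' : a' ∉ P := fun h => (Finset.mem_erase.1 (hPE h)).1 rfl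
    congr 1
    unfold bandLift xMon
    split_ifs with h1
    · rw [Finset.prod_insert ha', ← hlab]; field_simp
    · rw [Finset.prod_insert fun h => h1 ⟨⟨a, h, Or.inl rfl⟩, ⟨a, h, Or.inr rfl⟩⟩]; field_simp

end TriangulatedSurface

namespace TriangulatedSurface

variable {Tri : Type*} {T : TriangulatedSurface Tri}

/-! ### The expansions as matrix entries -/

theorem snakeGraph_good_ends {sd : ℕ → TSide Tri} {n : ℕ} {h : T.ReducedSeq sd (n + 1)}
    {o : ℕ → Fin 2} (ho : (T.snakeGraph sd (Nat.le_add_left 1 n) h).Good o) :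
    o 0 = 0 ∧ o (n + 2) = 0 :=
  ⟨(T.snakeGraph sd (Nat.le_add_left 1 n) h).ok_zero _ _ (ho 0 (Nat.zero_le _)),
    (T.snakeGraph sd (Nat.le_add_left 1 n) h).ok_last _ _ (ho (n + 1) le_rfl)⟩

theorem xMon_snake {sd : ℕ → TSide Tri} {n : ℕ} {h : T.ReducedSeq sd (n + 1)} (o : ℕ → Fin 2) :
    T.xMon ((T.snakeGraph sd (Nat.le_add_left 1 n) h).pathSet o) =
      firstWt (T := T) (sd 0) (o 1) * firstWt (T.glue (sd n)) (o (n + 1)) *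
        ∏ k ∈ Finset.range n,
          T.x (T.turnLab (T.glue (sd k)) (sd (k + 1)) (o (k + 1)) (o (k + 2))) := by
  rw [LayeredGraph.xMon_pathSet, Finset.prod_range_succ, Finset.prod_range_succ']
  have h1 : ∀ j β β', (T.snakeGraph sd (Nat.le_add_left 1 n) h).lab j β β' =
    T.snakeLab sd (n + 1) j β β' := fun _ _ _ => rfl
  have h2 : ∏ k ∈ Finset.range n, T.x (T.snakeLab sd (n + 1) (k + 1) (o (k + 1)) (o (k + 1 + 1))) =
      ∏ k ∈ Finset.range n,
          T.x (T.turnLab (T.glue (sd k)) (sd (k + 1)) (o (k + 1)) (o (k + 2))) := by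
    refine Finset.prod_congr rfl fun k hk => ?_
    have : k ≠ n := (Finset.mem_range.1 hk).ne
    simp [snakeLab, this]
  simp only [h1]
  rw [h2]
  simp only [snakeLab, firstWt, if_true, zero_add, Nat.add_one_ne_zero, if_false,
    Nat.add_sub_cancel, apply_ite T.x]
  ring

theorem snakeExpansion_eq (L : T.PrincipalLamination) (γ : T.ArcCurve) (sd : ℕ → TSide Tri) (n : ℕ)
    (hw : γ.word = (List.range' 0 (n + 1)).map sd) (h : T.ReducedSeq sd (n + 1)) :
    T.snakeExpansion L γ =
      1 / T.crossMon ((List.range' 0 (n + 1)).map sd) * arcCore L sd n := by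
  classical
  have hne : γ.word ≠ [] := by rw [hw]; simp
  rw [snakeExpansion, if_neg hne, hw]
  congr 1
  have := sum_perfectMatchings L sd n h
    (fun a b => firstWt (sd 0) a * firstWt (T.glue (sd n)) b) T.xMon fun o _ => xMon_snake o
  rw [this]
  exact Finset.sum_congr rfl fun a _ => Finset.sum_congr rfl fun b _ => by ring

theorem ed_mem_pathSet {d : ℕ} {G : T.LayeredGraph d} {o : ℕ → Fin 2} {j : ℕ} (hj : j ≤ d)
    (β β' : Fin 2) : G.ed j β β' ∈ G.pathSet o ↔
      G.ed j β β' = G.ed j (o j) (o (j + 1)) := by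
  rw [LayeredGraph.mem_pathSet]
  constructor
  · rintro ⟨i, hi, h⟩
    have h1 : G.vtx j (β + 1) = G.vtx i (o i + 1) := congrArg (fun e => e.1) h
    obtain ⟨rfl, _⟩ := LayeredGraph.vtx_inj h1
    exact h
  · exact fun h => ⟨j, hj, h⟩

open Classical in
theorem bandFirst_eq {sd : ℕ → TSide Tri} {n : ℕ} {h : T.ReducedSeq sd (n + 1)} :
    T.bandFirst (T.tileAt sd 0) (T.tileAt sd n) =
      (T.snakeGraph sd (Nat.le_add_left 1 n) h).ed 0 0
        (if sd 0 = next (T.glue (sd n)) then 1 else 0) := by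
  by_cases hs : sd 0 = next (T.glue (sd n))
  · simp [bandFirst, tileAt, hs, LayeredGraph.ed, snakeGraph, snakeVtx, inVtx, snakeLab, westEdge,
      parity, tilePos, Tile.sw, Tile.nw]
  · simp [bandFirst, tileAt, hs, LayeredGraph.ed, snakeGraph, snakeVtx, inVtx, snakeLab, southEdge,
      parity, tilePos, Tile.sw, Tile.se]

open Classical in
theorem bandLast_eq {sd : ℕ → TSide Tri} {n : ℕ} {h : T.ReducedSeq sd (n + 1)} :
    T.bandLast (T.tileAt sd 0) (T.tileAt sd n) =
      (T.snakeGraph sd (Nat.le_add_left 1 n) h).ed (n + 1)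
        (if sd 0 = next (T.glue (sd n)) then 0 else 1) 0 := by
  by_cases hs : sd 0 = next (T.glue (sd n)) <;> cases hp : parity n <;>
  simp [bandLast, tileAt, hs, LayeredGraph.ed, snakeGraph, snakeVtx, inVtx, snakeLab, eastEdge,
      northEdge, hp, gluesNorth, Tile.se, Tile.nw, Tile.ne]

/-- The two copies join levels `0, 1` and `n + 1, n + 2`. As edges join consecutive levels, `1 ≤ n`
suffices to keep the identified vertices apart and without a common edge. -/
theorem bandPair {sd : ℕ → TSide Tri} {n : ℕ} (hn : 1 ≤ n) (h : T.ReducedSeq sd (n + 1)) :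
    BandPair (T.snakeEdges ((List.range' 0 (n + 1)).map sd))
      (T.bandFirst (T.tileAt sd 0) (T.tileAt sd n)) (T.bandLast (T.tileAt sd 0) (T.tileAt sd n)) := by
  classical
  rw [bandFirst_eq (h := h), bandLast_eq (h := h)]
  set G := T.snakeGraph sd (Nat.le_add_left 1 n) h
  change BandPair G.edges _ _
  generalize (if sd 0 = next (T.glue (sd n)) then 1 else 0 : Fin 2) = β
  generalize (if sd 0 = next (T.glue (sd n)) then 0 else 1 : Fin 2) = β'
  have hm : G.ed 0 0 β ∈ G.edges := LayeredGraph.ed_mem 0 (by omega)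
    (by change T.snakeOk sd (n + 1) 0 0 β; simp [snakeOk])
  have hm' : G.ed (n + 1) β' 0 ∈ G.edges := LayeredGraph.ed_mem (n + 1) le_rfl
    (by change T.snakeOk sd (n + 1) (n + 1) β' 0; simp [snakeOk])
  clear_value G
  have hne : ∀ i j (b c : Fin 2), i ≠ j → G.vtx i b ≠ G.vtx j c := fun i j b c hij h =>
    hij (LayeredGraph.vtx_inj h).1
  have hlev : ∀ i j (b c : Fin 2), G.vtx i b = G.vtx j c → i = j := fun i j b c h =>
    (LayeredGraph.vtx_inj h).1
  refine ⟨hm, hm', hne 0 1 _ _ (by omega), hne (n + 1) (n + 2) _ _ (by omega),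
    hne 0 (n + 1) _ _ (by omega), hne 0 (n + 2) _ _ (by omega), hne 1 (n + 1) _ _ (by omega),
    hne 1 (n + 2) _ _ (by omega), ?_, ?_⟩
  all_goals
    rintro e he h1 h2
    obtain ⟨j, hj, b, b', hok, rfl⟩ := (G.mem_edges e).1 he
    rcases h1 with h1 | h1 <;> rcases h2 with h2 | h2 <;>
    · have := hlev _ _ _ _ h1
      have := hlev _ _ _ _ h2
      omega

/-- The first state tells whether the matching contains `a`, the last one whether it contains `a'`.
The pair of states in which it contains neither is exactly the one forbidden in the turn from the
last crossing to the first, and in the other cases division by the variable of `a` leaves the weight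
of that turn. Summing over both states gives a trace. -/
theorem bandExpansion_eq (L : T.PrincipalLamination) (γ : T.LoopCurve) (sd : ℕ → TSide Tri) (n : ℕ)
    (hn : 1 ≤ n) (hw : γ.word = (List.range' 0 (n + 1)).map sd) (h : T.ReducedSeq sd (n + 1))
    (hcyc : sd 0 = next (T.glue (sd n)) ∨ sd 0 = prev (T.glue (sd n))) :
    T.bandExpansion L γ =
      1 / T.crossMon ((List.range' 0 (n + 1)).map sd) *
        (turnMat (T.glue (sd n)) (sd 0) * coreMat L sd n).trace := by
  classical
  have hhead : (T.tiles γ.word).head? = some (T.tileAt sd 0) := by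
    rw [hw, tiles_eq]
    simp [List.range'_succ]
  have hlast : (T.tiles γ.word).getLast? = some (T.tileAt sd n) := by
    rw [hw, tiles_eq, List.getLast?_map, List.getLast?_range']
    simp
  have hstep : T.bandExpansion L γ = 1 / T.crossMon γ.word *
      ∑ P ∈ (T.snakeEdges γ.word).powerset with T.IsGoodMatching γ.word
        (T.bandFirst (T.tileAt sd 0) (T.tileAt sd n)) (T.bandLast (T.tileAt sd 0) (T.tileAt sd n)) P,
      T.xMon P * T.yMon L γ.word (T.bandLift (T.bandFirst (T.tileAt sd 0) (T.tileAt sd n))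
        (T.bandLast (T.tileAt sd 0) (T.tileAt sd n)) P) := by
    unfold bandExpansion
    rw [hhead, hlast]
  rw [hstep, hw]
  congr 1
  set e := T.glue (sd n) with he
  have hne := next_ne_prev e
  have hlab : (T.bandFirst (T.tileAt sd 0) (T.tileAt sd n)).2.2 =
      (T.bandLast (T.tileAt sd 0) (T.tileAt sd n)).2.2 := by
    rw [bandFirst_eq (h := h), bandLast_eq (h := h)]
    rcases hcyc with hs | hs <;>
      simp [LayeredGraph.ed, snakeGraph, snakeLab, ← he, hs, hne.symm]
  rw [sum_goodMatchings _ _ _ (bandPair hn h) hlab fun Q =>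
    T.yMon L ((List.range' 0 (n + 1)).map sd) Q]
  rw [sum_perfectMatchings L sd n h (fun a b => turnMat e (sd 0) a b)]
  · rw [Matrix.trace]
    simp only [Matrix.diag_apply, Matrix.mul_apply]
  intro o ho
  set G := T.snakeGraph sd (Nat.le_add_left 1 n) h with hG
  obtain ⟨ho0, hol⟩ := snakeGraph_good_ends ho
  have hm1 : ∀ b, G.ed 0 0 b ∈ G.pathSet o ↔ G.ed 0 0 b = G.ed 0 (o 0) (o 1) := fun b =>
    ed_mem_pathSet (by omega) _ _
  have hm2 : ∀ b, G.ed (n + 1) b 0 ∈ G.pathSet o ↔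
      G.ed (n + 1) b 0 = G.ed (n + 1) (o (n + 1)) (o (n + 2)) := fun b => ed_mem_pathSet le_rfl _ _
  simp only [bandFirst_eq (h := h), bandLast_eq (h := h), ← hG, ← he, hm1, hm2, ho0, hol]
  have h1 : ∀ b c, G.ed 0 0 b = G.ed 0 0 c ↔ b = c := fun b c =>
    ⟨fun h => (LayeredGraph.vtx_inj (congrArg (fun e => e.2.1) h : G.vtx 1 b = G.vtx 1 c)).2,
      fun h => h ▸ rfl⟩
  have h2 : ∀ b c, G.ed (n + 1) b 0 = G.ed (n + 1) c 0 ↔ b = c := fun b c =>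
    ⟨fun h => add_right_cancel (LayeredGraph.vtx_inj
      (congrArg (fun e => e.1) h : G.vtx (n + 1) (b + 1) = G.vtx (n + 1) (c + 1))).2,
      fun h => h ▸ rfl⟩
  have h3 : (G.ed 0 0 (if sd 0 = next e then 1 else 0)).2.2 =
      if sd 0 = next e then T.edge (next (sd 0)) else T.edge (prev (sd 0)) := by
    split_ifs <;> simp [LayeredGraph.ed, hG, snakeGraph, snakeLab]
  simp only [h1, h2, h3]
  rw [hG, xMon_snake, ← he]
  generalize ∏ k ∈ Finset.range n,
    T.x (T.turnLab (T.glue (sd k)) (sd (k + 1)) (o (k + 1)) (o (k + 2))) = m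
  generalize o (n + 1) = b
  generalize o 1 = c
  have hx1 := T.x_ne_zero (T.edge (prev e))
  have hx2 := T.x_ne_zero (T.edge (next e))
  -- Eight cases: the direction of the closing turn and the two extreme states.
  rcases hcyc with hs | hs <;> fin_cases b <;> fin_cases c <;>
    simp [turnMat, turnOk, turnLab, firstWt, hs, hne.symm] <;> field_simp

/-- Conjugation by the frame at the first side and by the rescaling does not affect the trace; what
remains closes the product by one more turn. -/
theorem trace_transport (L : T.PrincipalLamination) (sd : ℕ → TSide Tri) (n : ℕ)
    (h : T.ReducedSeq sd (n + 1))
    (hcyc : sd 0 = next (T.glue (sd n)) ∨ sd 0 = prev (T.glue (sd n))) :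
    EqNeg (T.transport L ((List.range' 0 (n + 1)).map sd)).trace
      (1 / T.crossMon ((List.range' 0 (n + 1)).map sd) *
        (turnMat (T.glue (sd n)) (sd 0) * coreMat L sd n).trace) := by
  set w := (List.range' 0 (n + 1)).map sd with hw
  have hx0 := T.x_ne_zero (T.edge (sd 0))
  have h1 := (EqNeg.refl ((T.frame (sd 0, false))⁻¹)).mul (transport_frame L sd n h)
  have h2 := (frame_turn_eq L (T.glue (sd n)) (sd 0) hcyc).mul
    (EqNeg.refl (T.scaleMat (T.x (T.edge (sd n)))⁻¹ * (coreMat L sd n *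
          T.scaleMat (T.x (T.edge (sd 0))))))
  have h3 := h2.map (fun M => (T.crossMon ((List.range' 0 n).map sd))⁻¹ • M)
    (fun M => smul_neg _ M)
  rw [Matrix.mul_smul, ← Matrix.mul_assoc (T.frame _)⁻¹ (T.frame _)] at h1
  have h4 := (h1.trans h3).map Matrix.trace Matrix.trace_neg
  have h5 : ((T.frame (sd 0, false))⁻¹ * (T.transport L w * T.frame (sd 0, false))).trace =
      (T.transport L w).trace := by
    rw [Matrix.trace_mul_comm, Matrix.mul_assoc, Matrix.mul_nonsing_inv _ (T.isUnit_det_frame _),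
      Matrix.mul_one]
  rw [h5] at h4
  refine h4.trans (Or.inl ?_)
  rw [crossMon_succ, edge_glue]
  simp only [Matrix.smul_mul, Matrix.trace_smul, smul_eq_mul]
  have h6 : (T.scaleMat (T.x (T.edge (sd 0)))⁻¹ * turnMat (T.glue (sd n)) (sd 0) *
      T.scaleMat (T.x (T.edge (sd n))) * (T.scaleMat (T.x (T.edge (sd n)))⁻¹ * (coreMat L sd n *
          T.scaleMat (T.x (T.edge (sd 0)))))).trace =
      (turnMat (T.glue (sd n)) (sd 0) * coreMat L sd n).trace := by
    rw [Matrix.mul_assoc (_ * _) (T.scaleMat _), ← Matrix.mul_assoc (T.scaleMat (T.x (T.edge (sd n)))),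
      scaleMat_inv_mul (T.x_ne_zero _), Matrix.one_mul, Matrix.mul_assoc, Matrix.trace_mul_comm,
      ← Matrix.mul_assoc, Matrix.mul_assoc, scaleMat_inv_mul hx0, Matrix.mul_one]
  rw [h6, one_div, mul_inv]
  ring

/-! ### Positivity and constant terms -/

/-- `f`, with the squares of the `y`-variables substituted, is a polynomial with natural
coefficients. -/
def NatSub (T : TriangulatedSurface Tri) : Subsemiring T.Fld := T.natPoly.rangeS.comap T.sqY

/-- A polynomial with natural coefficients which is not divisible by `y_ρ`. -/
def HasConst (ρ : T.Edge) (f : T.Fld) : Prop :=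
  ∃ p : MvPolynomial T.Var ℕ, p ≠ 0 ∧ T.natPoly p = T.sqY f ∧ yOrder ρ p = 0

theorem x_mem_natSub (τ : T.Edge) : T.x τ ∈ NatSub T := by
  refine ⟨MvPolynomial.X (Sum.inl τ), ?_⟩
  rw [natPoly_X, sqY_x]; rfl

theorem y_mem_natSub (τ : T.Edge) : T.y τ ∈ NatSub T := by
  refine ⟨MvPolynomial.X (Sum.inr τ) ^ 2, ?_⟩
  rw [map_pow, natPoly_X, sqY_y]; rfl

namespace HasConst

variable {ρ : T.Edge} {f g : T.Fld}

theorem mem (h : HasConst ρ f) : f ∈ NatSub T := by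
  obtain ⟨p, _, hp, _⟩ := h
  exact ⟨p, hp⟩

theorem add (h : HasConst ρ f) (hg : g ∈ NatSub T) : HasConst ρ (f + g) := by
  obtain ⟨p, hp0, hp, hρ⟩ := h
  obtain ⟨q, hq⟩ := hg
  refine ⟨p + q, T.natPoly_add_ne_zero hp0, by rw [map_add, map_add, hp, hq], ?_⟩
  by_cases hq0 : q = 0
  · rw [hq0, add_zero, hρ]
  · rw [yOrder_add _ hp0 hq0, hρ, Nat.zero_min]

theorem mul (h : HasConst ρ f) (hg : HasConst ρ g) : HasConst ρ (f * g) := by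
  obtain ⟨p, hp0, hp, hρ⟩ := h
  obtain ⟨q, hq0, hq, hρ'⟩ := hg
  exact ⟨p * q, mul_ne_zero hp0 hq0, by rw [map_mul, map_mul, hp, hq],
    by rw [yOrder_mul _ hp0 hq0, hρ, hρ']⟩

theorem one : HasConst ρ (1 : T.Fld) := ⟨1, one_ne_zero, by simp, yOrder_one ρ⟩

theorem x (τ : T.Edge) : HasConst ρ (T.x τ) :=
  ⟨MvPolynomial.X (Sum.inl τ), MvPolynomial.X_ne_zero _, by rw [natPoly_X, sqY_x]; rfl,
    by simp [yOrder_X]⟩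

theorem y {τ : T.Edge} (h : τ ≠ ρ) : HasConst ρ (T.y τ) := by
  have h0 := MvPolynomial.X_ne_zero (R := ℕ) (Sum.inr τ : T.Var)
  refine ⟨MvPolynomial.X (Sum.inr τ) ^ 2, pow_ne_zero _ h0, ?_, ?_⟩
  · rw [map_pow, natPoly_X, sqY_y]; rfl
  · rw [pow_two, yOrder_mul _ h0 h0]
    simp [yOrder_X, h]

end HasConst

/-- A matrix of polynomials with natural coefficients, one of whose diagonal entries is not
divisible by `y_ρ`. -/
def DiagConst (ρ : T.Edge) (β : Fin 2) (M : Matrix (Fin 2) (Fin 2) T.Fld) : Prop :=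
  (∀ i j, M i j ∈ NatSub T) ∧ HasConst ρ (M β β)

theorem DiagConst.mul {ρ : T.Edge} {β : Fin 2} {M N : Matrix (Fin 2) (Fin 2) T.Fld}
    (hM : DiagConst ρ β M) (hN : DiagConst ρ β N) : DiagConst ρ β (M * N) := by
  constructor
  · intro i j
    rw [Matrix.mul_apply]
    exact sum_mem fun k _ => mul_mem (hM.1 _ _) (hN.1 _ _)
  · rw [Matrix.mul_apply, ← Finset.add_sum_erase _ _ (Finset.mem_univ β)]
    exact (hM.2.mul hN.2).add (sum_mem fun k _ => mul_mem (hM.1 _ _) (hN.1 _ _))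

theorem DiagConst.one (ρ : T.Edge) (β : Fin 2) : DiagConst ρ β 1 := by
  constructor
  · intro i j
    rw [Matrix.one_apply]
    split_ifs
    · exact one_mem _
    · exact zero_mem _
  · rw [Matrix.one_apply_eq]; exact HasConst.one

/-- Equal consecutive states are always joined, in either direction of turning. Hence constant
sequences of states are matchings. -/
theorem DiagConst.turnMat (ρ : T.Edge) (β : Fin 2) (e s' : TSide Tri) :
    DiagConst (T := T) ρ β (turnMat e s') := by
  constructor
  · intro i j
    unfold TriangulatedSurface.turnMat
    split_ifs
    · exact x_mem_natSub _
    · exact zero_mem _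
  · have : turnOk e s' β β := by
      constructor <;> rintro _ ⟨rfl, h⟩
      · exact absurd h (by decide)
      · exact absurd h (by decide)
    unfold TriangulatedSurface.turnMat
    rw [if_pos this]
    exact HasConst.x _

open Classical in
/-- The state of the tiles in which `y_ρ` does not occur. -/
def constState (L : T.PrincipalLamination) (ρ : T.Edge) : Fin 2 := if L.b ρ ρ = 1 then 0 else 1

open Classical in
theorem crossWt_zero (L : T.PrincipalLamination) (s : TSide Tri) :
    crossWt L s 0 = if L.b (T.edge s) (T.edge s) = -1 then T.y (T.edge s) else 1 := by
  simp [crossWt, stepMatrix]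

open Classical in
theorem crossWt_one (L : T.PrincipalLamination) (s : TSide Tri) :
    crossWt L s 1 = if L.b (T.edge s) (T.edge s) = 1 then T.y (T.edge s) else 1 := by
  simp [crossWt, stepMatrix]

theorem crossWt_mem (L : T.PrincipalLamination) (s : TSide Tri) (β : Fin 2) :
    crossWt L s β ∈ NatSub T := by
  rcases Fin.two_eq_or β 0 with rfl | rfl
  · rw [crossWt_zero]
    split_ifs
    · exact y_mem_natSub _
    · exact one_mem _
  · rw [zero_add, crossWt_one]
    split_ifs
    · exact y_mem_natSub _
    · exact one_mem _

/-- The state is chosen such that a crossing of `ρ` has weight `1` in it; crossings of other arcs do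
not involve `y_ρ` at all. -/
theorem crossWt_hasConst (L : T.PrincipalLamination) (ρ : T.Edge) (s : TSide Tri) :
    HasConst ρ (crossWt L s (constState L ρ)) := by
  by_cases hs : T.edge s = ρ
  · subst hs
    have h : crossWt L s (constState L (T.edge s)) = 1 := by
      unfold constState
      split_ifs with hb
      · rw [crossWt_zero, hb]; rfl
      · rw [crossWt_one, if_neg hb]
    rw [h]
    exact HasConst.one
  · unfold constState
    split_ifs
    · rw [crossWt_zero]
      split_ifs
      · exact HasConst.y hs
      · exact HasConst.one
    · rw [crossWt_one]
      split_ifs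
      · exact HasConst.y hs
      · exact HasConst.one

theorem DiagConst.crossMat (L : T.PrincipalLamination) (ρ : T.Edge) (s : TSide Tri) :
    DiagConst ρ (constState L ρ) (crossMat L s) := by
  rw [crossMat_eq]
  constructor
  · intro i j
    rw [Matrix.diagonal_apply]
    split_ifs
    · exact crossWt_mem _ _ _
    · exact zero_mem _
  · rw [Matrix.diagonal_apply_eq]
    exact crossWt_hasConst L ρ s

theorem DiagConst.coreMat (L : T.PrincipalLamination) (ρ : T.Edge) (sd : ℕ → TSide Tri) (n : ℕ) :
    DiagConst ρ (constState L ρ) (coreMat L sd n) := by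
  refine (DiagConst.crossMat L ρ _).mul ?_
  induction n with
  | zero => exact DiagConst.one _ _
  | succ n ih => exact ((DiagConst.turnMat _ _ _ _).mul (DiagConst.crossMat L ρ _)).mul ih

theorem firstWt_hasConst (ρ : T.Edge) (s : TSide Tri) (β : Fin 2) :
    HasConst ρ (firstWt (T := T) s β) := by
  unfold firstWt; split_ifs <;> exact HasConst.x _

/-- The summand in which both end states are the distinguished state of `ρ` is not divisible by
`y_ρ`, and the other summands, having natural coefficients, cannot cancel it. -/
theorem arcCore_hasConst (L : T.PrincipalLamination) (ρ : T.Edge) (sd : ℕ → TSide Tri) (n : ℕ) :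
    HasConst ρ (arcCore L sd n) := by
  have h := DiagConst.coreMat L ρ sd n
  have hmem : ∀ a b, firstWt (T.glue (sd n)) b * TriangulatedSurface.coreMat L sd n b a *
      firstWt (sd 0) a ∈ NatSub T := fun a b =>
    mul_mem (mul_mem (firstWt_hasConst ρ _ _).mem (h.1 _ _)) (firstWt_hasConst ρ _ _).mem
  rw [arcCore, ← Finset.add_sum_erase _ _ (Finset.mem_univ (constState L ρ)),
    ← Finset.add_sum_erase _ _ (Finset.mem_univ (constState L ρ))]
  exact ((((firstWt_hasConst ρ _ _).mul h.2).mul (firstWt_hasConst ρ _ _)).add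
    (sum_mem fun b _ => hmem _ b)).add (sum_mem fun a _ => sum_mem fun b _ => hmem a b)

theorem trace_hasConst {ρ : T.Edge} {β : Fin 2} {M : Matrix (Fin 2) (Fin 2) T.Fld}
    (h : DiagConst ρ β M) : HasConst ρ M.trace := by
  rw [Matrix.trace, ← Finset.add_sum_erase _ _ (Finset.mem_univ β)]
  exact h.2.add (sum_mem fun k _ => h.1 _ _)

theorem crossMon_hasConst (ρ : T.Edge) (w : List (TSide Tri)) : HasConst ρ (T.crossMon w) := by
  induction w with
  | nil => simpa [crossMon] using HasConst.one
  | cons s w ih =>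
    rw [crossMon, List.map_cons, List.prod_cons]
    exact (HasConst.x _).mul ih

/-- The polynomial behind `HasConst` might depend on `ρ`, but by injectivity of `natPoly` it is the
same for all `ρ`. The edge `τ` only serves to produce it. -/
theorem HasConst.hasOrder {f : T.Fld} (τ : T.Edge) (h : ∀ ρ, HasConst ρ f) :
    HasOrder (T.sqY f) 0 := by
  obtain ⟨p, hp0, hp, _⟩ := h τ
  refine ⟨p, 1, hp0, one_ne_zero, by simp [hp], fun ρ => ?_⟩
  obtain ⟨q, hq0, hq, hρ⟩ := h ρ
  have : p = q := T.natPoly_injective (by rw [hp, hq])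
  rw [this, hρ, yOrder_one]
  simp

end TriangulatedSurface

/-! ### Consequences of the principal lamination: shear coordinates and boundary marked points -/

namespace TriangulatedSurface

variable {Tri : Type*} {T : TriangulatedSurface Tri}

/-! ### Elementary laminations -/

theorem shearAux_allTurn_next (τ : T.Edge) (e : TSide Tri) (w : List (TSide Tri))
    (h : T.AllTurn next e w) : T.shearAux τ e w = 0 := by
  induction w generalizing e with
  | nil => rfl
  | cons s w ih =>
    obtain _ | ⟨t, w⟩ := w
    · rfl
    · obtain ⟨rfl, ht, h'⟩ := h
      rw [shearAux, ih _ ⟨ht, h'⟩, ht]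
      simp [next_ne_prev]

theorem shearAux_allTurn_prev (τ : T.Edge) (e : TSide Tri) (w : List (TSide Tri))
    (h : T.AllTurn prev e w) : T.shearAux τ e w = 0 := by
  induction w generalizing e with
  | nil => rfl
  | cons s w ih =>
    obtain _ | ⟨t, w⟩ := w
    · rfl
    · obtain ⟨rfl, ht, h'⟩ := h
      rw [shearAux, ih _ ⟨ht, h'⟩, ht]
      simp [(next_ne_prev _).symm]

-- A contribution requires a change of the direction of turning, and the only change takes place at
-- `s`. A nonempty `v` is needed for the turn after `s` to be visible.
open Classical in
theorem shearAux_next_prev (τ : T.Edge) (e s : TSide Tri) (u v : List (TSide Tri)) (hv : v ≠ [])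
    (hu : T.AllTurn next e (u ++ [s])) (hv' : T.AllTurn prev (T.glue s) v) :
    T.shearAux τ e (u ++ s :: v) = if T.edge s = τ then 1 else 0 := by
  induction u generalizing e with
  | nil =>
    obtain ⟨rfl, _⟩ := hu
    obtain _ | ⟨t, v⟩ := v
    · exact (hv rfl).elim
    · have h1 := shearAux_allTurn_prev τ _ _ hv'
      obtain ⟨rfl, _⟩ := hv'
      rw [List.nil_append, shearAux, h1]
      simp [(next_ne_prev _).symm, next_ne_prev]
  | cons a u ih =>
    obtain ⟨rfl, h'⟩ := hu
    have h1 := ih _ h'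
    obtain _ | ⟨c, u⟩ := u
    · obtain ⟨rfl, _⟩ := h'
      simp only [List.cons_append, List.nil_append] at h1 ⊢
      rw [shearAux, h1]
      simp [next_ne_prev]
    · obtain ⟨rfl, _⟩ := h'
      simp only [List.cons_append] at h1 ⊢
      rw [shearAux, h1]
      simp [next_ne_prev]

open Classical in
theorem shearAux_prev_next (τ : T.Edge) (e s : TSide Tri) (u v : List (TSide Tri)) (hv : v ≠ [])
    (hu : T.AllTurn prev e (u ++ [s])) (hv' : T.AllTurn next (T.glue s) v) :
    T.shearAux τ e (u ++ s :: v) = if T.edge s = τ then -1 else 0 := by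
  induction u generalizing e with
  | nil =>
    obtain ⟨rfl, _⟩ := hu
    obtain _ | ⟨t, v⟩ := v
    · exact (hv rfl).elim
    · have h1 := shearAux_allTurn_next τ _ _ hv'
      obtain ⟨rfl, _⟩ := hv'
      rw [List.nil_append, shearAux, h1]
      simp [(next_ne_prev _).symm, next_ne_prev]
  | cons a u ih =>
    obtain ⟨rfl, h'⟩ := hu
    have h1 := ih _ h'
    obtain _ | ⟨c, u⟩ := u
    · obtain ⟨rfl, _⟩ := h'
      simp only [List.cons_append, List.nil_append] at h1 ⊢
      rw [shearAux, h1]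
      simp [(next_ne_prev _).symm]
    · obtain ⟨rfl, _⟩ := h'
      simp only [List.cons_append] at h1 ⊢
      rw [shearAux, h1]
      simp [(next_ne_prev _).symm]

/-- The curve ends on a boundary segment whereas `s` is interior, so the list continues beyond `s`.
-/
theorem IsElementary.last_mem {ℓ : T.LamCurve} {u v : List (TSide Tri)} {s : TSide Tri}
    (h : ℓ.exits = (u ++ [s]) ++ v) (hs : T.Interior s) : ℓ.last ∈ v := by
  have hlast : ∀ hne : ((u ++ [s]) ++ v) ≠ [], ((u ++ [s]) ++ v).getLast hne = ℓ.last := by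
    rw [← h]
    intro hne
    simp [LamCurve.exits]
  obtain rfl | ⟨v', t, rfl⟩ := List.eq_nil_or_concat v
  · have := hlast (by simp)
    simp at this
    exact (ℓ.last_boundary (this ▸ hs)).elim
  · have := hlast (by simp)
    simp [← List.append_assoc] at this
    simp [this]

theorem interior_glue {s : TSide Tri} (h : T.Interior s) : T.Interior (T.glue s) := by
  intro h'
  rw [T.glue_glue] at h'
  exact h h'.symm

theorem edge_eq_iff {s t : TSide Tri} : T.edge s = T.edge t ↔ t = s ∨ t = T.glue s :=
  ⟨fun h => Quotient.exact (s := T.edgeSetoid) h, fun h => Quotient.sound (s := T.edgeSetoid) h⟩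

theorem isArcEdge_edge {s : TSide Tri} (h : T.Interior s) : T.IsArcEdge (T.edge s) := ⟨s, h, rfl⟩

-- The coefficient rows of the initial seed thus form a signed identity matrix on the arcs.
open Classical in
theorem PrincipalLamination.b_eq (L : T.PrincipalLamination) {s : TSide Tri} (hs : T.Interior s) :
    ∃ ε : ℤ, (ε = 1 ∨ ε = -1) ∧ ∀ τ, L.b (T.edge s) τ = if T.edge s = τ then ε else 0 := by
  obtain ⟨u, v, t, h, ht, hts, hc⟩ := L.elementary (T.edge s) (isArcEdge_edge hs)
  have hv : v ≠ [] := List.ne_nil_of_mem (IsElementary.last_mem h ht)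
  have hb : ∀ τ, L.b (T.edge s) τ =
      T.shearAux τ (L.curve _ (isArcEdge_edge hs)).entry (u ++ t :: v) := by
    intro τ
    rw [b, dif_pos (isArcEdge_edge hs), shear, h, List.append_assoc]
    rfl
  rcases hc with ⟨h1, h2⟩ | ⟨h1, h2⟩
  · exact ⟨1, Or.inl rfl, fun τ => by rw [hb, shearAux_next_prev τ _ _ _ _ hv h1 h2, hts]⟩
  · exact ⟨-1, Or.inr rfl, fun τ => by rw [hb, shearAux_prev_next τ _ _ _ _ hv h1 h2, hts]⟩

theorem PrincipalLamination.b_of_not_isArcEdge (L : T.PrincipalLamination) {ρ : T.Edge}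
    (h : ¬T.IsArcEdge ρ) (τ : T.Edge) : L.b ρ τ = 0 := dif_neg h

theorem PrincipalLamination.b_self (L : T.PrincipalLamination) {s : TSide Tri}
    (hs : T.Interior s) : L.b (T.edge s) (T.edge s) = 1 ∨ L.b (T.edge s) (T.edge s) = -1 := by
  obtain ⟨ε, hε, h⟩ := L.b_eq hs
  rw [h, if_pos rfl]
  exact hε

theorem PrincipalLamination.b_of_ne (L : T.PrincipalLamination) {ρ τ : T.Edge} (h : ρ ≠ τ) :
    L.b ρ τ = 0 := by
  by_cases hρ : T.IsArcEdge ρ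
  · obtain ⟨s, hs, rfl⟩ := hρ
    obtain ⟨ε, hε, h'⟩ := L.b_eq hs
    rw [h', if_neg h]
  · exact L.b_of_not_isArcEdge hρ τ

/-! ### Rotation about the marked points -/

variable (T) in
/-- The rotation about a marked point from a corner to the next one in clockwise direction (or,
at the end, back to the first one). -/
def rot : Equiv.Perm (TSide Tri) where
  toFun s := next (T.glue s)
  invFun s := T.glue (prev s)
  left_inv s := by simp [T.glue_glue]
  right_inv s := by simp [T.glue_glue]

theorem rot_apply (s : TSide Tri) : T.rot s = next (T.glue s) := rfl

/-- A curve that keeps turning right circles around one vertex, so the corners it meets there form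
part of an orbit of the rotation. -/
theorem sameCycle_allTurn_next (e : TSide Tri) (w : List (TSide Tri)) (h : T.AllTurn next e w)
    (t : TSide Tri) (ht : t ∈ w) : T.rot.SameCycle (next e) t := by
  induction w generalizing e with
  | nil => simp at ht
  | cons s w ih =>
    obtain ⟨rfl, h⟩ := h
    rcases List.mem_cons.1 ht with rfl | ht
    · exact Equiv.Perm.SameCycle.refl _ _
    · exact (Equiv.Perm.sameCycle_apply_left (f := T.rot)).1 (ih _ h ht)

theorem sameCycle_allTurn_prev (e : TSide Tri) (w : List (TSide Tri)) (h : T.AllTurn prev e w)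
    (t : TSide Tri) (ht : t ∈ w) : T.rot.SameCycle e (T.glue t) := by
  induction w generalizing e with
  | nil => simp at ht
  | cons s w ih =>
    obtain ⟨rfl, h⟩ := h
    have h1 : T.rot.SameCycle e (T.glue (prev e)) := by
      have : e = T.rot (T.glue (prev e)) := by simp [rot_apply, T.glue_glue]
      conv_lhs => rw [this]
      exact (Equiv.Perm.sameCycle_apply_left (f := T.rot)).2 (Equiv.Perm.SameCycle.refl _ _)
    rcases List.mem_cons.1 ht with rfl | ht
    · exact h1
    · exact h1.trans (ih _ h ht)

/-- Every marked point lies on the boundary. -/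
theorem PrincipalLamination.exists_boundary (L : T.PrincipalLamination) (s : TSide Tri) :
    ∃ t, ¬T.Interior t ∧ T.rot.SameCycle s t := by
  by_cases hs : T.Interior s
  swap
  · exact ⟨s, hs, Equiv.Perm.SameCycle.refl _ _⟩
  obtain ⟨u, v, t, h, ht, hts, hc⟩ := L.elementary (T.edge s) (isArcEdge_edge hs)
  set ℓ := L.curve (T.edge s) (isArcEdge_edge hs)
  have hmem : ℓ.last ∈ v := IsElementary.last_mem h ht
  have he : T.glue ℓ.entry = ℓ.entry := not_not.1 ℓ.entry_boundary
  have hl : T.glue ℓ.last = ℓ.last := not_not.1 ℓ.last_boundary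
  have key : (∃ a, ¬T.Interior a ∧ T.rot.SameCycle t a) ∧
      ∃ a, ¬T.Interior a ∧ T.rot.SameCycle (T.glue t) a := by
    rcases hc with ⟨h1, h2⟩ | ⟨h1, h2⟩
    · refine ⟨⟨ℓ.entry, ℓ.entry_boundary, ?_⟩, ⟨ℓ.last, ℓ.last_boundary, ?_⟩⟩
      · have := sameCycle_allTurn_next _ _ h1 t (by simp)
        have hr : next ℓ.entry = T.rot ℓ.entry := by rw [rot_apply, he]
        rw [hr] at this
        exact ((Equiv.Perm.sameCycle_apply_left (f := T.rot)).1 this).symm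
      · have := sameCycle_allTurn_prev _ _ h2 _ hmem
        rwa [hl] at this
    · refine ⟨⟨ℓ.last, ℓ.last_boundary, ?_⟩, ⟨ℓ.entry, ℓ.entry_boundary, ?_⟩⟩
      · have := sameCycle_allTurn_next _ _ h2 _ hmem
        exact (Equiv.Perm.sameCycle_apply_left (f := T.rot)).1 this
      · exact (sameCycle_allTurn_prev _ _ h1 t (by simp)).symm
  rcases edge_eq_iff.1 hts with rfl | rfl
  · exact key.1
  · exact key.2

theorem PrincipalLamination.exists_rot_pow [Finite Tri] (L : T.PrincipalLamination)
    (s : TSide Tri) : ∃ n : ℕ, ¬T.Interior ((T.rot ^ n) s) := by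
  obtain ⟨t, ht, h⟩ := L.exists_boundary s
  obtain ⟨n, _, rfl⟩ := h.exists_pow_eq'
  exact ⟨n, ht⟩

/-- If two sides of a triangle were glued at their common vertex, the corner there would be fixed by
the rotation. The vertex would then have no boundary side, contrary to `exists_boundary`. -/
theorem PrincipalLamination.glue_ne_next (L : T.PrincipalLamination) (s : TSide Tri) :
    T.glue s ≠ next s := by
  intro h
  have hfix : T.rot (next s) = next s := by rw [rot_apply, ← h, T.glue_glue, h]
  obtain ⟨t, ht, n, hn⟩ := L.exists_boundary (next s)
  have : (T.rot ^ n) (next s) = next s := Equiv.Perm.zpow_apply_eq_self_of_apply_eq_self hfix n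
  rw [this] at hn
  refine ht ?_
  rw [← hn, ← h, Interior, T.glue_glue, h]
  exact (next_ne s).symm

theorem PrincipalLamination.glue_ne_prev (L : T.PrincipalLamination) (s : TSide Tri) :
    T.glue s ≠ prev s := by
  intro h
  refine L.glue_ne_next (prev s) ?_
  rw [next_prev, ← h, T.glue_glue]

theorem _root_.TSide.eq_cases {s t : TSide Tri} (h : t.1 = s.1) :
    t = s ∨ t = next s ∨ t = prev s := by
  obtain ⟨Δ, i⟩ := s
  obtain ⟨Δ', j⟩ := t
  obtain rfl : Δ' = Δ := h
  have : ∀ i j : Fin 3, j = i ∨ j = i + 1 ∨ j = i + 2 := by decide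
  rcases this i j with rfl | rfl | rfl
  · exact Or.inl rfl
  · exact Or.inr (Or.inl rfl)
  · exact Or.inr (Or.inr rfl)

theorem PrincipalLamination.glue_fst_ne (L : T.PrincipalLamination) {s : TSide Tri}
    (hs : T.Interior s) : (T.glue s).1 ≠ s.1 := by
  intro h
  rcases TSide.eq_cases h with h | h | h
  · exact hs h
  · exact L.glue_ne_next s h
  · exact L.glue_ne_prev s h

end TriangulatedSurface

/-! ### Homotopy invariant holonomy in `SL2` -/

namespace TriangulatedSurface

variable {Tri : Type*} {T : TriangulatedSurface Tri}

/-! ### Monomials in the coefficient variables -/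

variable (T) in
/-- The Laurent monomial in the `y_ρ` with given exponents. -/
def ymon [Finite Tri] (e : T.Edge → ℤ) : T.Fld :=
  letI := Fintype.ofFinite T.Edge
  ∏ ρ, T.y ρ ^ e ρ

section ymon

variable [Finite Tri]

theorem ymon_add (e e' : T.Edge → ℤ) : T.ymon (e + e') = T.ymon e * T.ymon e' := by
  simp only [ymon, Pi.add_apply, zpow_add₀ (T.y_ne_zero _), Finset.prod_mul_distrib]

theorem ymon_zero : T.ymon 0 = 1 := by simp [ymon]

theorem ymon_ne_zero (e : T.Edge → ℤ) : T.ymon e ≠ 0 := by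
  unfold ymon
  exact Finset.prod_ne_zero_iff.2 fun ρ _ => zpow_ne_zero _ (T.y_ne_zero ρ)

open Classical in
theorem ymon_single (τ : T.Edge) (n : ℤ) : T.ymon (Pi.single τ n) = T.y τ ^ n := by
  let := Fintype.ofFinite T.Edge
  change ∏ ρ, T.y ρ ^ (Pi.single τ n : T.Edge → ℤ) ρ = _
  rw [Finset.prod_eq_single τ]
  · simp
  · intro ρ _ h
    simp [h]
  · simp

open Classical in
theorem hasOrder_ymon (e : T.Edge → ℤ) : HasOrder (T.ymon e) e := by
  let := Fintype.ofFinite T.Edge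
  have h := HasOrder.prod (T := T) Finset.univ (fun ρ => T.y ρ ^ e ρ) (fun ρ => e ρ • Pi.single ρ 1)
    fun ρ _ => (HasOrder.y ρ).zpow (e ρ)
  have he : ∑ ρ, e ρ • (Pi.single ρ 1 : T.Edge → ℤ) = e := by
    ext τ
    simp [Finset.sum_apply, Pi.single_apply]
  rw [he] at h
  exact h

end ymon

/-! ### The normalized crossing matrices -/

variable (T) in
theorem sqY_cornerVec (s : TSide Tri) (i : Fin 2) :
    T.sqY (T.cornerVec s i) = T.cornerVec s i := by
  obtain ⟨Δ, j⟩ := s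
  fin_cases j <;> fin_cases i <;> simp [cornerVec, sqY_x]

variable (T) in
theorem sqY_sideSign (s : TSide Tri) : T.sqY (sideSign s) = sideSign s := by
  unfold sideSign; split_ifs <;> simp

variable (T) in
theorem map_sqY_frame (p : MPoint Tri) : (T.frame p).map T.sqY = T.frame p := by
  obtain ⟨s, _ | _⟩ := p <;> ext i j <;> fin_cases i <;> fin_cases j <;>
    simp [frame, sqY_cornerVec, sqY_x, sqY_sideSign]

/-- The crossing matrix, with the variables `y` replaced by their squares and scaled to
determinant one. -/
def crossN (L : T.PrincipalLamination) (s : TSide Tri) : Matrix (Fin 2) (Fin 2) T.Fld :=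
  (T.y (T.edge s))⁻¹ • (T.crossing L s).map T.sqY

theorem map_sqY_crossing (L : T.PrincipalLamination) (s : TSide Tri) :
    (T.crossing L s).map T.sqY = T.y (T.edge s) • crossN L s := by
  rw [crossN, smul_smul, mul_inv_cancel₀ (T.y_ne_zero _), one_smul]

theorem det_crossing (L : T.PrincipalLamination) {s : TSide Tri} (hs : T.Interior s) :
    (T.crossing L s).det = T.y (T.edge s) := by
  have h : (T.stepMatrix L .cross (s, false)).det = T.y (T.edge s) := by
    rcases L.b_self hs with hb | hb <;> simp [stepMatrix, hb]
  rw [crossing, Matrix.det_mul, Matrix.det_mul, det_frame, h, Matrix.det_nonsing_inv, det_frame]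
  simp

theorem det_crossN (L : T.PrincipalLamination) {s : TSide Tri} (hs : T.Interior s) :
    (crossN L s).det = 1 := by
  have hy := T.y_ne_zero (T.edge s)
  have h : ((T.crossing L s).map T.sqY).det = T.y (T.edge s) ^ 2 := by
    have := (RingHom.map_det T.sqY (T.crossing L s)).symm
    rw [det_crossing L hs, sqY_y] at this
    exact this
  rw [crossN, Matrix.det_smul, h]
  simp
  field_simp

/-- Crossing forth at the tail of `s` and back at the same place has the two complementary diagonal
matrices, whose product is the scalar `y`. -/
theorem crossing_glue_mul (L : T.PrincipalLamination) {s : TSide Tri} (hs : T.Interior s) :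
    EqNeg (T.crossing L (T.glue s) * T.crossing L s) (T.y (T.edge s) • 1) := by
  have h1 := T.frame_cross_true L (T.glue s)
  have h2 : T.crossing L s * T.frame (s, false) =
      T.frame (T.glue s, true) * T.stepMatrix L .cross (s, false) :=
    (T.frame_cross_false L s).symm
  have h3 : T.stepMatrix L .cross (T.glue s, true) * T.stepMatrix L .cross (s, false) =
      T.y (T.edge s) • 1 := by
    rcases L.b_self hs with hb | hb <;> ext i j <;> fin_cases i <;> fin_cases j <;>
      simp [stepMatrix, edge_glue, hb, Matrix.mul_apply, Fin.sum_univ_two]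
  have h4 := (h1.symm).mul (EqNeg.refl (T.stepMatrix L .cross (s, false)))
  rw [Matrix.mul_assoc (T.crossing L _), ← h2] at h4
  have h5 : T.frame (T.stepEnd .cross (T.glue s, true)) = T.frame (s, false) := by
    simp [stepEnd, T.glue_glue]
  rw [h5, Matrix.mul_assoc (T.frame _), h3] at h4
  have h6 := h4.mul (EqNeg.refl ((T.frame (s, false))⁻¹))
  rw [Matrix.mul_assoc, Matrix.mul_assoc, Matrix.mul_nonsing_inv _ (T.isUnit_det_frame _),
    Matrix.mul_one, Matrix.mul_smul, Matrix.mul_one, Matrix.smul_mul,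
    Matrix.mul_nonsing_inv _ (T.isUnit_det_frame _)] at h6
  exact h6

theorem crossN_glue_mul (L : T.PrincipalLamination) {s : TSide Tri} (hs : T.Interior s) :
    EqNeg (crossN L (T.glue s) * crossN L s) 1 := by
  have hy := T.y_ne_zero (T.edge s)
  have h := (crossing_glue_mul L hs).map (fun M => (T.y (T.edge s))⁻¹ ^ 2 • M.map T.sqY)
    (by intro M; ext i j; simp)
  have h1 : (T.y (T.edge s))⁻¹ ^ 2 • (T.crossing L (T.glue s) * T.crossing L s).map T.sqY =
      crossN L (T.glue s) * crossN L s := by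
    rw [Matrix.map_mul, crossN, crossN, edge_glue, Matrix.smul_mul, Matrix.mul_smul, smul_smul]
    ring_nf
  have h2 : (T.y (T.edge s))⁻¹ ^ 2 • (T.y (T.edge s) • (1 : Matrix (Fin 2) (Fin 2) T.Fld)).map
      T.sqY = 1 := by
    ext i j
    fin_cases i <;> fin_cases j <;> simp [sqY_y] <;> field_simp
  simp only [h1, h2] at h
  exact h

/-- The action of a normalized crossing matrix on the vector at the tail. -/
theorem crossN_mulVec (L : T.PrincipalLamination) {s : TSide Tri} (hs : T.Interior s) :
    (crossN L s).mulVec (T.cornerVec s) =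
      T.y (T.edge s) ^ L.b (T.edge s) (T.edge s) • T.cornerVec (next (T.glue s)) := by
  have hy := T.y_ne_zero (T.edge s)
  have h := congrArg (fun M => M.map T.sqY) (T.frame_cross_false L s)
  simp only [Matrix.map_mul, map_sqY_frame, map_sqY_crossing] at h
  ext i
  have hi := congrFun (congrFun h i) 1
  rw [Matrix.mul_apply, Matrix.mul_apply, Fin.sum_univ_two, Fin.sum_univ_two] at hi
  simp only [stepEnd, Bool.not_false, frame_apply_one, MPoint.corner, Matrix.smul_apply,
    Matrix.map_apply, stepMatrix] at hi
  rw [Matrix.mulVec, dotProduct, Fin.sum_univ_two, Pi.smul_apply]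
  rcases L.b_self hs with hb | hb
  · simp [hb, sqY_y] at hi ⊢
    refine mul_left_cancel₀ hy ?_
    linear_combination -hi
  · simp [hb] at hi ⊢
    field_simp
    linear_combination -hi

end TriangulatedSurface

namespace TriangulatedSurface

variable {Tri : Type*} {T : TriangulatedSurface Tri}

/-! ### Normalized holonomy -/

variable (T) in
/-- Matrices of determinant one. -/
abbrev SL2 : Type _ := Matrix.SpecialLinearGroup (Fin 2) T.Fld

open Classical in
/-- Crossing matrices of determinant one which are inverse to each other on the two sides of an
arc, and frames at the corners which are compatible with the rotation about marked points. -/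
structure Framing [Finite Tri] (L : T.PrincipalLamination) where
  C : TSide Tri → T.SL2
  F : TSide Tri → T.SL2
  m : TSide Tri → T.Edge → ℤ
  C_glue : ∀ s, T.Interior s → C (T.glue s) * C s = 1
  C_eqNeg : ∀ s, T.Interior s → EqNeg (C s).1 (crossN L s)
  F_col : ∀ s, EqNeg (fun i => (F s).1 i 1) (T.ymon (m s) • T.cornerVec s)
  rot_F : ∀ s, T.Interior s → C s * F s = F (next (T.glue s))
  rot_m : ∀ s, T.Interior s →
    m (next (T.glue s)) = m s + Pi.single (T.edge s) (L.b (T.edge s) (T.edge s))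

/-- The normalized crossings of the two sides of an arc are inverse only up to sign. Taking the
matrix for one representative of each arc and its inverse for the other side makes this exact, so
that backtracking leaves the holonomy unchanged. -/
theorem exists_crossSL (L : T.PrincipalLamination) : ∃ C : TSide Tri → T.SL2,
    (∀ s, T.Interior s → C (T.glue s) * C s = 1) ∧
    ∀ s, T.Interior s → EqNeg (C s).1 (crossN L s) := by
  classical
  have hd : ∀ s, ∃ D : T.SL2, T.Interior s → D.1 = crossN L s := fun s => by
    by_cases hs : T.Interior s
    · exact ⟨⟨_, det_crossN L hs⟩, fun _ => rfl⟩
    · exact ⟨1, fun h => (hs h).elim⟩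
  choose D hD using hd
  have hout : ∀ s, (T.edge s).out = s ∨ (T.edge s).out = T.glue s := fun s =>
    edge_eq_iff.1 (Quotient.out_eq (T.edge s)).symm
  refine ⟨fun s => if (T.edge s).out = s then D s else (D (T.glue s))⁻¹, fun s hs => ?_,
    fun s hs => ?_⟩
  · dsimp only
    rw [edge_glue, T.glue_glue]
    rcases hout s with h | h
    · rw [h, if_neg fun h' => hs h'.symm, if_pos rfl, inv_mul_cancel]
    · rw [h, if_pos rfl, if_neg hs, mul_inv_cancel]
  · dsimp only
    rcases hout s with h | h
    · rw [if_pos h, hD s hs]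
      exact EqNeg.refl _
    · rw [h, if_neg hs]
      have h1 := crossN_glue_mul L hs
      rw [← hD _ hs, ← hD _ (interior_glue hs)] at h1
      rw [← hD _ hs]
      have h2 := (EqNeg.refl ((D (T.glue s))⁻¹).1).mul h1
      rw [← Matrix.mul_assoc, ← Matrix.SpecialLinearGroup.coe_mul, inv_mul_cancel] at h2
      simp only [Matrix.SpecialLinearGroup.coe_one, Matrix.one_mul, Matrix.mul_one] at h2
      exact h2.symm

theorem exists_framing [Finite Tri] (L : T.PrincipalLamination) : Nonempty (Framing L) := by
  classical
  obtain ⟨C, hC, hC'⟩ := exists_crossSL L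
  let F₀ : TSide Tri → T.SL2 := fun s => ⟨T.frame (s, false), T.det_frame _⟩
  -- `Fn n s` is the standard frame `n` rotations further on, carried back to `s`; `mn` records the
  -- resulting exponents. With `n = cnt s`, the number of rotations until the boundary is reached,
  -- the choice is consistent along the whole fan at the marked point.
  let Fn : ℕ → TSide Tri → T.SL2 := fun n => n.rec F₀ fun _ G s => (C s)⁻¹ * G (T.rot s)
  let mn : ℕ → TSide Tri → T.Edge → ℤ := fun n => n.rec (fun _ => 0)
    fun _ g s => g (T.rot s) - Pi.single (T.edge s) (L.b (T.edge s) (T.edge s))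
  let cnt : TSide Tri → ℕ := fun s => Nat.find (L.exists_rot_pow s)
  have hcnt0 : ∀ s, ¬T.Interior s → cnt s = 0 := fun s hs => (Nat.find_eq_zero _).2 hs
  have hcnt : ∀ s, T.Interior s → cnt s = cnt (T.rot s) + 1 := fun s hs => by
    refine (Nat.find_comp_succ (p := fun n => ¬T.Interior ((T.rot ^ n) s)) (L.exists_rot_pow s) ?_
      (not_not.2 hs)).trans ?_
    · obtain ⟨n, hn⟩ := L.exists_rot_pow (T.rot s)
      exact ⟨n, by rwa [pow_succ]⟩
    · congr 1
  refine ⟨⟨C, fun s => Fn (cnt s) s, fun s => mn (cnt s) s, hC, hC', ?_, ?_, ?_⟩⟩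
  · have key : ∀ n s, cnt s = n →
        EqNeg (fun i => (Fn n s).1 i 1) (T.ymon (mn n s) • T.cornerVec s) := by
      intro n
      induction n with
      | zero =>
        intro s _
        refine Or.inl ?_
        ext i
        have : mn 0 s = 0 := rfl
        rw [this, ymon_zero, one_smul]
        exact T.frame_apply_one (s, false) i
      | succ n ih =>
        intro s hn
        have hs : T.Interior s := by
          by_contra hs
          rw [hcnt0 s hs] at hn
          omega
        have h1 := ih (T.rot s) (by have := hcnt s hs; omega)
        have hcol : (fun i => (Fn (n + 1) s).1 i 1) =
            ((C (T.glue s)).1).mulVec (fun i => (Fn n (T.rot s)).1 i 1) := by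
          have hF : Fn (n + 1) s = C (T.glue s) * Fn n (T.rot s) := by
            change (C s)⁻¹ * Fn n (T.rot s) = _
            rw [eq_inv_of_mul_eq_one_left (hC s hs)]
          rw [hF]
          ext i
          rw [Matrix.SpecialLinearGroup.coe_mul, Matrix.mul_apply]
          rfl
        have hm : mn n (T.rot s) = mn (n + 1) s +
            Pi.single (T.edge s) (L.b (T.edge s) (T.edge s)) := by
          change _ = mn n (T.rot s) - _ + _
          abel
        have hcorner : EqNeg (T.ymon (mn (n + 1) s) • T.cornerVec s)
            ((C (T.glue s)).1.mulVec (T.ymon (mn n (T.rot s)) • T.cornerVec (T.rot s))) := by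
          have h2 : T.ymon (mn n (T.rot s)) • T.cornerVec (T.rot s) =
              T.ymon (mn (n + 1) s) • (crossN L s).mulVec (T.cornerVec s) := by
            rw [crossN_mulVec L hs, hm, ymon_add, ymon_single, mul_smul]
            rfl
          rw [h2, Matrix.mulVec_smul, Matrix.mulVec_mulVec]
          have h3 : EqNeg ((C (T.glue s)).1 * crossN L s) 1 := by
            have := (EqNeg.refl (C (T.glue s)).1).mul (hC' s hs).symm
            rw [← Matrix.SpecialLinearGroup.coe_mul, hC s hs,
              Matrix.SpecialLinearGroup.coe_one] at this
            exact this
          rcases h3 with h3 | h3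
          · rw [h3, Matrix.one_mulVec]
            exact EqNeg.refl _
          · rw [h3, Matrix.neg_mulVec, Matrix.one_mulVec, smul_neg]
            exact Or.inr (neg_neg _).symm
        rw [hcol]
        refine EqNeg.trans ?_ hcorner.symm
        exact h1.map _ fun a => Matrix.mulVec_neg _ _
    exact fun s => key _ s rfl
  · intro s hs
    have : Fn (cnt s) s = (C s)⁻¹ * Fn (cnt (T.rot s)) (T.rot s) := by rw [hcnt s hs]
    change C s * Fn (cnt s) s = Fn (cnt (T.rot s)) (T.rot s)
    rw [this, mul_inv_cancel_left]
  · intro s hs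
    have : mn (cnt s) s = mn (cnt (T.rot s)) (T.rot s) -
        Pi.single (T.edge s) (L.b (T.edge s) (T.edge s)) := by rw [hcnt s hs]
    change mn (cnt (T.rot s)) (T.rot s) = mn (cnt s) s + _
    rw [this]
    abel

theorem IsWalk.append {Δ Δ' : Tri} {u v : List (TSide Tri)} (h : T.IsWalk Δ (u ++ v) Δ') :
    ∃ Δ'', T.IsWalk Δ u Δ'' ∧ T.IsWalk Δ'' v Δ' := by
  induction u generalizing Δ with
  | nil => exact ⟨Δ, rfl, h⟩
  | cons s u ih =>
    obtain ⟨h1, h2, h3⟩ := h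
    obtain ⟨Δ'', h4, h5⟩ := ih h3
    exact ⟨Δ'', ⟨h1, h2, h4⟩, h5⟩

theorem IsWalk.join {Δ Δ' Δ'' : Tri} {u v : List (TSide Tri)} (h : T.IsWalk Δ u Δ')
    (h' : T.IsWalk Δ' v Δ'') : T.IsWalk Δ (u ++ v) Δ'' := by
  induction u generalizing Δ with
  | nil => obtain rfl : Δ = Δ' := h; exact h'
  | cons s u ih =>
    obtain ⟨h1, h2, h3⟩ := h
    exact ⟨h1, h2, ih h3⟩

theorem IsWalk.interior {Δ Δ' : Tri} {w : List (TSide Tri)} (h : T.IsWalk Δ w Δ')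
    {s : TSide Tri} (hs : s ∈ w) : T.Interior s := by
  induction w generalizing Δ with
  | nil => simp at hs
  | cons t w ih =>
    obtain ⟨_, h2, h3⟩ := h
    rcases List.mem_cons.1 hs with rfl | hs
    · exact h2
    · exact ih h3 hs

namespace Framing

variable [Finite Tri] {L : T.PrincipalLamination} (Φ : Framing L)

/-- The normalized transport along a sequence of crossings. -/
def holW : List (TSide Tri) → T.SL2
  | [] => 1
  | s :: w => holW w * Φ.C s

theorem holW_append (u v : List (TSide Tri)) : Φ.holW (u ++ v) = Φ.holW v * Φ.holW u := by
  induction u with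
  | nil => simp [holW]
  | cons s u ih => simp [holW, ih, mul_assoc]

/-- The normalized holonomy of a curve between marked points. -/
def hol (γ : T.ArcCurve) : T.SL2 := (Φ.F γ.fin)⁻¹ * Φ.holW γ.word * Φ.F γ.init

theorem holW_backtrack {u v : List (TSide Tri)} {s : TSide Tri} (hs : T.Interior s) :
    Φ.holW (u ++ s :: T.glue s :: v) = Φ.holW (u ++ v) := by
  simp only [holW_append, holW, mul_assoc]
  rw [← mul_assoc (Φ.C _) (Φ.C _), Φ.C_glue s hs, one_mul]

theorem rot_F' {s : TSide Tri} (hs : T.Interior s) : Φ.C s * Φ.F (next s) = Φ.F (T.glue s) := by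
  have h1 := Φ.rot_F _ (interior_glue hs)
  have h2 := Φ.C_glue _ (interior_glue hs)
  rw [T.glue_glue] at h1 h2
  rw [← h1, ← mul_assoc, h2, one_mul]

/-- Backtracking cancels by `C_glue`. Sliding an end across an arc incident to it replaces a corner
by an adjacent corner at the same marked point, whose frame differs precisely by that crossing. -/
theorem hol_arcMove {γ γ' : T.ArcCurve} (h : T.ArcMove γ γ') : Φ.hol γ = Φ.hol γ' := by
  have hint : ∀ s ∈ γ.word, T.Interior s := fun s hs => γ.walk.interior hs
  cases h with
  | backtrack u v s h1 h2 h3 h4 =>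
    rw [hol, hol, h1, h2, h3, h4, Φ.holW_backtrack (hint s (by simp [h1]))]
  | initTail s h1 h2 h3 h4 =>
    rw [hol, hol, h1, h2, h3, h4, holW, ← Φ.rot_F s (hint s (by simp [h1]))]
    simp only [mul_assoc]
  | initHead s h1 h2 h3 h4 =>
    rw [hol, hol, h1, h2, h3, h4, holW, ← Φ.rot_F' (hint s (by simp [h1]))]
    simp only [mul_assoc]
  | finTail s h1 h2 h3 h4 =>
    rw [hol, hol, h1, h2, h3, h4, holW_append, ← Φ.rot_F s (hint s (by simp [h1]))]
    simp [holW, mul_assoc]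
  | finHead s h1 h2 h3 h4 =>
    rw [hol, hol, h1, h2, h3, h4, holW_append, ← Φ.rot_F' (hint s (by simp [h1]))]
    simp [holW, mul_assoc]

theorem hol_arcHomotopic {γ γ' : T.ArcCurve} (h : T.ArcHomotopic γ γ') : Φ.hol γ = Φ.hol γ' := by
  induction h with
  | rel _ _ h => exact Φ.hol_arcMove h
  | refl _ => rfl
  | symm _ _ _ ih => exact ih.symm
  | trans _ _ _ _ _ ih ih' => exact ih.trans ih'

theorem hol_isConcat {a b c : T.ArcCurve} (h : T.IsConcat a b c) :
    Φ.hol c = Φ.hol b * Φ.hol a := by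
  obtain ⟨a', b', c', ha, hb, hc, h1, h2, h3, h4⟩ := h
  rw [Φ.hol_arcHomotopic ha, Φ.hol_arcHomotopic hb, Φ.hol_arcHomotopic hc, hol, hol, hol, h2, h3, h4,
    holW_append, ← h1]
  simp [mul_assoc]

theorem trace_holW_loopMove {γ γ' : T.LoopCurve} (h : T.LoopMove γ γ') :
    (Φ.holW γ.word).1.trace = (Φ.holW γ'.word).1.trace := by
  cases h with
  | backtrack u v s h1 h2 h3 =>
    rw [h1, h2, Φ.holW_backtrack (γ.walk.interior (by simp [h1]))]
  | rotate s w h1 h2 =>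
    rw [h1, h2, holW_append]
    simp only [holW, one_mul, Matrix.SpecialLinearGroup.coe_mul]
    exact Matrix.trace_mul_comm _ _

theorem trace_holW_loopHomotopic {γ γ' : T.LoopCurve} (h : T.LoopHomotopic γ γ') :
    (Φ.holW γ.word).1.trace = (Φ.holW γ'.word).1.trace := by
  induction h with
  | rel _ _ h => exact Φ.trace_holW_loopMove h
  | refl _ => rfl
  | symm _ _ _ ih => exact ih.symm
  | trans _ _ _ _ _ ih ih' => exact ih.trans ih'

/-- How often the edges occur in a sequence of sides. -/
def _root_.TriangulatedSurface.crossCount (w : List (TSide Tri)) : T.Edge → ℤ :=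
  open Classical in (w.map fun s => (Pi.single (T.edge s) 1 : T.Edge → ℤ)).sum

theorem map_sqY_transport {w : List (TSide Tri)} (hw : ∀ s ∈ w, T.Interior s) :
    EqNeg ((T.transport L w).map T.sqY) (T.ymon (crossCount w) • (Φ.holW w).1) := by
  classical
  induction w with
  | nil =>
    refine Or.inl ?_
    simp [transport, crossCount, ymon_zero, holW]
  | cons s w ih =>
    have h1 := ih fun t ht => hw t (by simp [ht])
    have h2 : EqNeg ((T.crossing L s).map T.sqY) (T.y (T.edge s) • (Φ.C s).1) := by
      rw [map_sqY_crossing]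
      exact (Φ.C_eqNeg s (hw s (by simp))).symm.map (fun M => T.y (T.edge s) • M)
        fun a => smul_neg _ _
    have h3 := h1.mul h2
    rw [← Matrix.map_mul] at h3
    have h4 : T.ymon (crossCount (s :: w)) = T.ymon (crossCount w) * T.y (T.edge s) := by
      rw [crossCount, List.map_cons, List.sum_cons, add_comm, ymon_add, ymon_single, zpow_one]
      rfl
    rw [h4, holW, Matrix.SpecialLinearGroup.coe_mul, mul_smul]
    rw [Matrix.smul_mul, Matrix.mul_smul] at h3
    exact h3

theorem sqY_trace_transport {w : List (TSide Tri)} (hw : ∀ s ∈ w, T.Interior s) :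
    EqNeg (T.sqY (T.transport L w).trace) (T.ymon (crossCount w) * (Φ.holW w).1.trace) := by
  have h := (Φ.map_sqY_transport hw).map Matrix.trace Matrix.trace_neg
  rw [Matrix.trace_smul, smul_eq_mul] at h
  have h1 : ((T.transport L w).map T.sqY).trace = T.sqY (T.transport L w).trace := by
    simp [Matrix.trace]
  rwa [h1] at h

/-- The upper right entry of a normalized holonomy, in terms of vectors at the corners. -/
theorem hol_apply_zero_one (γ : T.ArcCurve) {p q : MPoint Tri} (hp : p.corner = γ.init)
    (hq : q.corner = γ.fin) :
    EqNeg ((Φ.hol γ).1 0 1) (T.ymon (Φ.m γ.init + Φ.m γ.fin) *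
      ((T.frame q)⁻¹ * (Φ.holW γ.word).1 * T.frame p) 0 1) := by
  have h1 : (Φ.hol γ).1 = ((Φ.F γ.fin).1)⁻¹ * (Φ.holW γ.word).1 * (Φ.F γ.init).1 := by
    rw [hol, Matrix.SpecialLinearGroup.coe_mul, Matrix.SpecialLinearGroup.coe_mul,
      Matrix.SpecialLinearGroup.coe_inv, Matrix.inv_def, (Φ.F γ.fin).2]
    simp
  rw [h1, inv_mul_apply_zero_one _ _ _ (Φ.F γ.fin).2, inv_mul_apply_zero_one _ _ _ (T.det_frame _)]
  simp only [frame_apply_one, hp, hq, ymon_add]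
  rcases Φ.F_col γ.fin with hf | hf <;> rcases Φ.F_col γ.init with hi | hi <;>
  · have f0 := congrFun hf 0
    have f1 := congrFun hf 1
    have i0 := congrFun hi 0
    have i1 := congrFun hi 1
    simp only [Pi.smul_apply, Pi.neg_apply, smul_eq_mul] at f0 f1 i0 i1
    rw [f0, f1, i0, i1]
    first
      | (refine Or.inl ?_; ring1)
      | (refine Or.inr ?_; ring1)

/-- Compares the actual upper right entry with the normalized one. The monomial collects one factor
`y` per crossing from the normalization of determinants, and the exponents by which the two end
vectors were scaled. -/
theorem sqY_frame_transport (γ : T.ArcCurve) {p q : MPoint Tri} (hp : p.corner = γ.init)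
    (hq : q.corner = γ.fin) :
    EqNeg (T.sqY (((T.frame q)⁻¹ * T.transport L γ.word * T.frame p) 0 1))
      (T.ymon (crossCount γ.word - Φ.m γ.init - Φ.m γ.fin) * (Φ.hol γ).1 0 1) := by
  have h1 := Φ.hol_apply_zero_one γ hp hq
  have h2 := (Φ.map_sqY_transport (w := γ.word) fun s hs => γ.walk.interior hs).map
    (fun M => ((T.frame q)⁻¹ * M * T.frame p) 0 1) fun M => by simp
  have hinv : ((T.frame q)⁻¹).map T.sqY = (T.frame q)⁻¹ := by
    rw [Matrix.inv_def, det_frame]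
    simp only [Ring.inverse_one, one_smul]
    change T.sqY.mapMatrix (T.frame q).adjugate = _
    rw [RingHom.map_adjugate, RingHom.mapMatrix_apply, map_sqY_frame]
  have h3 : T.sqY (((T.frame q)⁻¹ * T.transport L γ.word * T.frame p) 0 1) =
      ((T.frame q)⁻¹ * (T.transport L γ.word).map T.sqY * T.frame p) 0 1 := by
    have : (((T.frame q)⁻¹ * T.transport L γ.word * T.frame p).map T.sqY) 0 1 =
        T.sqY (((T.frame q)⁻¹ * T.transport L γ.word * T.frame p) 0 1) := rfl
    rw [← this, Matrix.map_mul, Matrix.map_mul, map_sqY_frame, hinv]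
  rw [h3]
  refine h2.trans ?_
  have h4 := (EqNeg.refl (T.ymon (crossCount γ.word - Φ.m γ.init - Φ.m γ.fin))).mul h1
  rw [← mul_assoc, ← ymon_add] at h4
  have h5 : crossCount γ.word - Φ.m γ.init - Φ.m γ.fin + (Φ.m γ.init + Φ.m γ.fin) =
      (crossCount γ.word : T.Edge → ℤ) := by abel
  rw [h5] at h4
  refine EqNeg.trans (Or.inl ?_) h4.symm
  simp

end Framing

end TriangulatedSurface

/-! ### Expansions as homotopy invariants -/

namespace TriangulatedSurface

variable {Tri : Type*} {T : TriangulatedSurface Tri}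

/-! ### Positivity of the expansions -/

variable (T) in
theorem crossMon_eq_monomial (w : List (TSide Tri)) : ∃ m, T.crossMon w =
    algebraMap (MvPolynomial T.Var ℚ) T.Fld (MvPolynomial.monomial m 1) := by
  induction w with
  | nil => exact ⟨0, by simp [crossMon, ← MvPolynomial.C_apply]⟩
  | cons s w ih =>
    obtain ⟨m, hm⟩ := ih
    refine ⟨Finsupp.single (Sum.inl (T.edge s)) 1 + m, ?_⟩
    rw [crossMon, List.map_cons, List.prod_cons, ← crossMon, hm, x, var, ← map_mul,
      MvPolynomial.X, MvPolynomial.monomial_mul, one_mul]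

theorem isPositiveLaurent_div {f : T.Fld} (w : List (TSide Tri)) (hf : f ∈ T.natPoly.rangeS) :
    T.IsPositiveLaurent (1 / T.crossMon w * f) := by
  obtain ⟨p, rfl⟩ := hf
  obtain ⟨m, hm⟩ := T.crossMon_eq_monomial w
  refine ⟨p, m, ?_⟩
  have h := crossMon_ne_zero (T := T) w
  rw [← hm]
  field_simp
  rfl

theorem x_mem_rangeS (τ : T.Edge) : T.x τ ∈ T.natPoly.rangeS := ⟨_, T.natPoly_X _⟩

theorem y_mem_rangeS (τ : T.Edge) : T.y τ ∈ T.natPoly.rangeS := ⟨_, T.natPoly_X _⟩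

theorem xMon_mul_yMon_mem (L : T.PrincipalLamination) (w : List (TSide Tri))
    (P P' : Finset T.SnakeEdge) : T.xMon P * T.yMon L w P' ∈ T.natPoly.rangeS := by
  refine mul_mem (prod_mem fun e _ => x_mem_rangeS _) (prod_mem fun k _ => ?_)
  split_ifs
  · exact y_mem_rangeS _
  · exact one_mem _

theorem isPositiveLaurent_snakeExpansion (L : T.PrincipalLamination) (γ : T.ArcCurve) :
    T.IsPositiveLaurent (T.snakeExpansion L γ) := by
  have hx : ∀ τ, T.IsPositiveLaurent (T.x τ) := fun τ => by
    have := isPositiveLaurent_div [] (x_mem_rangeS τ)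
    simpa [crossMon] using this
  unfold snakeExpansion
  split_ifs
  · exact hx _
  · exact hx _
  · exact isPositiveLaurent_div _ (sum_mem fun P _ => xMon_mul_yMon_mem L _ _ _)

theorem isPositiveLaurent_bandExpansion (L : T.PrincipalLamination) (γ : T.LoopCurve) :
    T.IsPositiveLaurent (T.bandExpansion L γ) := by
  unfold bandExpansion
  split
  · exact isPositiveLaurent_div _ (sum_mem fun P _ => xMon_mul_yMon_mem L _ _ _)
  · exact ⟨0, 0, by simp⟩

/-! ### Curves in minimal position -/

theorem IsWalk.fst_eq {Δ Δ' : Tri} {u v : List (TSide Tri)} {s t : TSide Tri}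
    (h : T.IsWalk Δ (u ++ s :: t :: v) Δ') : t.1 = (T.glue s).1 := by
  obtain ⟨_, _, h⟩ := h.append
  exact h.2.2.1

theorem IsWalk.remove_backtrack {Δ Δ' : Tri} {u v : List (TSide Tri)} {s : TSide Tri}
    (h : T.IsWalk Δ (u ++ s :: T.glue s :: v) Δ') : T.IsWalk Δ (u ++ v) Δ' := by
  obtain ⟨Δ'', h1, h2, _, _, _, h3⟩ := h.append
  refine h1.join ?_
  rwa [T.glue_glue, h2] at h3

theorem exists_eq_map_range' {α : Type*} {w : List α} (hw : w ≠ []) :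
    ∃ (sd : ℕ → α) (n : ℕ), w = (List.range' 0 (n + 1)).map sd := by
  obtain ⟨a, w, rfl⟩ := List.exists_cons_of_ne_nil hw
  refine ⟨fun k => (a :: w).getD k a, w.length, ?_⟩
  apply List.ext_getElem
  · simp
  · intro i h1 h2
    simp at h1
    simp [h1]

theorem range'_split {α : Type*} (sd : ℕ → α) {n k : ℕ} (hk : k + 1 < n) :
    (List.range' 0 n).map sd = (List.range' 0 k).map sd ++ sd k :: sd (k + 1) ::
      (List.range' (k + 2) (n - (k + 2))).map sd := by
  have h : List.range' 0 n = List.range' 0 k ++ (List.range' k 2 ++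
      List.range' (k + 2) (n - (k + 2))) := by
    rw [List.range'_append_1]
    have := List.range'_append_1 (s := 0) (m := k) (n := 2 + (n - (k + 2)))
    rw [zero_add] at this
    rw [this]
    congr 1
    omega
  rw [h]
  simp [List.range'_succ]

theorem range'_cons {α : Type*} (sd : ℕ → α) (n : ℕ) :
    (List.range' 0 (n + 1)).map sd = sd 0 :: (List.range' 1 n).map sd := by
  simp [List.range'_succ]

theorem _root_.TSide.eq_next_or_prev {s t : TSide Tri} (h : t.1 = s.1) (hne : t ≠ s) :
    t = next s ∨ t = prev s := (TSide.eq_cases h).resolve_left hne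

/-- An arc in minimal position either runs along a side of a triangle, or crosses arcs without
backtracking, where the first and the last arc are opposite to the end points. -/
theorem IsGeneralizedArc.cases {γ : T.ArcCurve} (hγ : T.IsGeneralizedArc γ) :
    (γ.word = [] ∧ (γ.fin = next γ.init ∨ γ.fin = prev γ.init)) ∨
      ∃ (sd : ℕ → TSide Tri) (n : ℕ), γ.word = (List.range' 0 (n + 1)).map sd ∧
        T.ReducedSeq sd (n + 1) ∧ γ.init = prev (sd 0) ∧ γ.fin = prev (T.glue (sd n)) := by
  obtain ⟨hmin, htriv⟩ := hγ
  have hmove : ∀ γ', T.ArcMove γ γ' → γ'.word.length < γ.word.length → False := fun γ' h h' =>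
    absurd (hmin γ' (Relation.EqvGen.rel _ _ h)) (by omega)
  by_cases hw : γ.word = []
  · refine Or.inl ⟨hw, ?_⟩
    have h1 : γ.init.1 = γ.fin.1 := by
      have := γ.walk
      rw [hw] at this
      exact this
    refine TSide.eq_next_or_prev h1.symm fun h => htriv γ.init ?_
    have : γ = T.trivialArc γ.init := ArcCurve.ext rfl hw h
    rw [← this]
    exact Relation.EqvGen.refl _
  · right
    obtain ⟨sd, n, hsd⟩ := exists_eq_map_range' hw
    have hwalk := γ.walk
    refine ⟨sd, n, hsd, ?_, ?_, ?_⟩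
    · intro k hk
      have hs := hsd
      rw [range'_split sd hk] at hs
      rw [hs] at hwalk
      refine TSide.eq_next_or_prev hwalk.fst_eq fun h => ?_
      rw [h] at hs hwalk
      refine hmove ⟨γ.init, _, γ.fin, hwalk.remove_backtrack⟩
        (.backtrack _ _ _ _ _ hs rfl rfl rfl) ?_
      rw [hs]
      simp
    · rw [range'_cons] at hsd
      rw [hsd] at hwalk
      obtain ⟨h1, h2, h3⟩ := hwalk
      -- If the curve starts at an end of the first crossed side, that crossing can be removed,
      -- against minimality; only the opposite corner remains. The same happens at the other end.
      rcases TSide.eq_cases h1.symm with h | h | h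
      · refine (hmove ⟨next (T.glue (sd 0)), _, γ.fin, h3⟩ (.initTail _ _ _ hsd h rfl rfl) ?_).elim
        rw [hsd]
        simp
      · refine (hmove ⟨T.glue (sd 0), _, γ.fin, h3⟩ (.initHead _ _ _ hsd h rfl rfl) ?_).elim
        rw [hsd]
        simp
      · exact h
    · rw [range'_map_succ] at hsd
      rw [hsd] at hwalk
      obtain ⟨Δ, h1, h2, _, h3⟩ := hwalk.append
      have h3 : (T.glue (sd n)).1 = γ.fin.1 := h3
      subst h2
      rcases TSide.eq_cases h3.symm with h | h | h
      · refine (hmove ⟨γ.init, _, next (sd n), h1⟩ (.finHead _ _ _ hsd h rfl rfl) ?_).elim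
        rw [hsd]
        simp
      · refine (hmove ⟨γ.init, _, sd n, h1⟩ (.finTail _ _ _ hsd h rfl rfl) ?_).elim
        rw [hsd]
        simp
      · exact h

/-! ### The expansions of generalized arcs -/

theorem EqNeg.neg_left {M : Type*} [InvolutiveNeg M] {a b : M} (h : EqNeg a b) : EqNeg (-a) b := by
  rcases h with rfl | rfl
  · exact Or.inr rfl
  · exact Or.inl (neg_neg _)

/-- The determinant of the vectors at the ends of a side. -/
theorem eqNeg_cornerVec (s : TSide Tri) :
    EqNeg (T.cornerVec s 0 * T.cornerVec (next s) 1 - T.cornerVec s 1 * T.cornerVec (next s) 0)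
      (T.x (T.edge s)) := by
  rw [det_cornerVec]
  unfold sideSign
  split_ifs <;> simp [EqNeg]

theorem frame_transport_eqNeg (L : T.PrincipalLamination) {γ : T.ArcCurve}
    (hγ : T.IsGeneralizedArc γ) {p q : MPoint Tri} (hp : p.corner = γ.init)
    (hq : q.corner = γ.fin) :
    EqNeg (((T.frame q)⁻¹ * T.transport L γ.word * T.frame p) 0 1) (T.snakeExpansion L γ) := by
  rcases hγ.cases with ⟨hw, h⟩ | ⟨sd, n, hw, hr, hi, hf⟩
  · rw [hw, snakeExpansion, if_pos hw, transport, inv_mul_apply_zero_one _ _ _ (T.det_frame _)]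
    simp only [frame_apply_one, hp, hq, Matrix.one_apply_eq, ne_eq, zero_ne_one, not_false_eq_true,
      Matrix.one_apply_ne, one_ne_zero]
    have hn := next_ne_prev γ.init
    rcases h with h | h
    · rw [if_pos h, h]
      refine EqNeg.trans (Or.inl ?_) (eqNeg_cornerVec γ.init)
      ring
    · rw [if_neg (by rw [h]; exact fun h' => hn h'.symm)]
      have h1 : γ.init = next γ.fin := by rw [h, next_prev]
      rw [h1]
      refine EqNeg.trans (Or.inl ?_) (eqNeg_cornerVec γ.fin).neg_left
      ring
  · rw [snakeExpansion_eq L γ sd n hw hr, hw]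
    exact frame_transport_arc L sd n hr p q (hp.trans hi) (hq.trans hf)

theorem hasOrder_div_crossMon {f : T.Fld} (τ : T.Edge) (w : List (TSide Tri))
    (h : ∀ ρ, HasConst ρ f) : HasOrder (T.sqY (1 / T.crossMon w * f)) 0 := by
  have h1 := (HasOrder.one.div (HasConst.hasOrder τ fun ρ => crossMon_hasConst ρ w)).mul
    (HasConst.hasOrder τ h)
  rw [sub_zero, add_zero] at h1
  rwa [map_mul, map_div₀, map_one]

theorem hasOrder_snakeExpansion (L : T.PrincipalLamination) {γ : T.ArcCurve}
    (hγ : T.IsGeneralizedArc γ) : HasOrder (T.sqY (T.snakeExpansion L γ)) 0 := by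
  rcases hγ.cases with ⟨hw, h⟩ | ⟨sd, n, hw, hr, hi, hf⟩
  · rw [snakeExpansion, if_pos hw]
    split_ifs <;> (rw [sqY_x]; exact HasOrder.x _)
  · rw [snakeExpansion_eq L γ sd n hw hr]
    exact hasOrder_div_crossMon (T.edge (sd 0)) _ fun ρ => arcCore_hasConst L ρ sd n

/-- Two functions of order zero that agree with one quantity `u` up to signs and monomials in the
`y` are equal: their quotient is a monomial up to sign, comparison of orders kills its exponents,
and positivity kills the sign. -/
theorem eq_of_eqNeg_ymon [Finite Tri] {z z' u : T.Fld} {e e' : T.Edge → ℤ}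
    (hz : HasOrder (T.sqY z) 0) (hz' : HasOrder (T.sqY z') 0)
    (h : EqNeg (T.sqY z) (T.ymon e * u)) (h' : EqNeg (T.sqY z') (T.ymon e' * u)) : z = z' := by
  have h1 : EqNeg (T.sqY z) (T.ymon (e - e') * T.sqY z') := by
    have h2 := (EqNeg.refl (T.ymon (e - e'))).mul h'.symm
    rw [← mul_assoc, ← ymon_add, sub_add_cancel] at h2
    exact h.trans h2
  have h3 : HasOrder (T.ymon (e - e') * T.sqY z') (e - e') := by
    have := (hasOrder_ymon (e - e')).mul hz'
    rwa [add_zero] at this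
  have h4 := hz.eq_of_eq_or_neg h3 h1
  have h5 : e - e' = 0 := by
    rw [← h4] at h3
    exact h3.unique hz
  rw [h5, ymon_zero, one_mul] at h4
  exact T.sqY.injective h4

variable [Finite Tri] {L : T.PrincipalLamination}

theorem Framing.sqY_snakeExpansion (Φ : Framing L) {γ : T.ArcCurve} (hγ : T.IsGeneralizedArc γ) :
    EqNeg (T.sqY (T.snakeExpansion L γ))
      (T.ymon (crossCount γ.word - Φ.m γ.init - Φ.m γ.fin) * (Φ.hol γ).1 0 1) := by
  have h := (frame_transport_eqNeg L hγ (p := (γ.init, false)) (q := (γ.fin, false)) rfl rfl).map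
    T.sqY fun a => map_neg _ _
  exact h.symm.trans (Φ.sqY_frame_transport γ rfl rfl)

theorem snakeExpansion_eq_of_arcHomotopic {γ γ' : T.ArcCurve} (hγ : T.IsGeneralizedArc γ)
    (hγ' : T.IsGeneralizedArc γ') (h : T.ArcHomotopic γ γ') :
    T.snakeExpansion L γ = T.snakeExpansion L γ' := by
  obtain ⟨Φ⟩ := exists_framing L
  have h' := Φ.sqY_snakeExpansion hγ'
  rw [← Φ.hol_arcHomotopic h] at h'
  exact eq_of_eqNeg_ymon (hasOrder_snakeExpansion L hγ) (hasOrder_snakeExpansion L hγ')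
    (Φ.sqY_snakeExpansion hγ) h'

/-- The curve traced by the M-path is homotopic to `γ` with equally many crossings, hence itself
minimal, and its own snake graph computes the matrix entry. Invariance of the expansion avoids any
uniqueness of minimal words. -/
theorem chiArc_eq {γ : T.ArcCurve} (hγ : T.IsGeneralizedArc γ) {ρ : MPath Tri}
    (hρ : T.IsMPathOfArc ρ γ) : T.chiArc L ρ = T.snakeExpansion L γ := by
  obtain ⟨δ, h1, h2, h3, h4, h5⟩ := hρ
  have hδ : T.IsGeneralizedArc δ := by
    refine ⟨fun γ' h => ?_, fun c h => hγ.2 c (h4.symm.trans _ _ _ h)⟩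
    rw [h5]
    exact hγ.1 γ' (h4.symm.trans _ _ _ h)
  rw [← snakeExpansion_eq_of_arcHomotopic hδ hγ h4]
  refine T.absL_eq (isPositiveLaurent_snakeExpansion L δ) ?_
  have h6 := (T.pathMatrix_eqNeg L ρ.start ρ.steps).map (fun M => M 0 1) fun M => rfl
  rw [← h2] at h6
  exact h6.trans (frame_transport_eqNeg L hδ h1.symm h3.symm)

end TriangulatedSurface

namespace TriangulatedSurface

variable {Tri : Type*} {T : TriangulatedSurface Tri}

/-! ### The expansions of closed loops -/

theorem IsWalk.rotate {Δ : Tri} {s : TSide Tri} {w : List (TSide Tri)}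
    (h : T.IsWalk Δ (s :: w) Δ) : T.IsWalk (T.glue s).1 (w ++ [s]) (T.glue s).1 := by
  obtain ⟨rfl, h2, h3⟩ := h
  exact h3.join ⟨rfl, h2, rfl⟩

/-- A closed loop in minimal position crosses at least two arcs, without backtracking. -/
theorem IsClosedLoop.exists_reduced (L : T.PrincipalLamination) {γ : T.LoopCurve}
    (hγ : T.IsClosedLoop γ) : ∃ (sd : ℕ → TSide Tri) (n : ℕ), 1 ≤ n ∧
      γ.word = (List.range' 0 (n + 1)).map sd ∧ T.ReducedSeq sd (n + 1) ∧
      (sd 0 = next (T.glue (sd n)) ∨ sd 0 = prev (T.glue (sd n))) := by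
  obtain ⟨hmin, htriv⟩ := hγ
  have hw : γ.word ≠ [] := by
    intro hw
    have : γ = T.trivialLoop γ.base := LoopCurve.ext rfl hw
    refine htriv γ.base ?_
    rw [← this]
    exact Relation.EqvGen.refl _
  obtain ⟨sd, n, hsd⟩ := exists_eq_map_range' hw
  have hwalk := γ.walk
  have hn : 1 ≤ n := by
    by_contra hn
    obtain rfl : n = 0 := by omega
    have h1 : γ.word = [sd 0] := hsd
    rw [h1] at hwalk
    obtain ⟨h2, h3, h4⟩ := hwalk
    have h4 : (T.glue (sd 0)).1 = γ.base := h4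
    exact L.glue_fst_ne h3 (h4.trans h2.symm)
  have hred : ∀ {Δ : Tri} {u v : List (TSide Tri)} {s t : TSide Tri}
      (hwk : T.IsWalk Δ (u ++ s :: t :: v) Δ), (u ++ s :: t :: v).length = γ.word.length →
      T.LoopHomotopic γ ⟨Δ, _, hwk⟩ → t = next (T.glue s) ∨ t = prev (T.glue s) := by
    intro Δ u v s t hwk hlen hh
    refine TSide.eq_next_or_prev hwk.fst_eq fun h => ?_
    subst h
    have h1 := hmin ⟨Δ, _, hwk.remove_backtrack⟩
      (hh.trans _ _ _ (Relation.EqvGen.rel _ _ (.backtrack _ _ u v s rfl rfl rfl)))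
    rw [← hlen] at h1
    simp at h1
  refine ⟨sd, n, hn, hsd, fun k hk => ?_, ?_⟩
  · have hs := hsd
    rw [range'_split sd hk] at hs
    rw [hs] at hwalk
    refine hred hwalk (by rw [hs]) ?_
    have h1 : γ = ⟨γ.base, _, hwalk⟩ := LoopCurve.ext rfl hs
    exact h1 ▸ Relation.EqvGen.refl γ
  -- Moving the base point across the first crossing makes the last and the first crossing
  -- consecutive, so a cyclic backtrack is excluded like any other.
  · obtain ⟨n, rfl⟩ := Nat.exists_eq_succ_of_ne_zero (show n ≠ 0 by omega)
    have hs := hsd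
    rw [range'_cons, List.range'_concat, List.map_append] at hs
    simp only [List.map_cons, List.map_nil] at hs
    rw [show 1 + 1 * n = n.succ by omega] at hs
    rw [hs] at hwalk
    have h1 := hwalk.rotate
    rw [List.append_assoc] at h1
    refine hred (u := (List.range' 1 n).map sd) (v := []) h1 (by rw [hs]; simp) ?_
    refine Relation.EqvGen.rel _ _ (.rotate _ _ (sd 0) _ hs ?_)
    simp

variable {L : T.PrincipalLamination}

theorem trace_transport_eqNeg {γ : T.LoopCurve} (hγ : T.IsClosedLoop γ) :
    EqNeg (T.transport L γ.word).trace (T.bandExpansion L γ) ∧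
      HasOrder (T.sqY (T.bandExpansion L γ)) 0 := by
  obtain ⟨sd, n, hn, hw, hr, hc⟩ := hγ.exists_reduced L
  rw [bandExpansion_eq L γ sd n hn hw hr hc, hw]
  exact ⟨trace_transport L sd n hr hc, hasOrder_div_crossMon (T.edge (sd 0)) _ fun ρ =>
    trace_hasConst ((DiagConst.turnMat _ _ _ _).mul (DiagConst.coreMat L ρ sd n))⟩

variable [Finite Tri]

theorem Framing.sqY_bandExpansion (Φ : Framing L) {γ : T.LoopCurve} (hγ : T.IsClosedLoop γ) :
    EqNeg (T.sqY (T.bandExpansion L γ))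
      (T.ymon (crossCount γ.word) * (Φ.holW γ.word).1.trace) :=
  ((trace_transport_eqNeg hγ).1.map T.sqY fun _ => map_neg _ _).symm.trans
    (Φ.sqY_trace_transport fun _ hs => γ.walk.interior hs)

/-- Moving the base point is a homotopy, so this includes the independence of the cutting point. -/
theorem bandExpansion_eq_of_loopHomotopic {γ γ' : T.LoopCurve} (hγ : T.IsClosedLoop γ)
    (hγ' : T.IsClosedLoop γ') (h : T.LoopHomotopic γ γ') :
    T.bandExpansion L γ = T.bandExpansion L γ' := by
  obtain ⟨Φ⟩ := exists_framing L
  have h' := Φ.sqY_bandExpansion hγ'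
  rw [← Φ.trace_holW_loopHomotopic h] at h'
  exact eq_of_eqNeg_ymon (trace_transport_eqNeg hγ).2 (trace_transport_eqNeg hγ').2
    (Φ.sqY_bandExpansion hγ) h'

theorem chiLoop_eq {γ : T.LoopCurve} (hγ : T.IsClosedLoop γ) {ρ : MPath Tri}
    (hρ : T.IsMPathOfLoop ρ γ) : T.chiLoop L ρ = T.bandExpansion L γ := by
  obtain ⟨h1, δ, h2, h3, h4, h5⟩ := hρ
  have hδ : T.IsClosedLoop δ := by
    refine ⟨fun γ' h => ?_, fun c h => hγ.2 c (h4.symm.trans _ _ _ h)⟩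
    rw [h5]
    exact hγ.1 γ' (h4.symm.trans _ _ _ h)
  rw [← bandExpansion_eq_of_loopHomotopic hδ hγ h4]
  refine T.absL_eq (isPositiveLaurent_bandExpansion L δ) ?_
  have h6 := (T.pathMatrix_eqNeg L ρ.start ρ.steps).map Matrix.trace Matrix.trace_neg
  rw [← h3, h1, Matrix.trace_mul_comm, ← Matrix.mul_assoc,
    Matrix.mul_nonsing_inv _ (T.isUnit_det_frame _), Matrix.one_mul] at h6
  exact h6.trans (trace_transport_eqNeg hδ).1

end TriangulatedSurface

/-! ### Signed adjacency, flips and mutations -/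

namespace TriangulatedSurface

variable {Tri : Type*}

/-! ### Signed adjacency and flips -/

theorem _root_.TSide.ne_of_fst_ne {u v : TSide Tri} {Δ Δ' : Tri} (h : Δ ≠ Δ') (hu : u.1 = Δ)
    (hv : v.1 = Δ') : u ≠ v := fun e => h (by rw [← hu, ← hv, e])

section adjacency

variable {ι : Type*}

open Classical in
/-- The Kronecker symbol. -/
def kron (a i : ι) : ℤ := if a = i then 1 else 0

/-- The contribution of one side to the signed adjacency matrix of a labelling. -/
def sideTerm (f : TSide Tri → ι) (s : TSide Tri) (i j : ι) : ℤ :=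
  (kron (f (next s)) i - kron (f (prev s)) i) * kron (f s) j

/-- The contribution of one triangle to the signed adjacency matrix of a labelling. -/
def triTerm (f : TSide Tri → ι) (s : TSide Tri) (i j : ι) : ℤ :=
  sideTerm f s i j + sideTerm f (next s) i j + sideTerm f (prev s) i j

/-- The signed adjacency matrix of a labelling of the sides. -/
def adj [Finite Tri] (f : TSide Tri → ι) (i j : ι) : ℤ :=
  letI := Fintype.ofFinite (TSide Tri)
  ∑ s, sideTerm f s i j

theorem triTerm_next (f : TSide Tri → ι) (s : TSide Tri) (i j : ι) :
    triTerm f (next s) i j = triTerm f s i j := by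
  simp only [triTerm, next_next, prev_next]
  ring

theorem triTerm_congr (f : TSide Tri → ι) {s t : TSide Tri} (h : t.1 = s.1) (i j : ι) :
    triTerm f t i j = triTerm f s i j := by
  rcases TSide.eq_cases h with rfl | rfl | rfl
  · rfl
  · exact triTerm_next f _ i j
  · rw [← next_next, triTerm_next, triTerm_next]

theorem triTerm_swap (f : TSide Tri → ι) (s : TSide Tri) (i j : ι) :
    triTerm f s j i = -triTerm f s i j := by
  simp only [triTerm, sideTerm, next_next, prev_next, next_prev, prev_prev]
  ring

theorem adj_eq_sum_triTerm [Finite Tri] [Fintype Tri] (f : TSide Tri → ι) (i j : ι) :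
    adj f i j = ∑ Δ : Tri, triTerm f (Δ, 0) i j := by
  have h : adj f i j = ∑ s : Tri × Fin 3, sideTerm f s i j := by
    unfold adj
    congr!
  rw [h, Fintype.sum_prod_type]
  exact Finset.sum_congr rfl fun Δ _ => Fin.sum_univ_three _

theorem adj_swap [Finite Tri] (f : TSide Tri → ι) (i j : ι) : adj f j i = -adj f i j := by
  let := Fintype.ofFinite Tri
  rw [adj_eq_sum_triTerm, adj_eq_sum_triTerm, ← Finset.sum_neg_distrib]
  exact Finset.sum_congr rfl fun Δ _ => triTerm_swap f _ i j

theorem adj_self [Finite Tri] (f : TSide Tri → ι) (i : ι) : adj f i i = 0 := by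
  have := adj_swap f i i
  omega

/-- A column of the signed adjacency matrix. -/
theorem adj_column [Finite Tri] (f : TSide Tri → ι) {s s' : TSide Tri} (hne : s ≠ s')
    (h : ∀ u, f s = f u ↔ u = s ∨ u = s') (i : ι) :
    adj f i (f s) = kron (f (next s)) i + kron (f (next s')) i -
      (kron (f (prev s)) i + kron (f (prev s')) i) := by
  classical
  let := Fintype.ofFinite (TSide Tri)
  have h1 : ∀ u, kron (f u) (f s) = if u = s ∨ u = s' then 1 else 0 := fun u => by
    unfold kron
    congr 1
    rw [← h u]
    exact propext eq_comm
  change ∑ u, sideTerm f u i (f s) = _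
  rw [Fintype.sum_eq_add s s' hne]
  · simp only [sideTerm, h1]
    simp
    ring
  · rintro u ⟨hu, hu'⟩
    simp [sideTerm, h1, hu, hu']

/-- The inequalities say that no positive contribution meets a negative one, so positive parts can
be read off term by term. The cases `a = c` and `b = d`, which give double entries, are permitted.
-/
theorem max_sub_kron {a b c d : ι} (h1 : a ≠ b) (h2 : a ≠ d) (h3 : c ≠ b) (h4 : c ≠ d) (i : ι) :
    max (kron a i + kron c i - (kron b i + kron d i)) 0 = kron a i + kron c i := by
  unfold kron
  split_ifs with e1 e2 e3 e4 <;> simp_all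

theorem max_neg_sub_kron {a b c d : ι} (h1 : a ≠ b) (h2 : a ≠ d) (h3 : c ≠ b) (h4 : c ≠ d)
    (i : ι) : max (-(kron a i + kron c i - (kron b i + kron d i))) 0 = kron b i + kron d i := by
  rw [neg_sub, max_sub_kron h1.symm h3.symm h2.symm h4.symm]

variable {s s' : TSide Tri}

theorem flipPos_self (hne : s'.1 ≠ s.1) : flipPos s s' s = s := by
  have h1 : s ≠ next s' := TSide.ne_of_fst_ne hne.symm rfl rfl
  have h2 : s ≠ prev s' := TSide.ne_of_fst_ne hne.symm rfl rfl
  simp [flipPos, (next_ne s).symm, (prev_ne s).symm, h1, h2]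

theorem flipPos_other (hne : s'.1 ≠ s.1) : flipPos s s' s' = s' := by
  have h1 : s' ≠ next s := TSide.ne_of_fst_ne hne rfl rfl
  have h2 : s' ≠ prev s := TSide.ne_of_fst_ne hne rfl rfl
  simp [flipPos, (next_ne s').symm, (prev_ne s').symm, h1, h2]

theorem flipPos_next : flipPos s s' (next s) = prev s := by simp [flipPos]

theorem flipPos_prev : flipPos s s' (prev s) = next s' := by
  simp [flipPos, (next_ne_prev s).symm]

theorem flipPos_next' (hne : s'.1 ≠ s.1) : flipPos s s' (next s') = prev s' := by
  have h1 : next s' ≠ next s := TSide.ne_of_fst_ne hne rfl rfl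
  have h2 : next s' ≠ prev s := TSide.ne_of_fst_ne hne rfl rfl
  simp [flipPos, h1, h2]

theorem flipPos_prev' (hne : s'.1 ≠ s.1) : flipPos s s' (prev s') = next s := by
  have h1 : prev s' ≠ next s := TSide.ne_of_fst_ne hne rfl rfl
  have h2 : prev s' ≠ prev s := TSide.ne_of_fst_ne hne rfl rfl
  simp [flipPos, h1, h2, (next_ne_prev s').symm]

theorem flipPos_of_ne {t : TSide Tri} (h1 : t ≠ next s) (h2 : t ≠ prev s) (h3 : t ≠ next s')
    (h4 : t ≠ prev s') : flipPos s s' t = t := by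
  simp [flipPos, h1, h2, h3, h4]

theorem flipPos_of_fst_ne {t : TSide Tri} (h : t.1 ≠ s.1) (h' : t.1 ≠ s'.1) :
    flipPos s s' t = t :=
  flipPos_of_ne (TSide.ne_of_fst_ne h rfl rfl) (TSide.ne_of_fst_ne h rfl rfl)
    (TSide.ne_of_fst_ne h' rfl rfl) (TSide.ne_of_fst_ne h' rfl rfl)

/-- A flip turns the quadrilateral by a quarter: the four outer positions are permuted cyclically.
-/
theorem flipPos_iterate (hne : s'.1 ≠ s.1) (t : TSide Tri) :
    flipPos s s' (flipPos s s' (flipPos s s' (flipPos s s' t))) = t := by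
  by_cases h1 : t = next s
  · subst h1
    simp only [flipPos_next, flipPos_prev, flipPos_next' hne, flipPos_prev' hne]
  by_cases h2 : t = prev s
  · subst h2
    simp only [flipPos_next, flipPos_prev, flipPos_next' hne, flipPos_prev' hne]
  by_cases h3 : t = next s'
  · subst h3
    simp only [flipPos_next, flipPos_prev, flipPos_next' hne, flipPos_prev' hne]
  by_cases h4 : t = prev s'
  · subst h4
    simp only [flipPos_next, flipPos_prev, flipPos_next' hne, flipPos_prev' hne]
  simp only [flipPos_of_ne h1 h2 h3 h4]

theorem flipPos_injective (hne : s'.1 ≠ s.1) : Function.Injective (flipPos s s') := by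
  intro t u h
  rw [← flipPos_iterate hne t, h, flipPos_iterate hne]

/-- The change of the signed adjacency matrix in a flip. -/
theorem adj_flip [Finite Tri] (f : TSide Tri → ι) (hne : s'.1 ≠ s.1) (i j : ι) :
    adj (fun t => f (flipPos s s' t)) i j = adj f i j +
      ((triTerm (fun t => f (flipPos s s' t)) s i j - triTerm f s i j) +
        (triTerm (fun t => f (flipPos s s' t)) s' i j - triTerm f s' i j)) := by
  let := Fintype.ofFinite Tri
  rw [← sub_eq_iff_eq_add', adj_eq_sum_triTerm, adj_eq_sum_triTerm, ← Finset.sum_sub_distrib,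
    Fintype.sum_eq_add s.1 s'.1 hne.symm]
  · rw [triTerm_congr (t := (s.1, 0)) (s := s) _ rfl, triTerm_congr (t := (s.1, 0)) (s := s) f rfl,
      triTerm_congr (t := (s'.1, 0)) (s := s') _ rfl,
      triTerm_congr (t := (s'.1, 0)) (s := s') f rfl]
  · rintro Δ ⟨h, h'⟩
    simp only [triTerm, sideTerm]
    simp only [next_next, prev_next, next_prev, prev_prev]
    rw [flipPos_of_fst_ne (t := (Δ, 0)) h h', flipPos_of_fst_ne (t := next (Δ, 0)) h h',
      flipPos_of_fst_ne (t := prev (Δ, 0)) h h']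
    ring

/-- The signed adjacency matrix mutates in a flip. -/
theorem adj_flip_eq_mutation [Finite Tri] (f : TSide Tri → ι) (hne : s'.1 ≠ s.1)
    (h : ∀ u, f s = f u ↔ u = s ∨ u = s')
    (h1 : f (next s) ≠ f (prev s)) (h2 : f (next s) ≠ f (prev s'))
    (h3 : f (next s') ≠ f (prev s)) (h4 : f (next s') ≠ f (prev s')) (i j : ι) [Decidable
      (i = f s ∨ j = f s)] :
    adj (fun t => f (flipPos s s' t)) i j =
      if i = f s ∨ j = f s then -adj f i j else
        adj f i j + (max (adj f i (f s)) 0 * max (adj f (f s) j) 0 -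
          max (-adj f i (f s)) 0 * max (-adj f (f s) j) 0) := by
  have hss : s ≠ s' := fun e => hne (by rw [e])
  -- Only the two triangles of the quadrilateral change. The column of the flipped arc has positive
  -- part the two `next` sides and negative part the two `prev` sides, and `key` is the resulting
  -- change expressed through them.
  have hcol := adj_column f hss h
  have hs' : f s' = f s := ((h s').2 (Or.inr rfl)).symm
  have key : triTerm (fun t => f (flipPos s s' t)) s i j - triTerm f s i j +
        (triTerm (fun t => f (flipPos s s' t)) s' i j - triTerm f s' i j) =
      (kron (f (next s)) i + kron (f (next s')) i) * (kron (f (prev s)) j + kron (f (prev s')) j) -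
      (kron (f (prev s)) i + kron (f (prev s')) i) * (kron (f (next s)) j + kron (f (next s')) j) +
      2 * ((kron (f (prev s)) i + kron (f (prev s')) i -
        (kron (f (next s)) i + kron (f (next s')) i)) * kron (f s) j -
        kron (f s) i * (kron (f (prev s)) j + kron (f (prev s')) j -
        (kron (f (next s)) j + kron (f (next s')) j))) := by
    simp only [triTerm, sideTerm, next_next, prev_next, next_prev, prev_prev, flipPos_self hne,
      flipPos_other hne, flipPos_next, flipPos_prev, flipPos_next' hne, flipPos_prev' hne, hs']
    ring
  rw [adj_flip f hne, key]
  have hrow : ∀ j, adj f (f s) j = -(kron (f (next s)) j + kron (f (next s')) j -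
      (kron (f (prev s)) j + kron (f (prev s')) j)) := fun j => by rw [adj_swap, hcol]
  have n1 : f (next s) ≠ f s := fun e => by
    rcases (h _).1 e.symm with e | e
    · exact next_ne s e
    · exact absurd e (TSide.ne_of_fst_ne hne.symm rfl rfl)
  have n2 : f (prev s) ≠ f s := fun e => by
    rcases (h _).1 e.symm with e | e
    · exact prev_ne s e
    · exact absurd e (TSide.ne_of_fst_ne hne.symm rfl rfl)
  have n3 : f (next s') ≠ f s := fun e => by
    rcases (h _).1 e.symm with e | e
    · exact absurd e (TSide.ne_of_fst_ne hne rfl rfl)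
    · exact next_ne s' e
  have n4 : f (prev s') ≠ f s := fun e => by
    rcases (h _).1 e.symm with e | e
    · exact absurd e (TSide.ne_of_fst_ne hne rfl rfl)
    · exact prev_ne s' e
  have k1 : ∀ {a : ι}, a ≠ f s → kron a (f s) = 0 := fun h => if_neg h
  have k2 : kron (f s) (f s) = 1 := if_pos rfl
  by_cases hi : i = f s
  · subst hi
    rw [if_pos (Or.inl rfl), hrow, k1 n1, k1 n2, k1 n3, k1 n4, k2]
    ring
  · by_cases hj : j = f s
    · subst hj
      rw [if_pos (Or.inr rfl), hcol, k1 n1, k1 n2, k1 n3, k1 n4, k2]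
      ring
    · have k3 : ∀ {i : ι}, i ≠ f s → kron (f s) i = 0 := fun h => if_neg (Ne.symm h)
      rw [if_neg (by tauto), hcol, hrow, k3 hi, k3 hj, neg_neg, max_sub_kron h1 h2 h3 h4,
        max_neg_sub_kron h1 h2 h3 h4, max_sub_kron h1 h2 h3 h4, max_neg_sub_kron h1 h2 h3 h4]
      ring

end adjacency

end TriangulatedSurface

namespace TriangulatedSurface

variable {Tri : Type*} {T : TriangulatedSurface Tri}

/-! ### Mutation of coefficients -/

theorem sum_kron_mul {ι : Type*} [Fintype ι] (a : ι) (f : ι → ℤ) : ∑ i, kron a i * f i = f a := by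
  classical
  simp [kron]

theorem prod_pow_kron {ι K : Type*} [Fintype ι] [CommMonoid K] (f : ι → K) (n : ι → ℕ) (a c : ι)
    (h : ∀ i, (n i : ℤ) = kron a i + kron c i) : ∏ i, f i ^ n i = f a * f c := by
  classical
  have h' : ∀ i, n i = (if a = i then 1 else 0) + if c = i then 1 else 0 := fun i => by
    zify
    rw [h i]
    simp [kron]
  simp only [h', pow_add, Finset.prod_mul_distrib, pow_ite, pow_one, pow_zero]
  simp

/-- Mutation preserves the relation between a coefficient row and tropical weights. -/
theorem row_mutation {ι : Type*} [Fintype ι] [DecidableEq ι] {B B' : ι → ι → ℤ} {b t : ι → ℤ}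
    {k : ι} (hk : B k k = 0) {Mp Mm : ℤ} (hMp : ∑ i, max (B i k) 0 * t i = Mp)
    (hMm : ∑ i, max (-B i k) 0 * t i = Mm) (hbk : 2 * b k = -∑ i, B i k * t i) {j : ι}
    (hbj : 2 * b j = -∑ i, B i j * t i)
    (hB' : ∀ i j, B' i j = if i = k ∨ j = k then -B i j else
      B i j + (max (B i k) 0 * max (B k j) 0 - max (-B i k) 0 * max (-B k j) 0)) :
    2 * (if j = k then -b j else
      b j + (max (b k) 0 * max (B k j) 0 - max (-b k) 0 * max (-B k j) 0)) =
      -∑ i, B' i j * (if i = k then max Mp Mm - t k else t i) := by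
  by_cases hj : j = k
  · subst hj
    have h : ∀ i, B' i j * (if i = j then max Mp Mm - t j else t i) = -(B i j * t i) := fun i => by
      rw [hB', if_pos (Or.inr rfl)]
      split_ifs with hi
      · rw [hi, hk]; ring
      · ring
    simp only [h, if_true, Finset.sum_neg_distrib]
    linarith
  · have h : ∀ i, B' i j * (if i = k then max Mp Mm - t k else t i) =
        B i j * t i + (max (B i k) 0 * t i * max (B k j) 0 - max (-B i k) 0 * t i * max (-B k j) 0) +
          if i = k then -B k j * max Mp Mm else 0 := fun i => by
      rw [hB']
      by_cases hi : i = k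
      · subst hi
        simp [hk]
        ring
      · simp [hi, hj]
        ring
    have hs : ∑ i, B i k * t i = Mp - Mm := by
      rw [← hMp, ← hMm, ← Finset.sum_sub_distrib]
      refine Finset.sum_congr rfl fun i _ => ?_
      have : B i k = max (B i k) 0 - max (-B i k) 0 := by omega
      conv_lhs => rw [this]
      ring
    simp only [h, Finset.sum_add_distrib, Finset.sum_sub_distrib, ← Finset.sum_mul, hMp, hMm,
      Finset.sum_ite_eq', Finset.mem_univ, if_true, if_neg hj]
    -- Now `2 b_k = Mm - Mp`, so twice its positive and negative parts are the amounts by which `Mp`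
    -- and `Mm` fall short of their maximum.
    rw [hs] at hbk
    have h1 : 2 * max (b k) 0 = max Mp Mm - Mp := by omega
    have h2 : 2 * max (-b k) 0 = max Mp Mm - Mm := by omega
    have h3 : B k j = max (B k j) 0 - max (-B k j) 0 := by omega
    linear_combination hbj + max (B k j) 0 * h1 - max (-B k j) 0 * h2 - max Mp Mm * h3

/-- The two edges with nonzero exponent in an exchange monomial contribute lambda lengths; squaring
the `y` doubles the coefficient exponents, which explains the factor `2` in the row relation. -/
theorem sqY_prod_cluster [Finite Tri] [Fintype T.Var] {cl : T.Var → T.Fld} {lam : T.Edge → T.Fld}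
    {t : T.Edge → T.Edge → ℤ} (h1 : ∀ i, T.sqY (cl (Sum.inl i)) = lam i * T.ymon (t i))
    (h2 : ∀ ρ, cl (Sum.inr ρ) = T.y ρ) (n : T.Var → ℕ) (a c : T.Edge)
    (h : ∀ i, (n (Sum.inl i) : ℤ) = kron a i + kron c i) :
    T.sqY (∏ j, cl j ^ n j) =
      lam a * lam c * T.ymon (t a + t c + fun ρ => 2 * (n (Sum.inr ρ) : ℤ)) := by
  let := Fintype.ofFinite T.Edge
  have h3 : ∏ j, cl j ^ n j = (∏ i, cl (Sum.inl i) ^ n (Sum.inl i)) *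
      ∏ ρ, cl (Sum.inr ρ) ^ n (Sum.inr ρ) := by
    rw [← Fintype.prod_sum_type fun j => cl j ^ n j]
    congr!
  have h4 : T.ymon (fun ρ => 2 * (n (Sum.inr ρ) : ℤ)) = ∏ ρ, (T.y ρ ^ 2) ^ n (Sum.inr ρ) := by
    change ∏ ρ, T.y ρ ^ (2 * (n (Sum.inr ρ) : ℤ)) = _
    refine Finset.prod_congr rfl fun ρ _ => ?_
    rw [← pow_mul, ← zpow_natCast]
    push_cast
    rfl
  rw [h3, prod_pow_kron _ _ a c h, map_mul, map_mul, map_prod, h1, h1, ymon_add, ymon_add, h4]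
  simp only [map_pow, h2, sqY_y]
  ring

/-! ### Two by two matrices of determinant one -/

theorem SL2.inv_apply_zero_one (A : T.SL2) : (A⁻¹).1 0 1 = -A.1 0 1 := by
  simp [Matrix.SpecialLinearGroup.SL2_inv_expl]

theorem SL2.inv_mul_apply_zero_one (A B : T.SL2) :
    (A⁻¹ * B).1 0 1 = B.1 0 1 * A.1 1 1 - B.1 1 1 * A.1 0 1 := by
  rw [Matrix.SpecialLinearGroup.coe_mul, Matrix.SpecialLinearGroup.SL2_inv_expl, Matrix.mul_apply,
    Fin.sum_univ_two]
  simp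
  ring

/-- The Plücker relation. -/
theorem SL2.pluecker {S N P N' P' : T.SL2} (h : P * N * S = 1) (h' : P' * N' * S⁻¹ = 1) :
    S.1 0 1 * (N * P').1 0 1 = N'.1 0 1 * N.1 0 1 - P.1 0 1 * P'.1 0 1 := by
  have h1 : P = (N * S)⁻¹ := eq_inv_of_mul_eq_one_left (by rwa [← mul_assoc])
  have h2 : N' = P'⁻¹ * S := by
    rw [mul_inv_eq_one] at h'
    rw [← h', inv_mul_cancel_left]
  rw [h1, h2, SL2.inv_apply_zero_one, SL2.inv_mul_apply_zero_one]
  simp only [Matrix.SpecialLinearGroup.coe_mul, Matrix.mul_apply, Fin.sum_univ_two]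
  ring

/-! ### Seeds along sequences of flips -/

open Classical in
/-- The relation between the curves, the labels and the seed of a triangulation and the normalized
holonomies. -/
structure StageData [Finite Tri] {L : T.PrincipalLamination} (Φ : Framing L) (A : T.Stage) where
  eps : TSide Tri → T.Fld
  lam : T.Edge → T.Fld
  t : T.Edge → T.Edge → ℤ
  hol_glue : ∀ s, A.surf.Interior s →
    Φ.hol (A.curve (A.surf.glue s)) * Φ.hol (A.curve s) = 1
  hol_tri : ∀ s, Φ.hol (A.curve (prev s)) * Φ.hol (A.curve (next s)) * Φ.hol (A.curve s) = 1
  label_eq : ∀ s u, A.label s = A.label u ↔ u = s ∨ u = A.surf.glue s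
  eps_sq : ∀ s, eps s * eps s = 1
  eps_mul : ∀ s, eps s * eps (next s) * eps (prev s) = -1
  ur : ∀ s, (Φ.hol (A.curve s)).1 0 1 = eps s * lam (A.label s)
  order : ∀ i, HasOrder (lam i) (-t i)
  cluster_inl : ∀ i, T.sqY (A.seed.cluster (Sum.inl i)) = lam i * T.ymon (t i)
  cluster_inr : ∀ ρ, A.seed.cluster (Sum.inr ρ) = T.y ρ
  B_inl : ∀ i j, A.seed.B (Sum.inl i) j = adj A.label i j
  B_inr : ∀ s, A.surf.Interior s → ∀ ρ, 2 * A.seed.B (Sum.inr ρ) (A.label s) =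
    -(letI := Fintype.ofFinite T.Edge
      ∑ i, adj A.label i (A.label s) * t i ρ)

theorem adj_edge [Finite Tri] (i j : T.Edge) : adj T.edge i j =
    (Nat.card {s : TSide Tri // T.edge (next s) = i ∧ T.edge s = j} : ℤ) -
      Nat.card {s : TSide Tri // T.edge (prev s) = i ∧ T.edge s = j} := by
  classical
  let := Fintype.ofFinite (TSide Tri)
  change ∑ s, sideTerm T.edge s i j = _
  rw [Nat.card_eq_fintype_card, Nat.card_eq_fintype_card, Fintype.card_subtype,
    Fintype.card_subtype, Finset.card_filter, Finset.card_filter]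
  push_cast
  rw [← Finset.sum_sub_distrib]
  refine Finset.sum_congr rfl fun s _ => ?_
  simp only [sideTerm, kron]
  by_cases h1 : T.edge (next s) = i <;> by_cases h2 : T.edge (prev s) = i <;>
    by_cases h3 : T.edge s = j <;> simp [h1, h2, h3]

/-- Initially the lambda length of an edge is its `x` times the monomial of the exponents at its two
ends, so `t` is minus their sum. The row relation expresses that the exponents jump by the shear
coordinate at either end of an arc when it is crossed. -/
theorem exists_stageData_initial [Finite Tri] {L : T.PrincipalLamination} (Φ : Framing L) :
    Nonempty (StageData Φ (T.initialStage L)) := by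
  classical
  let := Fintype.ofFinite T.Edge
  have hσ : ∀ s, ∃ σ : T.Fld, σ * σ = 1 ∧ ∀ i, (Φ.F s).1 i 1 =
      σ * (T.ymon (Φ.m s) * T.cornerVec s i) := fun s => by
    rcases Φ.F_col s with h | h
    · exact ⟨1, by simp, fun i => by simpa using congrFun h i⟩
    · exact ⟨-1, by simp, fun i => by simpa using congrFun h i⟩
  choose σ hσ hF using hσ
  -- The sum of the exponents at the ends does not depend on the side chosen: seen from either side
  -- of an arc it is `Φ.m s + Φ.m (T.glue s)` plus the same jump.
  obtain ⟨μ, hμ⟩ : ∃ μ : T.Edge → T.Edge → ℤ, ∀ s, μ (T.edge s) = Φ.m s + Φ.m (next s) := by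
    obtain ⟨r, hr⟩ : ∃ r : T.Edge → TSide Tri, ∀ τ, T.edge (r τ) = τ :=
      Classical.skolem.1 (Quotient.exists_rep (s := T.edgeSetoid))
    refine ⟨fun τ => Φ.m (r τ) + Φ.m (next (r τ)), fun s => ?_⟩
    dsimp only
    rcases edge_eq_iff.1 (hr (T.edge s)).symm with h | h
    · rw [h]
    · rw [h]
      by_cases hs : T.Interior s
      · have h1 := Φ.rot_m s hs
        have h2 := Φ.rot_m _ (interior_glue hs)
        rw [T.glue_glue, edge_glue] at h2
        rw [h1, h2]
        abel
      · rw [not_not.1 hs]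
  have hX : ∀ s, Φ.hol ((T.initialStage L).curve s) = (Φ.F (next s))⁻¹ * Φ.F s := fun s => by
    change (Φ.F (next s))⁻¹ * 1 * Φ.F s = _
    rw [mul_one]
  refine ⟨{
    eps := fun s => σ s * σ (next s) * sideSign s
    lam := fun τ => T.x τ * T.ymon (μ τ)
    t := fun τ => -μ τ
    hol_glue := fun s hs => ?_
    hol_tri := fun s => ?_
    label_eq := fun s u => edge_eq_iff
    eps_sq := fun s => ?_
    eps_mul := fun s => ?_
    ur := fun s => ?_
    order := fun τ => ?_
    cluster_inl := fun τ => ?_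
    cluster_inr := fun ρ => rfl
    B_inl := fun i j => (adj_edge i j).symm
    B_inr := fun s hs ρ => ?_ }⟩
  · have hs : T.Interior s := hs
    have h1 := Φ.rot_F s hs
    have h2 := Φ.rot_F _ (interior_glue hs)
    have h3 := Φ.C_glue s hs
    rw [T.glue_glue] at h2
    rw [hX, hX]
    change (Φ.F (next (T.glue s)))⁻¹ * Φ.F (T.glue s) * _ = _
    rw [← h1, ← h2, eq_inv_of_mul_eq_one_left h3]
    group
  · rw [hX, hX, hX, next_next, next_prev]
    group
  · have h1 := T.sideSign_sq s
    linear_combination sideSign s * sideSign s * (σ (next s) * σ (next s) * hσ s + hσ (next s)) + h1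
  · have h1 : (sideSign s * sideSign (next s) * sideSign (prev s) : T.Fld) = -1 := by
      obtain ⟨Δ, i⟩ := s
      fin_cases i <;> simp [sideSign, next, prev]
    simp only [next_next, next_prev]
    linear_combination (σ s * σ s) * (σ (next s) * σ (next s)) * (σ (prev s) * σ (prev s)) * h1 -
      (σ (next s) * σ (next s)) * (σ (prev s) * σ (prev s)) * hσ s -
      (σ (prev s) * σ (prev s)) * hσ (next s) - hσ (prev s)
  · rw [hX, SL2.inv_mul_apply_zero_one]
    simp only [hF]
    change _ = _ * (T.x (T.edge s) * T.ymon (μ (T.edge s)))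
    rw [hμ, ymon_add]
    linear_combination σ s * σ (next s) * T.ymon (Φ.m s) * T.ymon (Φ.m (next s)) *
      T.det_cornerVec s
  · rw [neg_neg, ← zero_add (μ τ)]
    exact (HasOrder.x τ).mul (by rw [zero_add]; exact hasOrder_ymon _)
  · change T.sqY (T.x τ) = _
    rw [sqY_x, mul_assoc, ← ymon_add, add_neg_cancel, ymon_zero, mul_one]
  · have hs : T.Interior s := hs
    change 2 * L.b ρ (T.edge s) = -∑ i, adj T.edge i (T.edge s) * (-μ i) ρ
    have hcol := adj_column T.edge (s := s) (s' := T.glue s) (Ne.symm hs) fun u => edge_eq_iff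
    have hk : ∀ a, ∑ i, kron a i * -μ i ρ = -μ a ρ := fun a => sum_kron_mul a fun i => -μ i ρ
    simp only [hcol, sub_mul, add_mul, Finset.sum_sub_distrib, Finset.sum_add_distrib,
      Pi.neg_apply, hk, hμ, Pi.add_apply, next_next, next_prev]
    have h1 := congrFun (Φ.rot_m s hs) ρ
    have h2 := congrFun (Φ.rot_m _ (interior_glue hs)) ρ
    rw [T.glue_glue, edge_glue] at h2
    simp only [Pi.add_apply] at h1 h2
    have h3 : L.b ρ (T.edge s) =
        (Pi.single (T.edge s) (L.b (T.edge s) (T.edge s)) : T.Edge → ℤ) ρ := by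
      by_cases h : ρ = T.edge s
      · rw [h, Pi.single_eq_same]
      · rw [Pi.single_eq_of_ne h, L.b_of_ne h]
    rw [← h3] at h1 h2
    linarith

end TriangulatedSurface

namespace TriangulatedSurface

variable {Tri : Type*} {T : TriangulatedSurface Tri}

/-- To prove a statement about all triangles of which two are special. -/
theorem forall_side {P : TSide Tri → Prop} {s s' : TSide Tri} (hP : ∀ t, P t → P (next t))
    (hs : P s) (hs' : P s') (ho : ∀ t : TSide Tri, t.1 ≠ s.1 → t.1 ≠ s'.1 → P t) (t : TSide Tri) :
    P t := by
  have key : ∀ {u : TSide Tri}, P u → t.1 = u.1 → P t := fun {u} hu h => by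
    rcases TSide.eq_cases h with h | h | h
    · exact h ▸ hu
    · exact h ▸ hP _ hu
    · have := hP _ (hP _ hu)
      rw [next_next] at this
      exact h ▸ this
  by_cases h : t.1 = s.1
  · exact key hs h
  by_cases h' : t.1 = s'.1
  · exact key hs' h'
  exact ho t h h'

section flip

variable [Finite Tri] {L : T.PrincipalLamination} {Φ : Framing L} {A A' : T.Stage} {s : TSide Tri}

namespace StageData

variable (D : StageData Φ A)

include D

theorem eps_ne_zero (t : TSide Tri) : D.eps t ≠ 0 := fun h => by
  have := D.eps_sq t
  simp [h] at this

theorem ur_ne_zero (t : TSide Tri) : (Φ.hol (A.curve t)).1 0 1 ≠ 0 := by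
  rw [D.ur]
  exact mul_ne_zero (D.eps_ne_zero t) (D.order _).ne_zero

theorem hol_ne_one (t : TSide Tri) : Φ.hol (A.curve t) ≠ 1 := fun h => by
  apply D.ur_ne_zero t
  rw [h]
  simp

theorem hol_mul_glue {t : TSide Tri} (ht : A.surf.Interior t) :
    Φ.hol (A.curve t) * Φ.hol (A.curve (A.surf.glue t)) = 1 := by
  have h := D.hol_glue _ (interior_glue ht)
  rwa [A.surf.glue_glue] at h

theorem eps_glue {t : TSide Tri} (ht : A.surf.Interior t) : D.eps (A.surf.glue t) = -D.eps t := by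
  have h1 : Φ.hol (A.curve (A.surf.glue t)) = (Φ.hol (A.curve t))⁻¹ :=
    eq_inv_of_mul_eq_one_left (D.hol_glue t ht)
  have h2 := D.ur (A.surf.glue t)
  rw [h1, SL2.inv_apply_zero_one, D.ur, ← (D.label_eq t _).2 (Or.inr rfl)] at h2
  refine mul_right_cancel₀ (D.order (A.label t)).ne_zero ?_
  rw [← h2, neg_mul]

/-- The relation between the normalized holonomies of the diagonals and the sides of a
quadrilateral. -/
theorem exchange (hs : A.surf.Interior s) :
    (Φ.hol (A.curve (next s)) * Φ.hol (A.curve (prev (A.surf.glue s)))).1 0 1 *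
        D.lam (A.label s) =
      -(D.eps (prev s) * D.eps (next (A.surf.glue s))) *
        (D.lam (A.label (next s)) * D.lam (A.label (next (A.surf.glue s))) +
          D.lam (A.label (prev s)) * D.lam (A.label (prev (A.surf.glue s)))) := by
  have h1 := D.hol_tri (A.surf.glue s)
  rw [eq_inv_of_mul_eq_one_left (D.hol_glue s hs)] at h1
  have h2 := SL2.pluecker (D.hol_tri s) h1
  simp only [D.ur] at h2
  have h3 := D.eps_mul s
  have h4 := D.eps_mul (A.surf.glue s)
  rw [D.eps_glue hs] at h4
  have hq := D.eps_sq
  -- The product of the three signs in each triangle is `-1`; eliminating one sign in each gives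
  -- both products in the Plücker relation the same sign, so that the exchange relation is
  -- subtraction-free.
  have e1 : D.eps (next s) = -(D.eps s * D.eps (prev s)) := by
    linear_combination D.eps s * D.eps (prev s) * h3 -
      D.eps (next s) * D.eps (prev s) * D.eps (prev s) * hq s - D.eps (next s) * hq (prev s)
  have e2 : D.eps (prev (A.surf.glue s)) = D.eps s * D.eps (next (A.surf.glue s)) := by
    linear_combination -(D.eps s * D.eps (next (A.surf.glue s))) * h4 -
      D.eps (next (A.surf.glue s)) * D.eps (next (A.surf.glue s)) *
        D.eps (prev (A.surf.glue s)) * hq s -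
      D.eps (prev (A.surf.glue s)) * hq (next (A.surf.glue s))
  rw [e1, e2] at h2
  refine mul_left_cancel₀ (D.eps_ne_zero s) ?_
  linear_combination h2

/-- The holonomies of the two orientations of the new diagonal are inverse to each other. -/
theorem hol_diagonal (hs : A.surf.Interior s) :
    Φ.hol (A.curve (next (A.surf.glue s))) * Φ.hol (A.curve (prev s)) *
      (Φ.hol (A.curve (next s)) * Φ.hol (A.curve (prev (A.surf.glue s)))) = 1 := by
  have h1 := D.hol_tri s
  have h2 := D.hol_tri (A.surf.glue s)
  rw [eq_inv_of_mul_eq_one_left (D.hol_glue s hs), mul_inv_eq_one] at h2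
  rw [← h2] at h1
  calc _ = (Φ.hol (A.curve (prev (A.surf.glue s))))⁻¹ *
      (Φ.hol (A.curve (prev (A.surf.glue s))) * Φ.hol (A.curve (next (A.surf.glue s)))) *
      (Φ.hol (A.curve (prev s)) * Φ.hol (A.curve (next s)) *
        (Φ.hol (A.curve (prev (A.surf.glue s))) * Φ.hol (A.curve (next (A.surf.glue s))))) *
      (Φ.hol (A.curve (next (A.surf.glue s))))⁻¹ := by group
    _ = 1 := by rw [h1]; group

/-- A sum of products of positive functions does not vanish, so by the exchange relation neither
does the upper right entry for the new diagonal. -/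
theorem hol_diagonal_ne_one (hs : A.surf.Interior s) :
    Φ.hol (A.curve (next s)) * Φ.hol (A.curve (prev (A.surf.glue s))) ≠ 1 := fun e => by
  have hex := D.exchange hs
  rw [e] at hex
  simp only [Matrix.SpecialLinearGroup.coe_one, ne_eq, zero_ne_one, not_false_eq_true,
    Matrix.one_apply_ne, zero_mul] at hex
  rcases mul_eq_zero.1 hex.symm with h2 | h2
  · exact mul_ne_zero (D.eps_ne_zero _) (D.eps_ne_zero _) (neg_eq_zero.1 h2)
  · exact (((D.order _).mul (D.order _)).add ((D.order _).mul (D.order _))).ne_zero h2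

theorem hol_mul_of_label_eq {u v : TSide Tri} (huv : u ≠ v) (e : A.label u = A.label v) :
    Φ.hol (A.curve u) * Φ.hol (A.curve v) = 1 := by
  rcases (D.label_eq u v).1 e with e | e
  · exact (huv e.symm).elim
  · have hu : A.surf.Interior u := fun e' => huv (by rw [e, e'])
    rw [e]
    exact D.hol_mul_glue hu

/-- If these sides were glued, their holonomies would cancel and the third side would have trivial
holonomy, although its upper right entry is nonzero. This and the next two lemmas guarantee that
nothing cancels in the column of the flipped arc. -/
theorem label_next_ne_prev (t : TSide Tri) : A.label (next t) ≠ A.label (prev t) := fun e => by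
  have h := D.hol_tri t
  rw [D.hol_mul_of_label_eq (next_ne_prev t).symm e.symm, one_mul] at h
  exact D.hol_ne_one t h

theorem label_next_ne_prev_glue (hs : A.surf.Interior s) (hne : (A.surf.glue s).1 ≠ s.1) :
    A.label (next s) ≠ A.label (prev (A.surf.glue s)) := fun e =>
  D.hol_diagonal_ne_one hs (D.hol_mul_of_label_eq (TSide.ne_of_fst_ne hne.symm rfl rfl) e)

theorem label_next_glue_ne_prev (hs : A.surf.Interior s) (hne : (A.surf.glue s).1 ≠ s.1) :
    A.label (next (A.surf.glue s)) ≠ A.label (prev s) := fun e => by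
  have h := D.hol_diagonal hs
  have h' : next (A.surf.glue s) ≠ prev s := TSide.ne_of_fst_ne hne rfl rfl
  rw [D.hol_mul_of_label_eq h' e, one_mul] at h
  exact D.hol_diagonal_ne_one hs h

theorem adj_column (hs : A.surf.Interior s) (i : T.Edge) :
    adj A.label i (A.label s) =
      kron (A.label (next s)) i + kron (A.label (next (A.surf.glue s))) i -
      (kron (A.label (prev s)) i + kron (A.label (prev (A.surf.glue s))) i) :=
  TriangulatedSurface.adj_column _ (Ne.symm hs) (fun u => D.label_eq s u) i

theorem two_mul_B_inr (hs : A.surf.Interior s) (ρ : T.Edge) :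
    2 * A.seed.B (Sum.inr ρ) (A.label s) =
      -(D.t (A.label (next s)) ρ + D.t (A.label (next (A.surf.glue s))) ρ -
        (D.t (A.label (prev s)) ρ + D.t (A.label (prev (A.surf.glue s))) ρ)) := by
  let := Fintype.ofFinite T.Edge
  have hk : ∀ a, ∑ i, kron a i * D.t i ρ = D.t a ρ := fun a => sum_kron_mul a fun i => D.t i ρ
  rw [D.B_inr s hs]
  simp only [D.adj_column hs, sub_mul, add_mul, Finset.sum_sub_distrib, Finset.sum_add_distrib, hk]

/-- The tropical weight of the new diagonal. -/
def newWeight (D : StageData Φ A) (s : TSide Tri) (ρ : T.Edge) : ℤ :=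
  max (D.t (A.label (next s)) ρ + D.t (A.label (next (A.surf.glue s))) ρ)
    (D.t (A.label (prev s)) ρ + D.t (A.label (prev (A.surf.glue s))) ρ) - D.t (A.label s) ρ

/-- The normalized lambda length of the new diagonal. -/
def newLam (D : StageData Φ A) (s : TSide Tri) : T.Fld :=
  (D.lam (A.label (next s)) * D.lam (A.label (next (A.surf.glue s))) +
    D.lam (A.label (prev s)) * D.lam (A.label (prev (A.surf.glue s)))) / D.lam (A.label s)

/-- Orders are `-t`, so the minimum for the sum of two products becomes the maximum in `newWeight`.
-/
theorem hasOrder_newLam : HasOrder (D.newLam s) (-D.newWeight s) := by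
  have h := (((D.order (A.label (next s))).mul (D.order (A.label (next (A.surf.glue s))))).add
    ((D.order (A.label (prev s))).mul (D.order (A.label (prev (A.surf.glue s)))))).div
    (D.order (A.label s))
  refine (congrArg (HasOrder _) ?_).mp h
  funext ρ
  simp only [newWeight, Pi.sub_apply, Pi.neg_apply, Pi.add_apply]
  omega

/-- The row relation makes the coefficients in the two exchange monomials fill up the exponents of
both terms to their common maximum. The monomial in the `y` then factors out, and the exchange
relation of lambda lengths remains. -/
theorem cluster_mutate (hs : A.surf.Interior s) (hne : (A.surf.glue s).1 ≠ s.1) :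
    T.sqY ((A.seed.mutate (A.label s)).cluster (Sum.inl (A.label s))) =
      D.newLam s * T.ymon (D.newWeight s) := by
  have h1 := D.label_next_ne_prev s
  have h2 := D.label_next_ne_prev_glue hs hne
  have h3 := D.label_next_glue_ne_prev hs hne
  have h4 := D.label_next_ne_prev (A.surf.glue s)
  let := Fintype.ofFinite T.Var
  rw [Seed.mutate]
  simp only [if_true]
  rw [map_div₀, map_add, sqY_prod_cluster D.cluster_inl D.cluster_inr _ (A.label (next s))
    (A.label (next (A.surf.glue s))), sqY_prod_cluster D.cluster_inl D.cluster_inr _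
    (A.label (prev s)) (A.label (prev (A.surf.glue s))), D.cluster_inl]
  · have e1 : (D.t (A.label (next s)) + D.t (A.label (next (A.surf.glue s))) +
        fun ρ => 2 * ((A.seed.B (Sum.inr ρ) (A.label s)).toNat : ℤ)) =
        D.newWeight s + D.t (A.label s) := by
      funext ρ
      have := D.two_mul_B_inr hs ρ
      simp only [newWeight, Pi.add_apply]
      omega
    have e2 : (D.t (A.label (prev s)) + D.t (A.label (prev (A.surf.glue s))) +
        fun ρ => 2 * ((-A.seed.B (Sum.inr ρ) (A.label s)).toNat : ℤ)) =
        D.newWeight s + D.t (A.label s) := by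
      funext ρ
      have := D.two_mul_B_inr hs ρ
      simp only [newWeight, Pi.add_apply]
      omega
    rw [e1, e2, ymon_add, newLam]
    have := (D.order (A.label s)).ne_zero
    have := ymon_ne_zero (T := T) (D.t (A.label s))
    field_simp
  · intro i
    rw [D.B_inl, D.adj_column hs, Int.ofNat_toNat, max_neg_sub_kron h1 h2 h3 h4]
  · intro i
    rw [D.B_inl, D.adj_column hs, Int.ofNat_toNat, max_sub_kron h1 h2 h3 h4]

end StageData

end flip

end TriangulatedSurface

namespace TriangulatedSurface

variable {Tri : Type*} {T : TriangulatedSurface Tri} [Finite Tri] {L : T.PrincipalLamination}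
  {Φ : Framing L} {A A' : T.Stage} {s : TSide Tri}

/-- The relation between seeds and normalized holonomies persists in a flip. -/
theorem StageData.flip (D : StageData Φ A) (h : IsFlip A A' s) : Nonempty (StageData Φ A') := by
  classical
  let := Fintype.ofFinite T.Edge
  obtain ⟨hne, hglue, hlabel, hcurve, hc, hc', hseed⟩ := h
  have hs : A.surf.Interior s := fun e => hne (by rw [e])
  have l1 := D.label_next_ne_prev s
  have l2 := D.label_next_ne_prev_glue hs hne
  have l3 := D.label_next_glue_ne_prev hs hne
  have l4 := D.label_next_ne_prev (A.surf.glue s)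
  have hdiag := D.hol_diagonal hs
  have hεg := D.eps_glue hs
  have hlab : ∀ u, A.label s = A.label u ↔ u = s ∨ u = A.surf.glue s := fun u => D.label_eq s u
  have hcl := D.cluster_mutate hs hne
  have hord := D.hasOrder_newLam (s := s)
  obtain ⟨w, hw⟩ : ∃ w, w = D.newWeight s := ⟨_, rfl⟩
  obtain ⟨ν, hν⟩ : ∃ ν, ν = D.newLam s := ⟨_, rfl⟩
  have hνex : (Φ.hol (A.curve (next s)) * Φ.hol (A.curve (prev (A.surf.glue s)))).1 0 1 =
      -(D.eps (prev s) * D.eps (next (A.surf.glue s))) * ν := by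
    rw [hν, newLam, ← mul_div_assoc, ← D.exchange hs, mul_div_cancel_right₀ _ (D.order _).ne_zero]
  -- The row relation after the flip: its coefficient mutation and the mutation of signed adjacency
  -- combine in `row_mutation`, with the new weight at the flipped label only.
  have hrow : ∀ j ρ, 2 * A.seed.B (Sum.inr ρ) j = -∑ i, adj A.label i j * D.t i ρ →
      2 * (A.seed.mutate (A.label s)).B (Sum.inr ρ) j =
        -∑ i, adj (fun t => A.label (flipPos s (A.surf.glue s) t)) i j *
          Function.update D.t (A.label s) w i ρ := by
    intro j ρ hj
    have hk : ∀ a, ∑ i, kron a i * D.t i ρ = D.t a ρ := fun a => sum_kron_mul a fun i => D.t i ρ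
    have hrm := row_mutation (B := adj A.label)
      (B' := adj fun t => A.label (flipPos s (A.surf.glue s) t))
      (b := fun j => A.seed.B (Sum.inr ρ) j) (t := fun i => D.t i ρ) (k := A.label s)
      (adj_self _ _)
      (Mp := D.t (A.label (next s)) ρ + D.t (A.label (next (A.surf.glue s))) ρ)
      (Mm := D.t (A.label (prev s)) ρ + D.t (A.label (prev (A.surf.glue s))) ρ)
      (by simp only [D.adj_column hs, max_sub_kron l1 l2 l3 l4, add_mul, Finset.sum_add_distrib, hk])
      (by simp only [D.adj_column hs, max_neg_sub_kron l1 l2 l3 l4, add_mul,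
            Finset.sum_add_distrib, hk])
      (D.B_inr s hs ρ) hj (fun i j => adj_flip_eq_mutation A.label hne hlab l1 l2 l3 l4 i j)
    refine Eq.trans ?_ (hrm.trans ?_)
    · simp only [Seed.mutate, reduceCtorEq, false_or, D.B_inl]
    · congr 1
      refine Finset.sum_congr rfl fun i _ => ?_
      congr 1
      by_cases hi : i = A.label s
      · rw [if_pos hi, hi, Function.update_self, hw]
        rfl
      · rw [if_neg hi, Function.update_of_ne hi]
  rw [← hν, ← hw] at hcl hord
  have hgl : ∀ t, A.surf.Interior t →
    Φ.hol (A.curve (A.surf.glue t)) * Φ.hol (A.curve t) = 1 := D.hol_glue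
  obtain ⟨s', hs'⟩ : ∃ s', s' = A.surf.glue s := ⟨_, rfl⟩
  simp only [← hs'] at hne hglue hlabel hcurve hc hc' l2 l3 l4 hdiag hlab hεg hrow hνex
  set X : TSide Tri → T.SL2 := fun t => Φ.hol (A.curve t) with hX
  set X' : TSide Tri → T.SL2 := fun t => Φ.hol (A'.curve t) with hX'
  set π := flipPos s s' with hπ
  have hinj : Function.Injective π := flipPos_injective hne
  have πs : π s = s := flipPos_self hne
  have πs' : π s' = s' := flipPos_other hne
  have πn : π (next s) = prev s := flipPos_next
  have πp : π (prev s) = next s' := flipPos_prev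
  have πn' : π (next s') = prev s' := flipPos_next' hne
  have πp' : π (prev s') = next s := flipPos_prev' hne
  have πo : ∀ t : TSide Tri, t.1 ≠ s.1 → t.1 ≠ s'.1 → π t = t := fun t => flipPos_of_fst_ne
  have Xs : X' s = X (next s) * X (prev s') := Φ.hol_isConcat hc
  have Xs' : X' s' = X (next s') * X (prev s) := Φ.hol_isConcat hc'
  have Xo : ∀ t, t ≠ s → t ≠ s' → X' t = X (π t) := fun t h1 h2 =>
    congrArg Φ.hol (hcurve t h1 h2)
  have n1 : next s ≠ s := next_ne s
  have n2 : prev s ≠ s := prev_ne s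
  have n3 : next s' ≠ s' := next_ne s'
  have n4 : prev s' ≠ s' := prev_ne s'
  have n5 : next s ≠ s' := TSide.ne_of_fst_ne hne.symm rfl rfl
  have n6 : prev s ≠ s' := TSide.ne_of_fst_ne hne.symm rfl rfl
  have n7 : next s' ≠ s := TSide.ne_of_fst_ne hne rfl rfl
  have n8 : prev s' ≠ s := TSide.ne_of_fst_ne hne rfl rfl
  have hss : s' ≠ s := TSide.ne_of_fst_ne hne rfl rfl
  have hno : ∀ {t u : TSide Tri}, t.1 ≠ u.1 → t ≠ u := fun h => TSide.ne_of_fst_ne h rfl rfl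
  have hgs : A'.surf.glue s = s' := hinj (by rw [hglue, πs, πs', hs'])
  have hgs' : A'.surf.glue s' = s := by rw [← hgs, A'.surf.glue_glue]
  have hint : ∀ t, A'.surf.Interior t → A.surf.Interior (π t) := fun t ht e => ht (hinj (by
    rw [hglue, e]))
  have hlab' : ∀ t u, A'.label t = A'.label u ↔ u = t ∨ u = A'.surf.glue t := fun t u => by
    rw [hlabel, hlabel, D.label_eq, ← hglue, hinj.eq_iff, hinj.eq_iff]
  have hlabs : A'.label s = A.label s := by rw [hlabel, πs]
  have hlabs' : A'.label s' = A.label s := by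
    rw [hlabel, πs']; exact ((hlab s').2 (Or.inr rfl)).symm
  have hlabk : ∀ {t}, t ≠ s → t ≠ s' → A'.label t ≠ A.label s := fun {t} h1 h2 e => by
    rw [← hlabs] at e
    rcases (hlab' s t).1 e.symm with e | e
    · exact h1 e
    · exact h2 (e.trans hgs)
  have hlabf : A'.label = fun t => A.label (π t) := funext hlabel
  -- The sign at `s` is dictated by the exchange relation. The other orientation of the diagonal has
  -- the inverse holonomy, hence the opposite sign, and the outer sides keep theirs.
  let eps' : TSide Tri → T.Fld := fun t =>
    if t = s then -(D.eps (prev s) * D.eps (next s'))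
    else if t = s' then D.eps (prev s) * D.eps (next s') else D.eps (π t)
  have Es : eps' s = -(D.eps (prev s) * D.eps (next s')) := if_pos rfl
  have Es' : eps' s' = D.eps (prev s) * D.eps (next s') := by simp [eps', hss]
  have Eo : ∀ t, t ≠ s → t ≠ s' → eps' t = D.eps (π t) := fun t h1 h2 => by simp [eps', h1, h2]
  have hq := D.eps_sq
  refine ⟨{
    eps := eps'
    lam := Function.update D.lam (A.label s) ν
    t := Function.update D.t (A.label s) w
    hol_glue := fun t ht => ?_
    hol_tri := ?_
    label_eq := hlab'
    eps_sq := fun t => ?_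
    eps_mul := ?_
    ur := fun t => ?_
    order := fun i => ?_
    cluster_inl := fun i => ?_
    cluster_inr := fun ρ => ?_
    B_inl := fun i j => ?_
    B_inr := fun t ht ρ => ?_ }⟩
  · change X' (A'.surf.glue t) * X' t = 1
    by_cases h1 : t = s
    · rw [h1, hgs, Xs, Xs']
      exact hdiag
    by_cases h2 : t = s'
    · rw [h2, hgs', Xs, Xs']
      exact mul_eq_one_comm.1 hdiag
    rw [Xo t h1 h2, Xo, hglue]
    · exact hgl _ (hint t ht)
    · exact fun e => h2 (by rw [← A'.surf.glue_glue t, e, hgs])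
    · exact fun e => h1 (by rw [← A'.surf.glue_glue t, e, hgs'])
  · change ∀ t, X' (prev t) * X' (next t) * X' t = 1
    refine forall_side (s := s) (s' := s') (fun t ht => ?_) ?_ ?_ fun t h1 h2 => ?_
    · rw [prev_next, next_next, mul_assoc]
      exact mul_eq_one_comm.1 ht
    · rw [Xo _ n2 n6, Xo _ n1 n5, Xs, πp, πn]
      exact hdiag
    · rw [Xo _ n8 n4, Xo _ n7 n3, Xs', πp', πn']
      exact mul_eq_one_comm.1 hdiag
    · rw [Xo t (hno h1) (hno h2), Xo (next t) (hno h1) (hno h2),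
        Xo (prev t) (hno h1) (hno h2), πo t h1 h2,
        πo (next t) h1 h2, πo (prev t) h1 h2]
      exact D.hol_tri t
  · by_cases h1 : t = s
    · rw [h1, Es]
      linear_combination D.eps (next s') * D.eps (next s') * hq (prev s) + hq (next s')
    by_cases h2 : t = s'
    · rw [h2, Es']
      linear_combination D.eps (next s') * D.eps (next s') * hq (prev s) + hq (next s')
    rw [Eo t h1 h2]
    exact hq _
  · refine forall_side (s := s) (s' := s') (fun t ht => ?_) ?_ ?_ fun t h1 h2 => ?_
    · rw [prev_next, next_next]
      linear_combination ht
    · rw [Eo _ n2 n6, Eo _ n1 n5, Es, πp, πn]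
      linear_combination -(D.eps (next s') * D.eps (next s')) * hq (prev s) - hq (next s')
    · rw [Eo _ n8 n4, Eo _ n7 n3, Es', πp', πn']
      have h3 := D.eps_mul s
      have h4 := D.eps_mul s'
      rw [hεg] at h4
      linear_combination -(D.eps (prev s) * D.eps (next s') * D.eps (prev s') * D.eps (next s)) *
        hq s + D.eps s * D.eps (next s') * D.eps (prev s') * h3 + h4
    · rw [Eo t (hno h1) (hno h2), Eo (next t) (hno h1) (hno h2),
        Eo (prev t) (hno h1) (hno h2), πo t h1 h2,
        πo (next t) h1 h2, πo (prev t) h1 h2]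
      exact D.eps_mul t
  · change (X' t).1 0 1 = _
    by_cases h1 : t = s
    · rw [h1, hlabs, Function.update_self, Es, Xs]
      exact hνex
    by_cases h2 : t = s'
    · rw [h2, hlabs', Function.update_self, Es', Xs', eq_inv_of_mul_eq_one_left hdiag,
        SL2.inv_apply_zero_one, hνex]
      ring
    · rw [Function.update_of_ne (hlabk h1 h2), Eo t h1 h2, Xo t h1 h2, hlabel]
      exact D.ur _
  · by_cases h1 : i = A.label s
    · rw [h1, Function.update_self, Function.update_self]
      exact hord
    · rw [Function.update_of_ne h1, Function.update_of_ne h1]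
      exact D.order i
  · rw [hseed]
    by_cases h1 : i = A.label s
    · rw [h1, Function.update_self, Function.update_self]
      exact hcl
    · rw [Function.update_of_ne h1, Function.update_of_ne h1, ← D.cluster_inl]
      simp [Seed.mutate, h1]
  · rw [hseed, ← D.cluster_inr]
    simp [Seed.mutate]
  · rw [hseed, hlabf, hπ, adj_flip_eq_mutation A.label hne hlab l1 l2 l3 l4 i j]
    simp only [Seed.mutate, Sum.inl.injEq, D.B_inl]
  · rw [hseed, hlabf]
    exact hrow _ ρ (D.B_inr _ (hint t ht) ρ)

theorem exists_stageData {A : T.Stage} (hA : T.Reachable L A) (Φ : Framing L) :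
    Nonempty (StageData Φ A) := by
  induction hA with
  | refl => exact exists_stageData_initial Φ
  | tail _ h ih =>
    obtain ⟨D⟩ := ih
    obtain ⟨s, hs⟩ := h
    exact D.flip hs

/-- Cluster variables are given by snake graph expansions. -/
theorem IsClusterVariable.eq_snakeExpansion {γ : T.ArcCurve} (hγ : T.IsGeneralizedArc γ) {z : T.Fld}
    (h : T.IsClusterVariable L γ z) : z = T.snakeExpansion L γ := by
  obtain ⟨A, hA, s, hs, rfl⟩ := h
  obtain ⟨Φ⟩ := exists_framing L
  obtain ⟨D⟩ := exists_stageData hA Φ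
  -- The cluster variable and the expansion are both of order zero and both come from the upper
  -- right entry of the holonomy of `γ`.
  refine eq_of_eqNeg_ymon (u := (Φ.hol γ).1 0 1) (e := D.t (A.label s)) ?_
    (hasOrder_snakeExpansion L hγ) ?_ (Φ.sqY_snakeExpansion hγ)
  · have := (D.order (A.label s)).mul (hasOrder_ymon (D.t (A.label s)))
    rwa [neg_add_cancel, ← D.cluster_inl] at this
  · rw [D.cluster_inl, ← Φ.hol_arcHomotopic hs, D.ur]
    rcases mul_self_eq_one_iff.1 (D.eps_sq s) with h | h
    · rw [h]; exact Or.inl (by ring)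
    · rw [h]; exact Or.inr (by ring)

end TriangulatedSurface

end

theorem mainTheorem3 {Tri : Type*} [Finite Tri] (T : TriangulatedSurface Tri)
    (L : T.PrincipalLamination) :
    (∀ γ : T.ArcCurve, T.IsGeneralizedArc γ →
      (∃ ρ, T.IsMPathOfArc ρ γ) ∧
      ∀ ρ, T.IsMPathOfArc ρ γ →
        T.chiArc L ρ = T.snakeExpansion L γ ∧
        T.IsPositiveLaurent (T.chiArc L ρ) ∧
        ∀ z, T.IsClusterVariable L γ z → z = T.chiArc L ρ) ∧
    (∀ γ : T.LoopCurve, T.IsClosedLoop γ →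
      (∃ ρ, T.IsMPathOfLoop ρ γ) ∧
      ∀ ρ, T.IsMPathOfLoop ρ γ →
        T.chiLoop L ρ = T.bandExpansion L γ ∧
        T.IsPositiveLaurent (T.chiLoop L ρ)) := by
  refine ⟨fun γ hγ => ⟨T.exists_isMPathOfArc γ, fun ρ hρ => ?_⟩,
    fun γ hγ => ⟨T.exists_isMPathOfLoop γ, fun ρ hρ => ?_⟩⟩
  · rw [TriangulatedSurface.chiArc_eq hγ hρ]
    exact ⟨rfl, TriangulatedSurface.isPositiveLaurent_snakeExpansion L γ,
      fun z hz => hz.eq_snakeExpansion hγ⟩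
  · rw [TriangulatedSurface.chiLoop_eq hγ hρ]
    exact ⟨rfl, TriangulatedSurface.isPositiveLaurent_bandExpansion L γ⟩
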